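/- **Setting.** Let $d,\ell\ge 1$. A $C^1$ IFS on a nonempty compact set $X\subset\mathbb R^d$ is a family of maps $S_1,\dots,S_\ell:X\to X$ such that, for some open set $U\supset X$, each $S_i$ extends to a $C^1$-diffeomorphism $S_i:U\to S_i(U)\subset U$ that is contracting, i.e. $|S_i(x)-S_i(y)|\le c_i|x-y|$ on $U$ for some $c_i<1$. Let $K\subset X$ be its attractor, the unique nonempty compact set $K\subset X$ with $K=\bigcup_i S_i(K)$. No separation condition is assumed. Let $\Sigma=\{1,\dots,\ell\}^{\mathbb N}$ with the left shift $\sigma$, write $S_{x_1\ldots x_n}=S_{x_1}\circ\cdots\circ S_{x_n}$, and let $\pi:\Sigma\to K$ be given by $\{\pi(x)\}=\bigcap_{n} S_{x_1\ldots x_n}(K)$. For $x\in\Sigma$ the upper and lower Lyapunov exponents are $$\overline\lambda(x)=-\liminf_{n\to\infty}\tfrac1n\log [\![S'_{x_1\ldots x_n}(\pi\sigma^nx)]\!],\qquad \underline\lambda(x)=-\limsup_{n\to\infty}\tfrac1n\log\|S'_{x_1\ldots x_n}(\pi\sigma^nx)\|,$$ where $\|M\|$ is the operator norm and $[\![M]\!]=\min_{|v|=1}|Mv|$.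 If they agree, $\lambda(x)$ denotes the common value. For a $\sigma$-invariant Borel probability measure $m$ on $\Sigma$, the IFS is called $m$-conformal if $\overline\lambda(x)=\underline\lambda(x)$ for $m$-a.e. $x$. It is called weakly conformal if $\frac1n\big(\log[\![S'_{x_1\ldots x_n}(\pi\sigma^nx)]\!]-\log\|S'_{x_1\ldots x_n}(\pi\sigma^nx)\|\big)\to0$ uniformly on $\Sigma$. Let $\mathcal P$ be the partition of $\Sigma$ according to the first symbol, $\gamma$ the Borel $\sigma$-algebra of $\mathbb R^d$, and $\mathcal I=\{B\subset\Sigma\text{ Borel}:\sigma^{-1}B=B\}$. For a sub-$\sigma$-algebra $\mathcal A$ put $\mathbf I_m(\mathcal P|\mathcal A)=-\sum_{A\in\mathcal P}\chi_A\log\mathbf E_m(\chi_A|\mathcal A)$ and $H_m(\mathcal P|\mathcal A)=\int\mathbf I_m(\mathcal P|\mathcal A)\,dm$. The projection entropy and the local projection entropy are $$h_\pi(\sigma,m)=H_m(\mathcal P|\sigma^{-1}\pi^{-1}\gamma)-H_m(\mathcal P|\pi^{-1}\gamma),$$ $$h_\pi(\sigma,m,x)=\mathbf E_m\big(\mathbf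 I_m(\mathcal P|\sigma^{-1}\pi^{-1}\gamma)-\mathbf I_m(\mathcal P|\pi^{-1}\gamma)\,\big|\,\mathcal I\big)(x).$$ For a probability measure $\mu$ on $\mathbb R^d$, the local dimension is $d(\mu,z)=\lim_{r\to0}\frac{\log\mu(B(z,r))}{\log r}$ when the limit exists, with $B(z,r)$ the closed ball. **Theorem.** Let $\{S_i\}_{i=1}^\ell$ be a $C^1$ IFS. 1. Let $m$ be a $\sigma$-invariant Borel probability measure on $\Sigma$ for which the IFS is $m$-conformal, and let $\mu=m\circ\pi^{-1}$. Then the two information functions above are $m$-integrable, $\lambda$ is $m$-integrable with $0<\lambda(x)<\infty$ for $m$-a.e. $x$, and for $m$-a.e. $x\in\Sigma$ the local dimension of $\mu$ at $\pi x$ exists and $$d(\mu,\pi x)=\frac{h_\pi(\sigma,m,x)}{\lambda(x)}.$$ If moreover $m$ is ergodic, then $\mu$ is exactly dimensional: for $\mu$-a.e. $z$ the local dimension exists and $$d(\mu,z)=\frac{h_\pi(\sigma,m)}{\int\lambda\,dm}.$$ 2. If the IFS is weakly conformal, then it is $m$-conformal for every $\sigma$-invariant Borel probability measure $m$ on $\Sigma$;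 so part 1 applies to every such $m$. -/

import Mathlib

open Filter Topology MeasureTheory ProbabilityTheory Set

noncomputable section

/-! ### The one-sided full shift -/

/-- The one-sided full shift space over `ℓ` symbols (coordinates are indexed from `0`), with the
product topology and the product (that is, Borel) sigma-algebra. -/
abbrev SymbolSpace (ℓ : ℕ) : Type := ℕ → Fin ℓ

/-- The left shift. -/
def leftShift {ℓ : ℕ} (x : SymbolSpace ℓ) : SymbolSpace ℓ := fun n => x (n + 1)

/-- `m` is a shift-invariant Borel probability measure. -/
def IsInvariantMeasure {ℓ : ℕ} (m : Measure (SymbolSpace ℓ)) : Prop :=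
  IsProbabilityMeasure m ∧ MeasurePreserving leftShift m m

/-- The partition of the shift space according to the first symbol. -/
def firstCylinder {ℓ : ℕ} (j : Fin ℓ) : Set (SymbolSpace ℓ) := {x | x 0 = j}

/-! ### Conditional information and conditional entropy -/

/-- The conditional information of the finite partition `ξ` given the sigma-algebra `𝒜`:
`- ∑_{A ∈ ξ} χ_A log E(χ_A | 𝒜)`. -/
def condInformation {Ω ι : Type*} [Fintype ι] (𝒜 : MeasurableSpace Ω)
    [MeasurableSpace Ω] (ν : Measure Ω) (ξ : ι → Set Ω) : Ω → ℝ :=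
  fun x => - ∑ i, (ξ i).indicator (fun y => Real.log ((ν⟦ξ i | 𝒜⟧) y)) x

/-- The conditional entropy of the finite partition `ξ` given the sigma-algebra `𝒜`. -/
def condEntropy {Ω ι : Type*} [Fintype ι] (𝒜 : MeasurableSpace Ω)
    [MeasurableSpace Ω] (ν : Measure Ω) (ξ : ι → Set Ω) : ℝ :=
  ∫ x, condInformation 𝒜 ν ξ x ∂ν

/-! ### Local dimensions -/

/-- The upper local dimension of `μ` at `z`, computed in the extended reals. -/
def upperLocalDim {d : ℕ} (μ : Measure (EuclideanSpace ℝ (Fin d)))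
    (z : EuclideanSpace ℝ (Fin d)) : EReal :=
  limsup (fun r : ℝ => ENNReal.log (μ (Metric.closedBall z r)) / (Real.log r : EReal)) (𝓝[>] 0)

/-- The lower local dimension of `μ` at `z`, computed in the extended reals. -/
def lowerLocalDim {d : ℕ} (μ : Measure (EuclideanSpace ℝ (Fin d)))
    (z : EuclideanSpace ℝ (Fin d)) : EReal :=
  liminf (fun r : ℝ => ENNReal.log (μ (Metric.closedBall z r)) / (Real.log r : EReal)) (𝓝[>] 0)

/-- The local dimension of `μ` at `z` exists and equals the real number `s`. -/
def HasLocalDim {d : ℕ} (μ : Measure (EuclideanSpace ℝ (Fin d)))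
    (z : EuclideanSpace ℝ (Fin d)) (s : ℝ) : Prop :=
  lowerLocalDim μ z = (s : EReal) ∧ upperLocalDim μ z = (s : EReal)

/-! ### `C¹` iterated function systems -/

/-- A `C¹` iterated function system of `ℓ` maps on a nonempty compact set `X ⊆ ℝᵈ`: each map sends
`X` into `X`, and it is a contracting `C¹` diffeomorphism of an open set `U ⊇ X` onto its image,
which lies in `U`.  (The maps are total functions; only their values on `U` matter.) -/
structure C1IFS (d ℓ : ℕ) where
  X : Set (EuclideanSpace ℝ (Fin d))
  U : Set (EuclideanSpace ℝ (Fin d))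
  map : Fin ℓ → EuclideanSpace ℝ (Fin d) → EuclideanSpace ℝ (Fin d)
  nonempty_X : X.Nonempty
  isCompact_X : IsCompact X
  isOpen_U : IsOpen U
  X_subset_U : X ⊆ U
  mapsTo_X : ∀ i, MapsTo (map i) X X
  mapsTo_U : ∀ i, MapsTo (map i) U U
  contDiffOn : ∀ i, ContDiffOn ℝ 1 (map i) U
  injOn : ∀ i, InjOn (map i) U
  isInvertible_fderiv : ∀ i, ∀ x ∈ U, (fderiv ℝ (map i) x).IsInvertible
  contracting : ∀ i, ∃ c : ℝ, 0 ≤ c ∧ c < 1 ∧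
    ∀ x ∈ U, ∀ y ∈ U, dist (map i x) (map i y) ≤ c * dist x y

namespace C1IFS

variable {d ℓ : ℕ} (Φ : C1IFS d ℓ)

/-- The composition `S_{x₁} ∘ S_{x₂} ∘ ⋯ ∘ S_{xₙ}`. -/
def word : ℕ → SymbolSpace ℓ → EuclideanSpace ℝ (Fin d) → EuclideanSpace ℝ (Fin d)
  | 0, _ => id
  | n + 1, x => Φ.map (x 0) ∘ word n (leftShift x)

/-- `K` is a nonempty compact subset of `X` with `K = ⋃ᵢ Sᵢ(K)`. -/
def IsAttractor (K : Set (EuclideanSpace ℝ (Fin d))) : Prop :=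
  K.Nonempty ∧ IsCompact K ∧ K ⊆ Φ.X ∧ K = ⋃ i, Φ.map i '' K

theorem continuous_leftShift : Continuous (leftShift : SymbolSpace ℓ → SymbolSpace ℓ) :=
  continuous_pi fun n => continuous_apply (n + 1)

theorem exists_common_ratio : ∃ c : ℝ, 0 ≤ c ∧ c < 1 ∧
    ∀ i, ∀ x ∈ Φ.X, ∀ y ∈ Φ.X, dist (Φ.map i x) (Φ.map i y) ≤ c * dist x y := by
  choose c h0 h1 h2 using Φ.contracting
  rcases isEmpty_or_nonempty (Fin ℓ) with h | h
  · exact ⟨0, le_rfl, one_pos, fun i => (h.false i).elim⟩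
  · obtain ⟨j, hj⟩ := Finite.exists_max c
    refine ⟨c j, h0 j, h1 j, fun i x hx y hy => ?_⟩
    exact (h2 i x (Φ.X_subset_U hx) y (Φ.X_subset_U hy)).trans
      (mul_le_mul_of_nonneg_right (hj i) dist_nonneg)

theorem word_mem (n : ℕ) : ∀ x : SymbolSpace ℓ, MapsTo (Φ.word n x) Φ.X Φ.X := by
  induction n with
  | zero => intro x p hp; exact hp
  | succ n ih => intro x p hp; exact Φ.mapsTo_X _ (ih _ hp)

theorem dist_word_le {c : ℝ} (h0 : 0 ≤ c)
    (hc : ∀ i, ∀ x ∈ Φ.X, ∀ y ∈ Φ.X, dist (Φ.map i x) (Φ.map i y) ≤ c * dist x y) (n : ℕ) :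
    ∀ x : SymbolSpace ℓ, ∀ p ∈ Φ.X, ∀ q ∈ Φ.X,
      dist (Φ.word n x p) (Φ.word n x q) ≤ c ^ n * dist p q := by
  induction n with
  | zero => intro x p _ q _; simp [word]
  | succ n ih =>
    intro x p hp q hq
    refine (hc _ _ (Φ.word_mem n _ hp) _ (Φ.word_mem n _ hq)).trans ?_
    rw [pow_succ', mul_assoc]
    exact mul_le_mul_of_nonneg_left (ih _ p hp q hq) h0

theorem word_succ' (n : ℕ) : ∀ (x : SymbolSpace ℓ) (p : EuclideanSpace ℝ (Fin d)),
    Φ.word (n + 1) x p = Φ.word n x (Φ.map (x n) p) := by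
  induction n with
  | zero => intro x p; rfl
  | succ n ih =>
    intro x p
    change Φ.map (x 0) (Φ.word (n + 1) (leftShift x) p) = _
    rw [ih]
    rfl

theorem isLocallyConstant_word (p : EuclideanSpace ℝ (Fin d)) (n : ℕ) :
    IsLocallyConstant (fun x : SymbolSpace ℓ => Φ.word n x p) := by
  induction n with
  | zero => exact IsLocallyConstant.const p
  | succ n ih =>
    have h1 : IsLocallyConstant (fun x : SymbolSpace ℓ => x 0) :=
      (IsLocallyConstant.iff_continuous _).2 (continuous_apply 0)
    have h2 : IsLocallyConstant (fun x : SymbolSpace ℓ => Φ.word n (leftShift x) p) :=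
      ih.comp_continuous continuous_leftShift
    exact h1.comp₂ h2 (fun i q => Φ.map i q)

theorem IsAttractor.subset {Φ : C1IFS d ℓ} {K L : Set (EuclideanSpace ℝ (Fin d))}
    (hK : Φ.IsAttractor K) (hL : Φ.IsAttractor L) : K ⊆ L := by
  obtain ⟨c, h0, h1, hc⟩ := Φ.exists_common_ratio
  obtain ⟨q, hq⟩ := hL.1
  have key : ∀ n : ℕ, ∀ x ∈ K, ∃ y ∈ L, dist x y ≤ c ^ n * Metric.diam Φ.X := by
    intro n
    induction n with
    | zero =>
      intro x hx
      refine ⟨q, hq, ?_⟩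
      simpa using Metric.dist_le_diam_of_mem Φ.isCompact_X.isBounded (hK.2.2.1 hx) (hL.2.2.1 hq)
    | succ n ih =>
      intro x hx
      rw [hK.2.2.2] at hx
      obtain ⟨i, x', hx', rfl⟩ := mem_iUnion.1 hx
      obtain ⟨y', hy', hd⟩ := ih x' hx'
      refine ⟨Φ.map i y', ?_, ?_⟩
      · rw [hL.2.2.2]
        exact mem_iUnion.2 ⟨i, y', hy', rfl⟩
      · refine (hc i _ (hK.2.2.1 hx') _ (hL.2.2.1 hy')).trans ?_
        rw [pow_succ', mul_assoc]
        exact mul_le_mul_of_nonneg_left hd h0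
  intro x hx
  rw [← hL.2.1.isClosed.closure_eq, Metric.mem_closure_iff]
  intro ε hε
  have ht : Tendsto (fun n : ℕ => c ^ n * Metric.diam Φ.X) atTop (𝓝 0) := by
    simpa using (tendsto_pow_atTop_nhds_zero_of_lt_one h0 h1).mul_const (Metric.diam Φ.X)
  obtain ⟨n, hn⟩ := (ht.eventually (gt_mem_nhds hε)).exists
  obtain ⟨y, hy, hd⟩ := key n x hx
  exact ⟨y, hy, hd.trans_lt hn⟩

theorem exists_isAttractor [NeZero ℓ] : ∃ K, Φ.IsAttractor K := by
  obtain ⟨c, h0, h1, hc⟩ := Φ.exists_common_ratio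
  obtain ⟨p, hp⟩ := Φ.nonempty_X
  have hstep : ∀ (x : SymbolSpace ℓ) (n : ℕ),
      dist (Φ.word n x p) (Φ.word (n + 1) x p) ≤ Metric.diam Φ.X * c ^ n := by
    intro x n
    rw [word_succ', mul_comm]
    refine (Φ.dist_word_le h0 hc n x p hp _ (Φ.mapsTo_X _ hp)).trans ?_
    exact mul_le_mul_of_nonneg_left
      (Metric.dist_le_diam_of_mem Φ.isCompact_X.isBounded hp (Φ.mapsTo_X _ hp)) (pow_nonneg h0 n)
  have hlim : ∀ x : SymbolSpace ℓ, ∃ z, Tendsto (fun n => Φ.word n x p) atTop (𝓝 z) :=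
    fun x => cauchySeq_tendsto_of_complete (cauchySeq_of_le_geometric c _ h1 (hstep x))
  choose g hg using hlim
  have hgX : ∀ x, g x ∈ Φ.X := fun x =>
    Φ.isCompact_X.isClosed.mem_of_tendsto (hg x)
      (Eventually.of_forall fun n => Φ.word_mem n x hp)
  have hgc : Continuous g := by
    have hu : TendstoUniformly (fun (n : ℕ) (x : SymbolSpace ℓ) => Φ.word n x p) g atTop := by
      rw [Metric.tendstoUniformly_iff]
      intro ε hε
      have ht : Tendsto (fun n : ℕ => Metric.diam Φ.X * c ^ n / (1 - c)) atTop (𝓝 0) := by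
        simpa using ((tendsto_pow_atTop_nhds_zero_of_lt_one h0 h1).const_mul
          (Metric.diam Φ.X)).div_const (1 - c)
      filter_upwards [ht.eventually (gt_mem_nhds hε)] with n hn x
      rw [dist_comm]
      exact (dist_le_of_le_geometric_of_tendsto c _ h1 (hstep x) (hg x) n).trans_lt hn
    exact hu.continuous
      (Frequently.of_forall fun n => (Φ.isLocallyConstant_word p n).continuous)
  have hshift : ∀ x, g x = Φ.map (x 0) (g (leftShift x)) := by
    intro x
    have hcont : ContinuousAt (Φ.map (x 0)) (g (leftShift x)) :=
      ((Φ.contDiffOn (x 0)).continuousOn).continuousAt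
        (Φ.isOpen_U.mem_nhds (Φ.X_subset_U (hgX _)))
    have ha : Tendsto (fun n => Φ.word (n + 1) x p) atTop
        (𝓝 (Φ.map (x 0) (g (leftShift x)))) := hcont.tendsto.comp (hg (leftShift x))
    exact tendsto_nhds_unique ((hg x).comp (tendsto_add_atTop_nat 1)) ha
  refine ⟨range g, range_nonempty g, isCompact_range hgc, range_subset_iff.2 hgX, ?_⟩
  apply Subset.antisymm
  · rintro _ ⟨x, rfl⟩
    exact mem_iUnion.2 ⟨x 0, g (leftShift x), mem_range_self _, (hshift x).symm⟩
  · intro y hy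
    obtain ⟨i, _, ⟨x, rfl⟩, rfl⟩ := mem_iUnion.1 hy
    refine ⟨fun n => Nat.casesOn n i x, ?_⟩
    rw [hshift]
    rfl

theorem existsUnique_isAttractor [NeZero ℓ] : ∃! K, Φ.IsAttractor K := by
  obtain ⟨K, hK⟩ := Φ.exists_isAttractor
  exact ⟨K, hK, fun L hL => Subset.antisymm (hL.subset hK) (hK.subset hL)⟩

/-- The attractor: the unique nonempty compact set `K ⊆ X` with `K = ⋃ᵢ Sᵢ(K)`. -/
def attractor [NeZero ℓ] : Set (EuclideanSpace ℝ (Fin d)) :=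
  Φ.existsUnique_isAttractor.choose

theorem isAttractor_attractor [NeZero ℓ] : Φ.IsAttractor Φ.attractor :=
  Φ.existsUnique_isAttractor.choose_spec.1

theorem exists_coding [NeZero ℓ] (x : SymbolSpace ℓ) :
    ∃ z, ⋂ n : ℕ, Φ.word n x '' Φ.attractor = {z} := by
  obtain ⟨hne, hcpt, hsub, heq⟩ := Φ.isAttractor_attractor
  obtain ⟨c, h0, h1, hc⟩ := Φ.exists_common_ratio
  have hmap : ∀ i, ∀ q ∈ Φ.attractor, Φ.map i q ∈ Φ.attractor := by
    intro i q hq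
    rw [heq]
    exact mem_iUnion.2 ⟨i, q, hq, rfl⟩
  have hcw : ∀ (n : ℕ) (x : SymbolSpace ℓ), ContinuousOn (Φ.word n x) Φ.X := by
    intro n
    induction n with
    | zero => intro x; exact continuousOn_id
    | succ n ih =>
      intro x
      exact ((Φ.contDiffOn (x 0)).continuousOn.mono Φ.X_subset_U).comp (ih _) (Φ.word_mem n _)
  have hk : ∀ n, IsCompact (Φ.word n x '' Φ.attractor) :=
    fun n => hcpt.image_of_continuousOn ((hcw n x).mono hsub)
  have hnon : (⋂ n : ℕ, Φ.word n x '' Φ.attractor).Nonempty := by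
    refine IsCompact.nonempty_iInter_of_sequence_nonempty_isCompact_isClosed _ ?_
      (fun n => hne.image _) (hk 0) (fun n => (hk n).isClosed)
    rintro n _ ⟨q, hq, rfl⟩
    exact ⟨Φ.map (x n) q, hmap _ _ hq, (Φ.word_succ' n x q).symm⟩
  obtain ⟨z, hz⟩ := hnon
  refine ⟨z, Subset.antisymm (fun w hw => ?_) (singleton_subset_iff.2 hz)⟩
  have hle : ∀ n : ℕ, dist w z ≤ c ^ n * Metric.diam Φ.X := by
    intro n
    obtain ⟨a, ha, rfl⟩ := mem_iInter.1 hw n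
    obtain ⟨b, hb, hbz⟩ := mem_iInter.1 hz n
    rw [← hbz]
    exact (Φ.dist_word_le h0 hc n x a (hsub ha) b (hsub hb)).trans
      (mul_le_mul_of_nonneg_left
        (Metric.dist_le_diam_of_mem Φ.isCompact_X.isBounded (hsub ha) (hsub hb))
        (pow_nonneg h0 n))
  have ht : Tendsto (fun n : ℕ => c ^ n * Metric.diam Φ.X) atTop (𝓝 0) := by
    simpa using (tendsto_pow_atTop_nhds_zero_of_lt_one h0 h1).mul_const (Metric.diam Φ.X)
  exact dist_le_zero.1 (ge_of_tendsto' ht hle)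

/-- The canonical projection: `{π(x)} = ⋂ₙ S_{x₁} ∘ ⋯ ∘ S_{xₙ}(K)`. -/
def coding [NeZero ℓ] (x : SymbolSpace ℓ) : EuclideanSpace ℝ (Fin d) :=
  (Φ.exists_coding x).choose

theorem coding_spec [NeZero ℓ] (x : SymbolSpace ℓ) :
    ⋂ n : ℕ, Φ.word n x '' Φ.attractor = {Φ.coding x} :=
  (Φ.exists_coding x).choose_spec

/-! ### Projection entropy -/

/-- The sigma-algebra `π⁻¹ 𝓑(ℝᵈ)` on the shift space. -/
abbrev codingSigma [NeZero ℓ] : MeasurableSpace (SymbolSpace ℓ) :=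
  MeasurableSpace.comap Φ.coding (borel (EuclideanSpace ℝ (Fin d)))

/-- The sigma-algebra `σ⁻¹ π⁻¹ 𝓑(ℝᵈ)` on the shift space. -/
abbrev shiftCodingSigma [NeZero ℓ] : MeasurableSpace (SymbolSpace ℓ) :=
  MeasurableSpace.comap leftShift Φ.codingSigma

/-- The projection entropy `h_π(σ, m) = H_m(𝒫 | σ⁻¹π⁻¹𝓑(ℝᵈ)) - H_m(𝒫 | π⁻¹𝓑(ℝᵈ))`. -/
def projEntropy [NeZero ℓ] (m : Measure (SymbolSpace ℓ)) : ℝ :=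
  condEntropy Φ.shiftCodingSigma m firstCylinder - condEntropy Φ.codingSigma m firstCylinder

/-- The local projection entropy `h_π(σ, m, x)`: the conditional expectation of
`I_m(𝒫 | σ⁻¹π⁻¹𝓑(ℝᵈ)) - I_m(𝒫 | π⁻¹𝓑(ℝᵈ))` given the sigma-algebra of the Borel sets `B` with
`σ⁻¹ B = B`. -/
def localProjEntropy [NeZero ℓ] (m : Measure (SymbolSpace ℓ)) : SymbolSpace ℓ → ℝ :=
  m[fun x => condInformation Φ.shiftCodingSigma m firstCylinder x
      - condInformation Φ.codingSigma m firstCylinder x |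
    MeasurableSpace.invariants leftShift]

/-! ### Lyapunov exponents and conformality -/

/-- The smallest singular value `min {|M v| : |v| = 1}` of a linear map (for `d ≥ 1`). -/
def minStretch (M : EuclideanSpace ℝ (Fin d) →L[ℝ] EuclideanSpace ℝ (Fin d)) : ℝ :=
  sInf ((fun v => ‖M v‖) '' Metric.sphere 0 1)

/-- The differential of `S_{x₁} ∘ ⋯ ∘ S_{xₙ}` at `π(σⁿ x)`. -/
def wordDeriv [NeZero ℓ] (n : ℕ) (x : SymbolSpace ℓ) :
    EuclideanSpace ℝ (Fin d) →L[ℝ] EuclideanSpace ℝ (Fin d) :=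
  fderiv ℝ (Φ.word n x) (Φ.coding (leftShift^[n] x))

/-- The upper Lyapunov exponent at `x`, computed in the extended reals. -/
def upperLyapunov [NeZero ℓ] (x : SymbolSpace ℓ) : EReal :=
  - liminf (fun n : ℕ => ((1 / (n : ℝ) * Real.log (minStretch (Φ.wordDeriv n x)) : ℝ) : EReal))
    atTop

/-- The lower Lyapunov exponent at `x`, computed in the extended reals. -/
def lowerLyapunov [NeZero ℓ] (x : SymbolSpace ℓ) : EReal :=
  - limsup (fun n : ℕ => ((1 / (n : ℝ) * Real.log ‖Φ.wordDeriv n x‖ : ℝ) : EReal)) atTop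

/-- The Lyapunov exponent at `x`, meaningful where the upper and lower exponents agree: it is then
their common (finite) value. -/
def lyapunov [NeZero ℓ] (x : SymbolSpace ℓ) : ℝ := (Φ.upperLyapunov x).toReal

/-- `Φ` is `m`-conformal: the Lyapunov exponent exists `m`-almost everywhere. -/
def IsConformalFor [NeZero ℓ] (m : Measure (SymbolSpace ℓ)) : Prop :=
  ∀ᵐ x ∂m, Φ.upperLyapunov x = Φ.lowerLyapunov x

/-- `Φ` is weakly conformal: `(log [S'_{x₁…xₙ}(πσⁿx)] - log ‖S'_{x₁…xₙ}(πσⁿx)‖) / n → 0`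
uniformly in `x`, where `[M]` denotes the smallest singular value of `M`. -/
def IsWeaklyConformal [NeZero ℓ] : Prop :=
  TendstoUniformly
    (fun (n : ℕ) (x : SymbolSpace ℓ) =>
      1 / (n : ℝ) * (Real.log (minStretch (Φ.wordDeriv n x)) - Real.log ‖Φ.wordDeriv n x‖))
    (fun _ => 0) atTop

end C1IFS

end

/-!
Let `μ = π_* m` be the coded measure. The proof compares `μ` with its images under blocks of maps.

*Jacobians.* For a block `w = x₀ … x_{k-1}` the measure `(S_w)_* μ` has a Radon–Nikodym derivative
with respect to `μ`, which by Besicovitch's differentiation theorem is the limit of the ratios of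
the masses of small balls. Since the `S_u` are injective, the derivatives for single symbols
multiply along a block, although the cylinders may overlap (`C1IFS.ae_rnDeriv_map_coding_prepend`);
and at `π x` the logarithm of the derivative for `x₀` is exactly the increment `I_m(𝒫 | σ⁻¹π⁻¹𝓑) -
I_m(𝒫 | π⁻¹𝓑)` whose conditional expectation is the local projection entropy
(`C1IFS.ae_infoIncrement_eq_log_jacobian`).

*Telescoping.* At small scales the preimage under `S_w` of a ball of radius `r` about `π x` lies
between the balls about `π σᵏ x` of radii about `r / ‖S_w'‖` and `r / ⟦S_w'⟧`
(`C1IFS.exists_block_distortion`). Hence the logarithm of the mass of a ball at `π x` is that of a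
ball at `π σᵏ x` minus nearly the sum of the increments of information at `σⁱ x`, `i < k`, the ratio
of the two radii being an extreme stretching factor of the block. Iterating, the mass of a ball
whose radius is a product of stretching factors is controlled by a Birkhoff sum, plus a sum of
differentiation errors in which the scale improves with the number of remaining steps. Those errors
are `o(n)` by Maker's theorem (`ae_tendsto_sum_antitone_div`), whose domination hypothesis comes
from the Besicovitch maximal inequality: it gives the logarithms of the ratios exponential tails
(`C1IFS.exists_tail_blockLogMass_sub_logMass`). This yields `C1IFS.exists_ae_logMass_le` and
`C1IFS.exists_ae_le_logMass`.

*Long blocks.* The logarithms of the radii so obtained are block averages of `log ‖S_w'‖` and of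
`log ⟦S_w'⟧`. Both sequences are subadditive up to sign, so if their averages converge to `-λ(x)`,
then so do the block averages along suitable `k → ∞` (`ae_frequently_birkhoffSum_block_le`), and the
factor `2` lost in each block becomes negligible. Interpolating between consecutive radii gives the
local dimension (`C1IFS.ae_tendsto_logMass_div_log`).

Birkhoff's pointwise ergodic theorem, in the form without ergodicity, is proved along the way. It
also gives the statement on weak conformality, since there the two logarithms of a long block differ
by a uniformly small multiple of its length.
-/

/-! ### The pointwise ergodic theorem -/

section Birkhoff

variable {Ω : Type*}

/-- The running maximum `max (0, S₁, …, Sₙ)` of the Birkhoff sums of `f`, in recursive form. -/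
def birkhoffMax (T : Ω → Ω) (f : Ω → ℝ) : ℕ → Ω → ℝ
  | 0, _ => 0
  | n + 1, x => max 0 (f x + birkhoffMax T f n (T x))

theorem birkhoffMax_nonneg (T : Ω → Ω) (f : Ω → ℝ) (n : ℕ) (x : Ω) : 0 ≤ birkhoffMax T f n x := by
  cases n with
  | zero => exact le_rfl
  | succ n => exact le_max_left _ _

theorem birkhoffMax_le_succ (T : Ω → Ω) (f : Ω → ℝ) (n : ℕ) :
    ∀ x, birkhoffMax T f n x ≤ birkhoffMax T f (n + 1) x := by
  induction n with
  | zero => intro x; exact birkhoffMax_nonneg T f 1 x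
  | succ n ih =>
    intro x
    exact max_le_max le_rfl (add_le_add le_rfl (ih (T x)))

theorem birkhoffSum_le_birkhoffMax (T : Ω → Ω) (f : Ω → ℝ) (n : ℕ) :
    ∀ x, birkhoffSum T f n x ≤ birkhoffMax T f n x := by
  induction n with
  | zero => intro x; simp [birkhoffMax]
  | succ n ih =>
    intro x
    rw [birkhoffSum_succ']
    exact (add_le_add le_rfl (ih (T x))).trans (le_max_right _ _)

theorem bddAbove_range_birkhoffSum_map_iff (T : Ω → Ω) (f : Ω → ℝ) (x : Ω) :
    BddAbove (range fun n => birkhoffSum T f n (T x)) ↔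
      BddAbove (range fun n => birkhoffSum T f n x) := by
  constructor
  · rintro ⟨C, hC⟩
    refine ⟨max 0 (f x + C), ?_⟩
    rintro _ ⟨n, rfl⟩
    cases n with
    | zero => simp
    | succ n =>
      simp only [birkhoffSum_succ']
      exact le_max_of_le_right (add_le_add le_rfl (hC ⟨n, rfl⟩))
  · rintro ⟨C, hC⟩
    refine ⟨C - f x, ?_⟩
    rintro _ ⟨n, rfl⟩
    have := hC ⟨n + 1, rfl⟩
    simp only [birkhoffSum_succ'] at this ⊢
    linarith

theorem abs_birkhoffMax_sub_le (T : Ω → Ω) (f : Ω → ℝ) (n : ℕ) (x : Ω) :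
    |birkhoffMax T f (n + 1) x - birkhoffMax T f n (T x)| ≤ |f x| := by
  have h := birkhoffMax_nonneg T f n (T x)
  change |max 0 (f x + birkhoffMax T f n (T x)) - birkhoffMax T f n (T x)| ≤ |f x|
  rcases le_total 0 (f x + birkhoffMax T f n (T x)) with h0 | h0
  · rw [max_eq_right h0]; simp
  · rw [max_eq_left h0, zero_sub, abs_neg, abs_of_nonneg h]
    have := neg_abs_le (f x)
    linarith

variable [MeasurableSpace Ω]

theorem integrable_birkhoffMax {m : Measure Ω} {T : Ω → Ω} (hT : MeasurePreserving T m m)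
    {f : Ω → ℝ} (hf : Integrable f m) (n : ℕ) : Integrable (birkhoffMax T f n) m := by
  induction n with
  | zero => exact integrable_zero _ _ _
  | succ n ih => exact (integrable_zero _ _ _).sup (hf.add (hT.integrable_comp_of_integrable ih))

/-- The maximal ergodic theorem, for the set where the Birkhoff sums are unbounded above. -/
theorem setIntegral_nonneg_of_not_bddAbove_birkhoffSum {m : Measure Ω} {T : Ω → Ω}
    (hT : MeasurePreserving T m m) {f : Ω → ℝ} (hf : Integrable f m) {A : Set Ω}
    (hA : MeasurableSet A) (hTA : T ⁻¹' A = A)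
    (hunb : ∀ x ∈ A, ¬ BddAbove (range fun n => birkhoffSum T f n x)) :
    0 ≤ ∫ x in A, f x ∂m := by
  have hint := integrable_birkhoffMax hT hf
  have hTr : MeasurePreserving T (m.restrict A) (m.restrict A) := by
    simpa [hTA] using hT.restrict_preimage hA
  have hcomp : ∀ n, ∫ x in A, birkhoffMax T f n (T x) ∂m = ∫ x in A, birkhoffMax T f n x ∂m := by
    intro n
    have h := integral_map (μ := m.restrict A) hTr.measurable.aemeasurable
      (f := birkhoffMax T f n) (by rw [hTr.map_eq]; exact (hint n).1.restrict)
    rw [hTr.map_eq] at h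
    exact h.symm
  -- On `A` the integrand is eventually equal to `f`, and it is always dominated by `|f|`.
  have hlim : Tendsto (fun n => ∫ x in A, (birkhoffMax T f (n + 1) x - birkhoffMax T f n (T x)) ∂m)
      atTop (𝓝 (∫ x in A, f x ∂m)) := by
    refine tendsto_integral_of_dominated_convergence (fun x => |f x|) ?_ hf.abs.integrableOn ?_ ?_
    · exact fun n => ((hint (n + 1)).1.sub
        (hT.integrable_comp_of_integrable (hint n)).1).restrict
    · exact fun n => Eventually.of_forall fun x => by
        simpa using abs_birkhoffMax_sub_le T f n x
    · refine (ae_restrict_iff' hA).2 (Eventually.of_forall fun x hx => ?_)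
      have hTx : T x ∈ A := by rw [← hTA] at hx; exact hx
      obtain ⟨_, ⟨k, rfl⟩, hk⟩ := not_bddAbove_iff.1 (hunb _ hTx) (-f x)
      refine tendsto_const_nhds.congr' ?_
      filter_upwards [eventually_ge_atTop k] with n hn
      have h1 : birkhoffSum T f k (T x) ≤ birkhoffMax T f n (T x) :=
        (birkhoffSum_le_birkhoffMax T f k _).trans
          (monotone_nat_of_le_succ (f := fun n => birkhoffMax T f n (T x))
            (fun n => birkhoffMax_le_succ T f n _) hn)
      change f x = max 0 (f x + birkhoffMax T f n (T x)) - birkhoffMax T f n (T x)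
      have hk' : -f x < birkhoffSum T f k (T x) := hk
      rw [max_eq_right (by linarith)]
      ring
  refine ge_of_tendsto' hlim fun n => ?_
  have hTn : Integrable (fun x => birkhoffMax T f n (T x)) m :=
    hT.integrable_comp_of_integrable (hint n)
  rw [integral_sub (hint (n + 1)).integrableOn hTn.integrableOn, hcomp, ← integral_sub
    (hint (n + 1)).integrableOn (hint n).integrableOn]
  exact integral_nonneg fun x => sub_nonneg.2 (birkhoffMax_le_succ T f n x)

theorem condExp_invariants_comp (m : Measure Ω) (T : Ω → Ω) (f : Ω → ℝ) (x : Ω) :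
    (m[f | MeasurableSpace.invariants T]) (T x) = (m[f | MeasurableSpace.invariants T]) x :=
  congrFun (MeasurableSpace.comp_eq_of_measurable_invariants
    (stronglyMeasurable_condExp (m := MeasurableSpace.invariants T) (μ := m) (f := f)).measurable) x

/-- The exceptional set `A` is invariant, so the integral of `f - E(f | ℐ) - ε` over it is `-ε
m(A)`, whereas the maximal ergodic theorem makes it nonnegative. -/
theorem ae_bddAbove_birkhoffSum {m : Measure Ω} [IsFiniteMeasure m] {T : Ω → Ω}
    (hT : MeasurePreserving T m m) {f : Ω → ℝ} (hf : Integrable f m) (hfm : Measurable f) {ε : ℝ}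
    (hε : 0 < ε) :
    ∀ᵐ x ∂m, BddAbove (range fun n => birkhoffSum T
      (fun x => f x - (m[f | MeasurableSpace.invariants T]) x - ε) n x) := by
  set g := m[f | MeasurableSpace.invariants T] with hg
  have hI := MeasurableSpace.invariants_le T
  have hgm : Measurable g :=
    (stronglyMeasurable_condExp (m := MeasurableSpace.invariants T)).measurable.mono hI le_rfl
  have hFm : Measurable fun x => f x - g x - ε := (hfm.sub hgm).sub_const ε
  have hfg : Integrable (fun x => f x - g x) m := hf.sub integrable_condExp
  have hFi : Integrable (fun x => f x - g x - ε) m := hfg.sub (integrable_const ε)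
  set A := {x | ¬ BddAbove (range fun n => birkhoffSum T (fun x => f x - g x - ε) n x)} with hAdef
  have hSm : ∀ n, Measurable fun x => birkhoffSum T (fun x => f x - g x - ε) n x := fun n => by
    unfold birkhoffSum
    exact Finset.measurable_sum _ fun i _ => hFm.comp (hT.measurable.iterate i)
  have hA : MeasurableSet A := (measurableSet_bddAbove_range hSm).compl
  have hTA : T ⁻¹' A = A := by
    ext x
    exact not_congr (bddAbove_range_birkhoffSum_map_iff T _ x)
  have h0 := setIntegral_nonneg_of_not_bddAbove_birkhoffSum hT hFi hA hTA fun x hx => hx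
  rw [integral_sub hfg.integrableOn (integrable_const ε).integrableOn,
    integral_sub hf.integrableOn integrable_condExp.integrableOn,
    setIntegral_condExp hI hf (s := A) ⟨hA, hTA⟩, sub_self, zero_sub, setIntegral_const,
    smul_eq_mul] at h0
  have h1 : m.real A = 0 := by
    by_contra hne
    have : 0 < m.real A := lt_of_le_of_ne measureReal_nonneg (Ne.symm hne)
    nlinarith
  rw [measureReal_eq_zero_iff] at h1
  rw [ae_iff]
  exact h1

theorem ae_eventually_birkhoffSum_le {m : Measure Ω} [IsFiniteMeasure m] {T : Ω → Ω}
    (hT : MeasurePreserving T m m) {f : Ω → ℝ} (hf : Integrable f m) (hfm : Measurable f) :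
    ∀ᵐ x ∂m, ∀ ε > 0, ∀ᶠ n : ℕ in atTop,
      birkhoffSum T f n x ≤ n * ((m[f | MeasurableSpace.invariants T]) x + ε) := by
  have h := ae_all_iff.2 fun k : ℕ =>
    ae_bddAbove_birkhoffSum hT hf hfm (Nat.one_div_pos_of_nat (α := ℝ) (n := k))
  filter_upwards [h] with x hx ε hε
  obtain ⟨k, hk⟩ := exists_nat_one_div_lt hε
  obtain ⟨C, hC⟩ := hx k
  -- The conditional expectation is constant along the orbit.
  have hs : ∀ n, birkhoffSum T (fun x => f x - (m[f | MeasurableSpace.invariants T]) x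
      - 1 / ((k : ℝ) + 1)) n x = birkhoffSum T f n x
        - n * ((m[f | MeasurableSpace.invariants T]) x + 1 / ((k : ℝ) + 1)) := by
    intro n
    have hinv : ∀ i, (m[f | MeasurableSpace.invariants T]) (T^[i] x)
        = (m[f | MeasurableSpace.invariants T]) x := by
      intro i
      induction i with
      | zero => rfl
      | succ i ih => rw [Function.iterate_succ_apply', condExp_invariants_comp, ih]
    simp only [birkhoffSum, Finset.sum_sub_distrib, hinv, Finset.sum_const, Finset.card_range,
      nsmul_eq_mul]
    ring
  obtain ⟨N, hN⟩ := exists_nat_gt (C / (ε - 1 / ((k : ℝ) + 1)))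
  filter_upwards [eventually_ge_atTop N] with n hn
  have h1 := hC ⟨n, rfl⟩
  simp only [hs] at h1
  have h2 : C < n * (ε - 1 / ((k : ℝ) + 1)) := by
    rw [div_lt_iff₀ (by linarith)] at hN
    have : (N : ℝ) ≤ n := by exact_mod_cast hn
    nlinarith
  linarith

/-- **Birkhoff's pointwise ergodic theorem.** -/
theorem ae_tendsto_birkhoffSum_div {m : Measure Ω} [IsFiniteMeasure m] {T : Ω → Ω}
    (hT : MeasurePreserving T m m) {f : Ω → ℝ} (hf : Integrable f m) :
    ∀ᵐ x ∂m, Tendsto (fun n : ℕ => birkhoffSum T f n x / n) atTop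
      (𝓝 ((m[f | MeasurableSpace.invariants T]) x)) := by
  obtain ⟨f', hf'm, hff'⟩ := hf.1
  have hf' : Integrable f' m := hf.congr hff'
  have h1 := ae_eventually_birkhoffSum_le hT hf' hf'm.measurable
  have h2 := ae_eventually_birkhoffSum_le hT hf'.neg hf'm.measurable.neg
  have h3 : ∀ᵐ x ∂m, ∀ i : ℕ, f (T^[i] x) = f' (T^[i] x) := ae_all_iff.2 fun i =>
    (hT.iterate i).quasiMeasurePreserving.ae hff'
  filter_upwards [h1, h2, h3, condExp_congr_ae (m := MeasurableSpace.invariants T) hff',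
    condExp_neg f' (m := MeasurableSpace.invariants T) (μ := m)] with x h1 h2 h3 h4 h5
  rw [h5] at h2
  rw [h4]
  have hs : ∀ n, birkhoffSum T f n x = birkhoffSum T f' n x := fun n =>
    Finset.sum_congr rfl fun i _ => h3 i
  have hsn : ∀ n, birkhoffSum T (-f') n x = -birkhoffSum T f' n x := fun n => by
    simp [birkhoffSum]
  rw [Metric.tendsto_atTop']
  intro ε hε
  obtain ⟨N, hN⟩ := ((h1 (ε / 2) (half_pos hε)).and
    ((h2 (ε / 2) (half_pos hε)).and (eventually_gt_atTop 0))).exists_forall_of_atTop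
  refine ⟨N, fun n hn => ?_⟩
  obtain ⟨ha, hb, hc⟩ := hN n hn.le
  rw [hsn, Pi.neg_apply] at hb
  have hc' : (0 : ℝ) < n := by exact_mod_cast hc
  rw [hs, Real.dist_eq, abs_lt]
  constructor
  · rw [lt_sub_iff_add_lt, lt_div_iff₀ hc']
    nlinarith
  · rw [sub_lt_iff_lt_add, div_lt_iff₀ hc']
    nlinarith

/-- Nonnegative functions whose integrals tend to `0` have lower limit `0` almost everywhere. -/
theorem ae_frequently_lt_of_tendsto_integral_zero {m : Measure Ω} {h : ℕ → Ω → ℝ}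
    (hi : ∀ n, Integrable (h n) m) (h0 : ∀ n, 0 ≤ᵐ[m] h n)
    (hlim : Tendsto (fun n => ∫ x, h n x ∂m) atTop (𝓝 0)) :
    ∀ᵐ x ∂m, ∀ δ > 0, ∃ᶠ n in atTop, h n x < δ := by
  have h1 : ∀ n, ∫⁻ x, ENNReal.ofReal (h n x) ∂m = ENNReal.ofReal (∫ x, h n x ∂m) := fun n =>
    (ofReal_integral_eq_lintegral_ofReal (hi n) (h0 n)).symm
  have h2 : Tendsto (fun n => ∫⁻ x, ENNReal.ofReal (h n x) ∂m) atTop (𝓝 0) := by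
    simp only [h1]
    simpa [Function.comp_def] using (ENNReal.continuous_ofReal.tendsto 0).comp hlim
  have hm : ∀ n, AEMeasurable (fun x => ENNReal.ofReal (h n x)) m := fun n =>
    (hi n).1.aemeasurable.ennreal_ofReal
  have h3 : ∫⁻ x, liminf (fun n => ENNReal.ofReal (h n x)) atTop ∂m = 0 := by
    refine le_antisymm ((lintegral_liminf_le' hm).trans ?_) zero_le
    rw [h2.liminf_eq]
  have hlm : AEMeasurable (fun x => liminf (fun n => ENNReal.ofReal (h n x)) atTop) m := by
    simp only [liminf_eq_iSup_iInf_of_nat]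
    exact AEMeasurable.iSup fun n => AEMeasurable.biInf _ (to_countable _) fun i _ => hm i
  rw [lintegral_eq_zero_iff' hlm] at h3
  filter_upwards [h3] with x hx δ hδ
  have : liminf (fun n => ENNReal.ofReal (h n x)) atTop < ENNReal.ofReal δ := by
    rw [hx]; simpa using hδ
  refine (frequently_lt_of_liminf_lt (by isBoundedDefault) this).mono fun n hn => ?_
  exact (ENNReal.ofReal_lt_ofReal_iff hδ).1 hn

/-- A form of Maker's ergodic theorem: Birkhoff averages of a monotone sequence decreasing to `0`
still tend to `0` when the index of the function is the number of remaining steps. -/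
theorem ae_tendsto_sum_antitone_div {m : Measure Ω} [IsFiniteMeasure m] {T : Ω → Ω}
    (hT : MeasurePreserving T m m) {G : ℕ → Ω → ℝ} (hm : ∀ N, Measurable (G N))
    (h0 : ∀ N x, 0 ≤ G N x) (hanti : ∀ᵐ x ∂m, Antitone fun N => G N x) (hint : Integrable (G 0) m)
    (hlim : ∀ᵐ x ∂m, Tendsto (fun N => G N x) atTop (𝓝 0)) :
    ∀ᵐ x ∂m, Tendsto (fun n : ℕ => (∑ j ∈ Finset.range n, G (n - j) (T^[j] x)) / n) atTop
      (𝓝 0) := by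
  have hi : ∀ N, Integrable (G N) m := fun N => by
    refine hint.mono' (hm N).aestronglyMeasurable ?_
    filter_upwards [hanti] with x hx
    rw [Real.norm_of_nonneg (h0 N x)]
    exact hx (Nat.zero_le N)
  have hI : Tendsto (fun N => ∫ x, (m[G N | MeasurableSpace.invariants T]) x ∂m) atTop (𝓝 0) := by
    simp only [integral_condExp (MeasurableSpace.invariants_le T)]
    have := tendsto_integral_of_dominated_convergence (G 0) (fun N => (hi N).1) hint
      (fun N => by
        filter_upwards [hanti] with x hx
        rw [Real.norm_of_nonneg (h0 N x)]
        exact hx (Nat.zero_le N)) hlim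
    simpa using this
  have hsmall := ae_frequently_lt_of_tendsto_integral_zero (fun N => integrable_condExp)
    (fun N => condExp_nonneg (Eventually.of_forall (h0 N))) hI
  have hB := ae_all_iff.2 fun N => ae_tendsto_birkhoffSum_div hT (hi N)
  have hA : ∀ᵐ x ∂m, ∀ j : ℕ, Antitone fun N => G N (T^[j] x) := ae_all_iff.2 fun j =>
    (hT.iterate j).quasiMeasurePreserving.ae hanti
  filter_upwards [hsmall, hB, hA] with x hsmall hB hA
  rw [Metric.tendsto_atTop']
  intro ε hε
  obtain ⟨N, hN⟩ := (hsmall (ε / 2) (half_pos hε)).exists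
  have hshift : Tendsto (fun n : ℕ => birkhoffSum T (G 0) (n - N) x / n) atTop
      (𝓝 ((m[G 0 | MeasurableSpace.invariants T]) x)) := by
    rw [← tendsto_add_atTop_iff_nat N]
    have h1 : Tendsto (fun n : ℕ => (n : ℝ) / ((n + N : ℕ) : ℝ)) atTop (𝓝 1) := by
      simpa using tendsto_natCast_div_add_atTop (N : ℝ)
    have h2 := (hB 0).mul h1
    rw [mul_one] at h2
    refine h2.congr' ?_
    filter_upwards [eventually_gt_atTop 0] with n hn
    have : (n : ℝ) ≠ 0 := by exact_mod_cast hn.ne'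
    rw [Nat.add_sub_cancel]
    field_simp
  have hsum := ((hB N).add ((hB 0).sub hshift))
  rw [sub_self, add_zero] at hsum
  have hev := hsum.eventually (gt_mem_nhds (hN.trans (half_lt_self hε)))
  obtain ⟨n₀, hn₀⟩ := (hev.and (eventually_ge_atTop N)).exists_forall_of_atTop
  refine ⟨n₀, fun n hn => ?_⟩
  obtain ⟨hlt, hnN⟩ := hn₀ n hn.le
  -- All but the last `N` terms are bounded by `G N`, and those last terms by `G 0`.
  have hle : ∑ j ∈ Finset.range n, G (n - j) (T^[j] x) ≤
      birkhoffSum T (G N) n x + (birkhoffSum T (G 0) n x - birkhoffSum T (G 0) (n - N) x) := by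
    have hsplit : birkhoffSum T (G 0) n x - birkhoffSum T (G 0) (n - N) x
        = ∑ j ∈ Finset.range n, if n - N ≤ j then G 0 (T^[j] x) else 0 := by
      rw [birkhoffSum, birkhoffSum, ← Finset.sum_sdiff (Finset.range_mono (Nat.sub_le n N)),
        add_sub_cancel_right, ← Finset.sum_filter]
      refine Finset.sum_congr ?_ fun _ _ => rfl
      ext j
      simp only [Finset.mem_sdiff, Finset.mem_range, Finset.mem_filter, not_lt]
    rw [hsplit, birkhoffSum, ← Finset.sum_add_distrib]
    refine Finset.sum_le_sum fun j hj => ?_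
    split_ifs with h
    · exact (hA j (Nat.zero_le _)).trans (le_add_of_nonneg_left (h0 _ _))
    · rw [add_zero]
      exact hA j (by omega)
  rw [dist_zero_right, Real.norm_of_nonneg (div_nonneg (Finset.sum_nonneg fun j _ => h0 _ _)
    (Nat.cast_nonneg n))]
  calc _ ≤ _ := div_le_div_of_nonneg_right hle (Nat.cast_nonneg n)
    _ < ε := by rw [add_div, sub_div]; exact hlt

end Birkhoff

/-! ### A maximal inequality and integrability from exponential tails -/

/-- The weak type `(1, 1)` maximal inequality for the ratio of two measures on balls. -/
theorem exists_measure_maximal_le (E : Type*) [MetricSpace E] [SecondCountableTopology E]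
    [MeasurableSpace E] [OpensMeasurableSpace E] [HasBesicovitchCovering E] :
    ∃ N : ℕ, ∀ (μ ν : Measure E) (t : ENNReal),
      t * μ {z | ∃ r, 0 < r ∧ r ≤ 1 ∧
        t * μ (Metric.closedBall z r) ≤ ν (Metric.closedBall z r)} ≤ N * ν univ := by
  obtain ⟨N, τ, hτ, hN⟩ := HasBesicovitchCovering.no_satelliteConfig (α := E)
  refine ⟨N, fun μ ν t => ?_⟩
  set s := {z | ∃ r, 0 < r ∧ r ≤ 1 ∧ t * μ (Metric.closedBall z r) ≤ ν (Metric.closedBall z r)}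
  choose r hr0 hr1 hr using fun z : s => z.2
  -- By Besicovitch's theorem `s` is covered by `N` families of disjoint balls of the defining kind.
  let q : Besicovitch.BallPackage s E :=
    { c := fun z => z
      r := r
      rpos := hr0
      r_bound := 1
      r_le := hr1 }
  obtain ⟨u, hu, hcov⟩ := Besicovitch.exist_disjoint_covering_families hτ hN q
  have hcount : ∀ i, (u i).Countable := fun i =>
    (hu i).countable_of_nonempty_interior fun j _ =>
      ⟨_, Metric.ball_subset_interior_closedBall (Metric.mem_ball_self (hr0 j))⟩
  have hs : s ⊆ ⋃ i, ⋃ j ∈ u i, Metric.closedBall (j : E) (r j) := by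
    intro z hz
    have h := hcov ⟨⟨z, hz⟩, rfl⟩
    simp only [mem_iUnion] at h ⊢
    obtain ⟨i, j, hj, hzj⟩ := h
    exact ⟨i, j, hj, Metric.ball_subset_closedBall hzj⟩
  calc t * μ s ≤ t * ∑ i, ∑' j : u i, μ (Metric.closedBall (j : E) (r j)) := by
        gcongr
        refine (measure_mono hs).trans ((measure_iUnion_fintype_le _ _).trans ?_)
        exact Finset.sum_le_sum fun i _ => measure_biUnion_le _ (hcount i) _
    _ ≤ ∑ i, ∑' j : u i, ν (Metric.closedBall (j : E) (r j)) := by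
        rw [Finset.mul_sum]
        refine Finset.sum_le_sum fun i _ => ?_
        rw [← ENNReal.tsum_mul_left]
        exact ENNReal.tsum_le_tsum fun j => hr j
    _ ≤ ∑ _i : Fin N, ν univ := by
        refine Finset.sum_le_sum fun i _ => ?_
        rw [← measure_biUnion (hcount i) (hu i) fun j _ => Metric.isClosed_closedBall.measurableSet]
        exact measure_mono (subset_univ _)
    _ = N * ν univ := by simp

theorem ENNReal.le_tsum_ite_natCast_lt (a : ENNReal) :
    a ≤ ∑' n : ℕ, if (n : ENNReal) < a then 1 else 0 := by
  induction a with
  | top => simp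
  | coe a =>
    refine le_trans ?_ (ENNReal.sum_le_tsum (Finset.range ⌈a⌉₊))
    have h : ∀ n ∈ Finset.range ⌈a⌉₊, (if (n : ENNReal) < a then (1 : ENNReal) else 0) = 1 := by
      intro n hn
      have h1 : (n : NNReal) < a := Nat.lt_ceil.1 (Finset.mem_range.1 hn)
      exact if_pos (by exact_mod_cast h1)
    rw [Finset.sum_congr rfl h]
    simp only [Finset.sum_const, Finset.card_range, nsmul_eq_mul, mul_one]
    exact_mod_cast Nat.le_ceil a

theorem lintegral_lt_top_of_exponential_tail {Ω : Type*} [MeasurableSpace Ω] {m : Measure Ω}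
    {f : Ω → ENNReal} (hf : Measurable f) {C : ENNReal} (hC : C ≠ ⊤)
    (h : ∀ n : ℕ, m {x | (n : ENNReal) < f x} ≤ C * ENNReal.ofReal (Real.exp (-n))) :
    ∫⁻ x, f x ∂m < ⊤ := by
  calc ∫⁻ x, f x ∂m ≤ ∫⁻ x, ∑' n : ℕ, {x | (n : ENNReal) < f x}.indicator 1 x ∂m := by
        refine lintegral_mono fun x => (ENNReal.le_tsum_ite_natCast_lt (f x)).trans (le_of_eq ?_)
        simp only [indicator_apply, mem_ofPred_eq, Pi.one_apply]
    _ = ∑' n : ℕ, m {x | (n : ENNReal) < f x} := by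
        have hm : ∀ n : ℕ, MeasurableSet {x | (n : ENNReal) < f x} := fun n =>
          measurableSet_lt measurable_const hf
        rw [lintegral_tsum fun n => (measurable_one.indicator (hm n)).aemeasurable]
        exact tsum_congr fun n => lintegral_indicator_one (hm n)
    _ ≤ ∑' n : ℕ, C * ENNReal.ofReal (Real.exp (-n)) := ENNReal.tsum_le_tsum h
    _ < ⊤ := by
        rw [ENNReal.tsum_mul_left]
        refine ENNReal.mul_lt_top hC.lt_top ?_
        have hs : Summable fun n : ℕ => Real.exp (-(n : ℝ)) := Real.summable_exp_neg_nat
        exact hs.tsum_ofReal_lt_top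

theorem integrable_of_exponential_tail {Ω : Type*} [MeasurableSpace Ω] {m : Measure Ω}
    {f : Ω → ℝ} (hf : Measurable f) {C : ENNReal} (hC : C ≠ ⊤)
    (h : ∀ n : ℕ, m {x | (n : ℝ) < |f x|} ≤ C * ENNReal.ofReal (Real.exp (-n))) :
    Integrable f m := by
  refine ⟨hf.aestronglyMeasurable, lintegral_lt_top_of_exponential_tail hf.enorm hC fun n => ?_⟩
  refine le_trans (measure_mono fun x hx => ?_) (h n)
  rw [mem_ofPred_eq, Real.enorm_eq_ofReal_abs, ENNReal.lt_ofReal_iff_toReal_lt (by simp)] at hx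
  simpa using hx

/-! ### Words and the full shift -/

section Shift

variable {ℓ : ℕ}

/-- The sequence `u y₀ y₁ …`. -/
def consSymbol (u : Fin ℓ) (y : SymbolSpace ℓ) : SymbolSpace ℓ
  | 0 => u
  | n + 1 => y n

/-- The sequence `x₀ … x_{k-1} y₀ y₁ …`. -/
def prepend : ℕ → SymbolSpace ℓ → SymbolSpace ℓ → SymbolSpace ℓ
  | 0, _, y => y
  | k + 1, x, y => consSymbol (x 0) (prepend k (leftShift x) y)

theorem consSymbol_head_leftShift (x : SymbolSpace ℓ) : consSymbol (x 0) (leftShift x) = x := by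
  funext n
  cases n <;> rfl

theorem prepend_iterate_leftShift (k : ℕ) : ∀ x : SymbolSpace ℓ,
    prepend k x (leftShift^[k] x) = x := by
  induction k with
  | zero => intro x; rfl
  | succ k ih =>
    intro x
    change consSymbol (x 0) (prepend k (leftShift x) (leftShift^[k] (leftShift x))) = x
    rw [ih, consSymbol_head_leftShift]

theorem prepend_congr (k : ℕ) : ∀ x x' : SymbolSpace ℓ, (∀ i < k, x i = x' i) →
    prepend k x = prepend k x' := by
  induction k with
  | zero => intro x x' _; rfl
  | succ k ih =>
    intro x x' h
    funext y
    change consSymbol (x 0) (prepend k (leftShift x) y) =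
      consSymbol (x' 0) (prepend k (leftShift x') y)
    rw [h 0 k.succ_pos, ih (leftShift x) (leftShift x') fun i hi => h (i + 1) (by omega)]

theorem continuous_consSymbol :
    Continuous fun p : Fin ℓ × SymbolSpace ℓ => consSymbol p.1 p.2 := by
  refine continuous_pi fun n => ?_
  cases n with
  | zero => exact continuous_fst
  | succ n => exact (continuous_apply n).comp continuous_snd

theorem continuous_prepend (k : ℕ) :
    Continuous fun p : SymbolSpace ℓ × SymbolSpace ℓ => prepend k p.1 p.2 := by
  induction k with
  | zero => exact continuous_snd
  | succ k ih =>
    have h1 : Continuous fun p : SymbolSpace ℓ × SymbolSpace ℓ => (leftShift p.1, p.2) :=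
      (C1IFS.continuous_leftShift.comp continuous_fst).prodMk continuous_snd
    have h2 : Continuous fun p : SymbolSpace ℓ × SymbolSpace ℓ => p.1 0 :=
      (continuous_apply 0).comp continuous_fst
    exact continuous_consSymbol.comp (h2.prodMk (ih.comp h1))

theorem finite_range_prepend (k : ℕ) :
    (range (prepend k : SymbolSpace ℓ → SymbolSpace ℓ → SymbolSpace ℓ)).Finite := by
  induction k with
  | zero =>
    refine (finite_singleton (id : SymbolSpace ℓ → SymbolSpace ℓ)).subset ?_
    rintro _ ⟨x, rfl⟩
    rfl
  | succ k ih =>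
    refine (Set.Finite.image2 (fun (u : Fin ℓ) f => consSymbol u ∘ f) finite_univ ih).subset ?_
    rintro _ ⟨x, rfl⟩
    exact ⟨x 0, mem_univ _, _, ⟨leftShift x, rfl⟩, rfl⟩

theorem measurableSet_prepend_eq (k : ℕ) (w : SymbolSpace ℓ) :
    MeasurableSet {x : SymbolSpace ℓ | prepend k x = prepend k w} := by
  refine IsOpen.measurableSet (isOpen_iff_mem_nhds.2 fun x hx => ?_)
  have h : ∀ᶠ x' : SymbolSpace ℓ in 𝓝 x, ∀ i ∈ Finset.range k, x' i = x i := by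
    refine (Filter.eventually_all_finset _).2 fun i _ => ?_
    have hc : Continuous fun x' : SymbolSpace ℓ => x' i := continuous_apply i
    exact (isOpen_discrete {x i}).preimage hc |>.mem_nhds rfl
  filter_upwards [h] with x' hx'
  exact (prepend_congr k x' x fun i hi => hx' i (Finset.mem_range.2 hi)).trans hx

end Shift

/-! ### The smallest stretching factor of a linear map -/

section MinStretch

variable {d : ℕ}

local notation "𝔼" => EuclideanSpace ℝ (Fin d)

namespace C1IFS

theorem minStretch_nonneg (M : 𝔼 →L[ℝ] 𝔼) : 0 ≤ minStretch M := by
  refine Real.sInf_nonneg ?_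
  rintro _ ⟨v, _, rfl⟩
  exact norm_nonneg _

theorem minStretch_mul_norm_le (M : 𝔼 →L[ℝ] 𝔼) (v : 𝔼) : minStretch M * ‖v‖ ≤ ‖M v‖ := by
  rcases eq_or_ne v 0 with rfl | hv
  · simp
  have h0 : 0 < ‖v‖ := norm_pos_iff.2 hv
  have h : minStretch M ≤ ‖M (‖v‖⁻¹ • v)‖ := by
    refine csInf_le ⟨0, ?_⟩ ⟨_, ?_, rfl⟩
    · rintro _ ⟨v, _, rfl⟩
      exact norm_nonneg _
    · simp [norm_smul, h0.ne']
  rw [map_smul, norm_smul, norm_inv, norm_norm] at h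
  calc minStretch M * ‖v‖ ≤ ‖v‖⁻¹ * ‖M v‖ * ‖v‖ := by gcongr
    _ = ‖M v‖ := by field_simp

variable [NeZero d]

theorem le_minStretch {M : 𝔼 →L[ℝ] 𝔼} {a : ℝ} (h : ∀ v, ‖v‖ = 1 → a ≤ ‖M v‖) :
    a ≤ minStretch M := by
  refine le_csInf ?_ ?_
  · exact (NormedSpace.sphere_nonempty.2 zero_le_one).image _
  · rintro _ ⟨v, hv, rfl⟩
    exact h v (by simpa using hv)

theorem minStretch_le_norm (M : 𝔼 →L[ℝ] 𝔼) : minStretch M ≤ ‖M‖ := by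
  obtain ⟨v, hv⟩ := NormedSpace.sphere_nonempty (E := 𝔼) (x := 0).2 zero_le_one
  have hv : ‖v‖ = 1 := by simpa using hv
  have h1 := minStretch_mul_norm_le M v
  have h2 := M.le_opNorm v
  rw [hv, mul_one] at h1 h2
  exact h1.trans h2

theorem minStretch_mul_le_comp (M N : 𝔼 →L[ℝ] 𝔼) :
    minStretch M * minStretch N ≤ minStretch (M.comp N) := by
  refine le_minStretch fun v hv => ?_
  have h1 := minStretch_mul_norm_le M (N v)
  have h2 := minStretch_mul_norm_le N v
  rw [hv, mul_one] at h2
  exact (mul_le_mul_of_nonneg_left h2 (minStretch_nonneg M)).trans h1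

theorem minStretch_pos {M : 𝔼 →L[ℝ] 𝔼} (hM : M.IsInvertible) : 0 < minStretch M := by
  obtain ⟨e, rfl⟩ := hM
  have h : ∀ v : 𝔼, ‖v‖ = 1 → (‖(e.symm : 𝔼 →L[ℝ] 𝔼)‖ + 1)⁻¹ ≤ ‖(e : 𝔼 →L[ℝ] 𝔼) v‖ := by
    intro v hv
    have h1 := (e.symm : 𝔼 →L[ℝ] 𝔼).le_opNorm (e v)
    simp only [ContinuousLinearEquiv.coe_coe, ContinuousLinearEquiv.symm_apply_apply, hv] at h1 ⊢
    rw [inv_le_iff_one_le_mul₀ (by positivity)]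
    nlinarith [norm_nonneg (e v)]
  exact lt_of_lt_of_le (by positivity) (le_minStretch h)

theorem minStretch_le_add (M N : 𝔼 →L[ℝ] 𝔼) : minStretch M ≤ minStretch N + ‖M - N‖ := by
  rw [← sub_le_iff_le_add]
  refine le_minStretch fun v hv => ?_
  have h1 := minStretch_mul_norm_le M v
  have h2 := (M - N).le_opNorm v
  have h3 : ‖M v‖ ≤ ‖N v‖ + ‖(M - N) v‖ := by
    simpa [add_comm] using norm_add_le (N v) ((M - N) v)
  rw [hv, mul_one] at h1 h2
  linarith

theorem continuous_minStretch : Continuous (minStretch : (𝔼 →L[ℝ] 𝔼) → ℝ) := by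
  refine (LipschitzWith.of_le_add fun M N => ?_).continuous
  rw [dist_eq_norm]
  exact minStretch_le_add M N

theorem minStretch_id : minStretch (ContinuousLinearMap.id ℝ 𝔼) = 1 := by
  refine le_antisymm ?_ (le_minStretch fun v hv => by simp [hv])
  exact (minStretch_le_norm _).trans (ContinuousLinearMap.norm_id_le)

end C1IFS

end MinStretch

/-! ### The coding map and the differentials of the iterates -/

namespace C1IFS

variable {d ℓ : ℕ} (Φ : C1IFS d ℓ)

local notation "𝔼" => EuclideanSpace ℝ (Fin d)

theorem mapsTo_word_U (n : ℕ) : ∀ x : SymbolSpace ℓ, MapsTo (Φ.word n x) Φ.U Φ.U := by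
  induction n with
  | zero => intro x p hp; exact hp
  | succ n ih => intro x p hp; exact Φ.mapsTo_U _ (ih _ hp)

theorem injOn_word_U (n : ℕ) : ∀ x : SymbolSpace ℓ, InjOn (Φ.word n x) Φ.U := by
  induction n with
  | zero => intro x; exact injOn_id _
  | succ n ih => intro x; exact (Φ.injOn _).comp (ih _) (Φ.mapsTo_word_U n _)

theorem contDiffOn_word (n : ℕ) : ∀ x : SymbolSpace ℓ, ContDiffOn ℝ 1 (Φ.word n x) Φ.U := by
  induction n with
  | zero => intro x; exact contDiffOn_id
  | succ n ih => intro x; exact (Φ.contDiffOn _).comp (ih _) (Φ.mapsTo_word_U n _)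

theorem differentiableAt_word (n : ℕ) (x : SymbolSpace ℓ) {p : 𝔼} (hp : p ∈ Φ.U) :
    DifferentiableAt ℝ (Φ.word n x) p :=
  ((Φ.contDiffOn_word n x).differentiableOn one_ne_zero).differentiableAt (Φ.isOpen_U.mem_nhds hp)

theorem word_add (n k : ℕ) : ∀ x : SymbolSpace ℓ,
    Φ.word (n + k) x = Φ.word n x ∘ Φ.word k (leftShift^[n] x) := by
  induction n with
  | zero => intro x; rw [zero_add]; rfl
  | succ n ih =>
    intro x
    rw [Nat.succ_add]
    change Φ.map (x 0) ∘ Φ.word (n + k) (leftShift x) = _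
    rw [ih]
    rfl

theorem finite_range_word (n : ℕ) : (range (Φ.word n)).Finite := by
  induction n with
  | zero =>
    refine (finite_singleton (id : 𝔼 → 𝔼)).subset ?_
    rintro _ ⟨x, rfl⟩
    rfl
  | succ n ih =>
    refine (Set.Finite.image2 (fun (u : Fin ℓ) f => Φ.map u ∘ f) finite_univ ih).subset ?_
    rintro _ ⟨x, rfl⟩
    exact ⟨x 0, mem_univ _, _, ⟨leftShift x, rfl⟩, rfl⟩

theorem exists_norm_fderiv_map_le : ∃ c : ℝ, 0 < c ∧ c < 1 ∧
    ∀ i, ∀ p ∈ Φ.U, ‖fderiv ℝ (Φ.map i) p‖ ≤ c := by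
  choose c h0 h1 h2 using Φ.contracting
  have key : ∃ C : ℝ, 0 < C ∧ C < 1 ∧ ∀ i, c i ≤ C := by
    rcases isEmpty_or_nonempty (Fin ℓ) with h | h
    · exact ⟨1 / 2, by norm_num, by norm_num, fun i => (h.false i).elim⟩
    · obtain ⟨j, hj⟩ := Finite.exists_max c
      exact ⟨max (c j) (1 / 2), by positivity, max_lt (h1 j) (by norm_num),
        fun i => (hj i).trans (le_max_left _ _)⟩
  obtain ⟨C, hC0, hC1, hC⟩ := key
  refine ⟨C, hC0, hC1, fun i p hp => ?_⟩
  refine norm_fderiv_le_of_lip' ℝ hC0.le ?_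
  filter_upwards [Φ.isOpen_U.mem_nhds hp] with q hq
  rw [← dist_eq_norm, ← dist_eq_norm]
  exact (h2 i q hq p hp).trans (mul_le_mul_of_nonneg_right (hC i) dist_nonneg)

variable [NeZero ℓ]

theorem map_mem_attractor (i : Fin ℓ) {p : 𝔼} (hp : p ∈ Φ.attractor) :
    Φ.map i p ∈ Φ.attractor := by
  rw [Φ.isAttractor_attractor.2.2.2]
  exact mem_iUnion.2 ⟨i, p, hp, rfl⟩

theorem attractor_subset_U : Φ.attractor ⊆ Φ.U :=
  Φ.isAttractor_attractor.2.2.1.trans Φ.X_subset_U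

theorem coding_mem_image (n : ℕ) (x : SymbolSpace ℓ) :
    Φ.coding x ∈ Φ.word n x '' Φ.attractor := by
  have h : Φ.coding x ∈ ⋂ n : ℕ, Φ.word n x '' Φ.attractor := by
    rw [Φ.coding_spec]; rfl
  exact mem_iInter.1 h n

theorem coding_mem_attractor (x : SymbolSpace ℓ) : Φ.coding x ∈ Φ.attractor := by
  simpa [word] using Φ.coding_mem_image 0 x

theorem coding_mem_U (x : SymbolSpace ℓ) : Φ.coding x ∈ Φ.U :=
  Φ.attractor_subset_U (Φ.coding_mem_attractor x)

theorem coding_eq_map (x : SymbolSpace ℓ) :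
    Φ.coding x = Φ.map (x 0) (Φ.coding (leftShift x)) := by
  have h : Φ.map (x 0) (Φ.coding (leftShift x)) ∈ ⋂ n : ℕ, Φ.word n x '' Φ.attractor := by
    refine mem_iInter.2 fun n => ?_
    cases n with
    | zero => exact ⟨_, Φ.map_mem_attractor _ (Φ.coding_mem_attractor _), rfl⟩
    | succ n =>
      obtain ⟨p, hp, hpx⟩ := Φ.coding_mem_image n (leftShift x)
      exact ⟨p, hp, congrArg (Φ.map (x 0)) hpx⟩
  rw [Φ.coding_spec] at h
  exact (mem_singleton_iff.1 h).symm

theorem coding_consSymbol (u : Fin ℓ) (y : SymbolSpace ℓ) :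
    Φ.coding (consSymbol u y) = Φ.map u (Φ.coding y) :=
  Φ.coding_eq_map _

theorem coding_prepend (k : ℕ) : ∀ x y : SymbolSpace ℓ,
    Φ.coding (prepend k x y) = Φ.word k x (Φ.coding y) := by
  induction k with
  | zero => intro x y; rfl
  | succ k ih =>
    intro x y
    change Φ.coding (consSymbol (x 0) (prepend k (leftShift x) y)) = _
    rw [coding_consSymbol, ih]
    rfl

theorem coding_eq_word (k : ℕ) (x : SymbolSpace ℓ) :
    Φ.coding x = Φ.word k x (Φ.coding (leftShift^[k] x)) := by
  rw [← coding_prepend, prepend_iterate_leftShift]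

theorem continuous_coding : Continuous Φ.coding := by
  obtain ⟨c, h0, h1, hc⟩ := Φ.exists_common_ratio
  obtain ⟨p, hp⟩ := Φ.nonempty_X
  have hu : TendstoUniformly (fun (n : ℕ) (x : SymbolSpace ℓ) => Φ.word n x p) Φ.coding atTop := by
    rw [Metric.tendstoUniformly_iff]
    intro ε hε
    have ht : Tendsto (fun n : ℕ => c ^ n * Metric.diam Φ.X) atTop (𝓝 0) := by
      simpa using (tendsto_pow_atTop_nhds_zero_of_lt_one h0 h1).mul_const (Metric.diam Φ.X)
    filter_upwards [ht.eventually (gt_mem_nhds hε)] with n hn x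
    have hX := Φ.isAttractor_attractor.2.2.1 (Φ.coding_mem_attractor (leftShift^[n] x))
    rw [Φ.coding_eq_word n x]
    refine (Φ.dist_word_le h0 hc n x _ hX p hp).trans_lt (lt_of_le_of_lt ?_ hn)
    exact mul_le_mul_of_nonneg_left (Metric.dist_le_diam_of_mem Φ.isCompact_X.isBounded hX hp)
      (pow_nonneg h0 n)
  exact hu.continuous (Frequently.of_forall fun n => (Φ.isLocallyConstant_word p n).continuous)

theorem wordDeriv_zero (x : SymbolSpace ℓ) : Φ.wordDeriv 0 x = ContinuousLinearMap.id ℝ 𝔼 :=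
  fderiv_id

theorem wordDeriv_add (n k : ℕ) (x : SymbolSpace ℓ) :
    Φ.wordDeriv (n + k) x = (Φ.wordDeriv n x).comp (Φ.wordDeriv k (leftShift^[n] x)) := by
  have h1 : Φ.coding (leftShift^[n] x) =
      Φ.word k (leftShift^[n] x) (Φ.coding (leftShift^[n + k] x)) := by
    rw [Φ.coding_eq_word k (leftShift^[n] x), ← Function.iterate_add_apply, Nat.add_comm k n]
  unfold wordDeriv
  rw [word_add, fderiv_comp, ← h1, ← Function.iterate_add_apply, Nat.add_comm k n]
  · rw [← h1]
    exact Φ.differentiableAt_word n x (Φ.coding_mem_U _)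
  · exact Φ.differentiableAt_word k _ (Φ.coding_mem_U _)

theorem continuous_wordDeriv (n : ℕ) : Continuous (Φ.wordDeriv n) := by
  induction n with
  | zero =>
    rw [show Φ.wordDeriv 0 = fun _ => ContinuousLinearMap.id ℝ 𝔼 from funext Φ.wordDeriv_zero]
    exact continuous_const
  | succ n ih =>
    have h1 : Continuous (Φ.wordDeriv 1) := by
      have h : Continuous fun p : Fin ℓ × SymbolSpace ℓ =>
          fderiv ℝ (Φ.map p.1) (Φ.coding p.2) := by
        refine continuous_prod_of_discrete_left.2 fun i => ?_
        exact ((Φ.contDiffOn i).continuousOn_fderiv_of_isOpen Φ.isOpen_U le_rfl).comp_continuous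
          Φ.continuous_coding fun x => Φ.coding_mem_U x
      exact h.comp ((continuous_apply 0).prodMk continuous_leftShift)
    have h2 : Φ.wordDeriv (n + 1) = fun x =>
        (Φ.wordDeriv 1 x).comp (Φ.wordDeriv n (leftShift x)) := by
      funext x
      rw [Nat.add_comm n 1, wordDeriv_add]
      rfl
    rw [h2]
    exact h1.clm_comp (ih.comp continuous_leftShift)

variable [NeZero d]

/-- The logarithms of the extreme stretching factors of the iterates grow at most linearly, and
the iterates contract at a definite exponential rate. -/
theorem exists_pow_le_minStretch_norm_le_pow : ∃ α c : ℝ, 0 < α ∧ 0 < c ∧ c < 1 ∧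
    ∀ (n : ℕ) (x : SymbolSpace ℓ),
      α ^ n ≤ minStretch (Φ.wordDeriv n x) ∧ ‖Φ.wordDeriv n x‖ ≤ c ^ n := by
  obtain ⟨c, hc0, hc1, hc⟩ := Φ.exists_norm_fderiv_map_le
  obtain ⟨α, hα0, hα⟩ := isCompact_univ.exists_forall_le' (a := 0)
    (continuous_minStretch.comp (Φ.continuous_wordDeriv 1)).continuousOn fun x _ =>
      minStretch_pos (Φ.isInvertible_fderiv (x 0) _ (Φ.coding_mem_U (leftShift x)))
  refine ⟨α, c, hα0, hc0, hc1, fun n => ?_⟩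
  induction n with
  | zero =>
    intro x
    rw [wordDeriv_zero, minStretch_id]
    simp
  | succ n ih =>
    intro x
    rw [Nat.add_comm n 1, wordDeriv_add, pow_add, pow_add, pow_one, pow_one]
    refine ⟨le_trans ?_ (minStretch_mul_le_comp _ _),
      (ContinuousLinearMap.opNorm_comp_le _ _).trans ?_⟩
    · exact mul_le_mul (hα x (mem_univ x)) (ih _).1 (pow_nonneg hα0.le n) (minStretch_nonneg _)
    · exact mul_le_mul (hc _ _ (Φ.coding_mem_U _)) (ih _).2 (norm_nonneg _) hc0.le

theorem minStretch_wordDeriv_pos (n : ℕ) (x : SymbolSpace ℓ) :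
    0 < minStretch (Φ.wordDeriv n x) := by
  obtain ⟨α, _, hα, _, _, h⟩ := Φ.exists_pow_le_minStretch_norm_le_pow
  exact (pow_pos hα n).trans_le (h n x).1

theorem norm_wordDeriv_pos (n : ℕ) (x : SymbolSpace ℓ) : 0 < ‖Φ.wordDeriv n x‖ :=
  (Φ.minStretch_wordDeriv_pos n x).trans_le (minStretch_le_norm _)

end C1IFS

/-! ### Distortion of a block of maps at small scales -/

/-- A `C¹` map is approximated by its differentials uniformly on compact sets. -/
theorem exists_uniform_linear_approx_of_contDiffOn {E F : Type*} [NormedAddCommGroup E]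
    [NormedSpace ℝ E] [ProperSpace E] [NormedAddCommGroup F] [NormedSpace ℝ F] {f : E → F}
    {U K : Set E} (hf : ContDiffOn ℝ 1 f U) (hU : IsOpen U) (hK : IsCompact K) (hKU : K ⊆ U)
    {ε : ℝ} (hε : 0 < ε) :
    ∃ ρ > 0, ∀ p ∈ K, ∀ q, dist q p ≤ ρ → ‖f q - f p - fderiv ℝ f p (q - p)‖ ≤ ε * ‖q - p‖ := by
  obtain ⟨δ, hδ, hδU⟩ := hK.exists_cthickening_subset_open hU hKU
  have huc : UniformContinuousOn (fderiv ℝ f) (Metric.cthickening δ K) :=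
    (hK.cthickening).uniformContinuousOn_of_continuous
      ((hf.continuousOn_fderiv_of_isOpen hU le_rfl).mono hδU)
  obtain ⟨η, hη, h⟩ := Metric.uniformContinuousOn_iff_le.1 huc ε hε
  refine ⟨min δ η, lt_min hδ hη, fun p hp q hq => ?_⟩
  have hball : ∀ z ∈ Metric.closedBall p (min δ η), z ∈ Metric.cthickening δ K := fun z hz =>
    Metric.mem_cthickening_of_dist_le z p δ K hp (hz.trans (min_le_left _ _))
  have hpb : p ∈ Metric.closedBall p (min δ η) := Metric.mem_closedBall_self (lt_min hδ hη).le
  refine (convex_closedBall p (min δ η)).norm_image_sub_le_of_norm_hasFDerivWithin_le'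
    (f := f) (f' := fderiv ℝ f) (φ := fderiv ℝ f p) (fun z hz => ?_) (fun z hz => ?_) hpb hq
  · exact ((hf.differentiableOn one_ne_zero).differentiableAt
      (hU.mem_nhds (hδU (hball z hz)))).hasFDerivAt.hasFDerivWithinAt
  · rw [← dist_eq_norm]
    exact h _ (hball z hz) _ (hball p hpb) (hz.trans (min_le_right _ _))

namespace C1IFS

variable {d ℓ : ℕ} [NeZero ℓ] (Φ : C1IFS d ℓ)

theorem exists_uniform_wordDeriv_approx (k : ℕ) {ε : ℝ} (hε : 0 < ε) :
    ∃ ρ > 0, ∀ x y : SymbolSpace ℓ, dist (Φ.coding y) (Φ.coding (leftShift^[k] x)) ≤ ρ →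
      ‖Φ.coding (prepend k x y) - Φ.coding x
        - Φ.wordDeriv k x (Φ.coding y - Φ.coding (leftShift^[k] x))‖
        ≤ ε * ‖Φ.coding y - Φ.coding (leftShift^[k] x)‖ := by
  have h : ∀ᶠ ρ in 𝓝[>] (0 : ℝ), ∀ f ∈ range (Φ.word k), ∀ p ∈ Φ.attractor, ∀ q, dist q p ≤ ρ →
      ‖f q - f p - fderiv ℝ f p (q - p)‖ ≤ ε * ‖q - p‖ := by
    refine (eventually_all_finite (Φ.finite_range_word k)).2 ?_
    rintro _ ⟨x, rfl⟩
    obtain ⟨ρ, hρ, h⟩ := exists_uniform_linear_approx_of_contDiffOn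
      (Φ.contDiffOn_word k x) Φ.isOpen_U
      Φ.isAttractor_attractor.2.1 Φ.attractor_subset_U hε
    filter_upwards [Ioc_mem_nhdsGT hρ] with r hr p hp q hq
    exact h p hp q (hq.trans hr.2)
  obtain ⟨ρ, h, hρ⟩ := (h.and self_mem_nhdsWithin).exists
  refine ⟨ρ, hρ, fun x y hxy => ?_⟩
  rw [coding_prepend, Φ.coding_eq_word k x]
  exact h _ ⟨x, rfl⟩ _ (Φ.coding_mem_attractor _) _ hxy

/-- Points whose images under a block are close to each other are themselves close to each other.
Only injectivity is used, so no separation of the cylinders is needed. -/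
theorem exists_le_dist_coding_prepend (k : ℕ) {ρ : ℝ} (hρ : 0 < ρ) :
    ∃ η > 0, ∀ x y : SymbolSpace ℓ, ρ ≤ dist (Φ.coding y) (Φ.coding (leftShift^[k] x)) →
      η ≤ dist (Φ.coding (prepend k x y)) (Φ.coding x) := by
  have hsh : Continuous (leftShift^[k] : SymbolSpace ℓ → SymbolSpace ℓ) :=
    continuous_leftShift.iterate k
  have hc1 : Continuous fun p : SymbolSpace ℓ × SymbolSpace ℓ =>
      dist (Φ.coding p.2) (Φ.coding (leftShift^[k] p.1)) :=
    (Φ.continuous_coding.comp continuous_snd).dist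
      (Φ.continuous_coding.comp (hsh.comp continuous_fst))
  have hc2 : Continuous fun p : SymbolSpace ℓ × SymbolSpace ℓ =>
      dist (Φ.coding (prepend k p.1 p.2)) (Φ.coding p.1) :=
    (Φ.continuous_coding.comp (continuous_prepend k)).dist (Φ.continuous_coding.comp continuous_fst)
  obtain ⟨η, hη, h⟩ := (isClosed_le continuous_const hc1).isCompact.exists_forall_le' (a := 0)
    hc2.continuousOn fun p (hp : ρ ≤ _) => by
      rw [dist_pos]
      intro heq
      rw [coding_prepend, Φ.coding_eq_word k p.1] at heq
      have := Φ.injOn_word_U k p.1 (Φ.coding_mem_U _) (Φ.coding_mem_U _) heq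
      rw [this, dist_self] at hp
      exact absurd hp (not_le.2 hρ)
  exact ⟨η, hη, fun x y hxy => h (x, y) hxy⟩

variable [NeZero d]

/-- At small scales a block of maps distorts distances from a point of the attractor by at most the
extreme stretching factors of its differential, up to a factor `2`. -/
theorem exists_block_distortion (k : ℕ) : ∃ ρ > 0, ∀ r, 0 < r → r ≤ ρ → ∀ x y : SymbolSpace ℓ,
    (dist (Φ.coding (prepend k x y)) (Φ.coding x) ≤ minStretch (Φ.wordDeriv k x) / 2 * r →
      dist (Φ.coding y) (Φ.coding (leftShift^[k] x)) ≤ r) ∧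
    (dist (Φ.coding y) (Φ.coding (leftShift^[k] x)) ≤ r →
      dist (Φ.coding (prepend k x y)) (Φ.coding x) ≤ 2 * ‖Φ.wordDeriv k x‖ * r) := by
  obtain ⟨α, c, hα0, hc0, hc1, hα⟩ := Φ.exists_pow_le_minStretch_norm_le_pow
  have hαk := pow_pos hα0 k
  obtain ⟨ρ, hρ, h1⟩ := Φ.exists_uniform_wordDeriv_approx k (half_pos hαk)
  obtain ⟨η, hη, h2⟩ := Φ.exists_le_dist_coding_prepend k hρ
  refine ⟨min ρ η, lt_min hρ hη, fun r hr hrρ x y => ?_⟩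
  have hr1 := hrρ.trans (min_le_left _ _)
  have hr2 := hrρ.trans (min_le_right _ _)
  obtain ⟨hmin, hnorm⟩ := hα k x
  have hmn := minStretch_le_norm (Φ.wordDeriv k x)
  have hn1 : ‖Φ.wordDeriv k x‖ ≤ 1 := hnorm.trans (pow_le_one₀ hc0.le hc1.le)
  constructor
  · intro h
    by_contra! hlt
    -- Either `y` is within the scale of the linear approximation, or injectivity separates the
    -- images.
    rcases le_total (dist (Φ.coding y) (Φ.coding (leftShift^[k] x))) ρ with hle | hle
    · have hap := h1 x y hle
      have hst := minStretch_mul_norm_le (Φ.wordDeriv k x)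
        (Φ.coding y - Φ.coding (leftShift^[k] x))
      rw [dist_eq_norm] at h hlt
      set v := Φ.coding y - Φ.coding (leftShift^[k] x)
      set w := Φ.coding (prepend k x y) - Φ.coding x
      have htri : ‖Φ.wordDeriv k x v‖ ≤ ‖w‖ + ‖w - Φ.wordDeriv k x v‖ := by
        simpa using norm_sub_le w (w - Φ.wordDeriv k x v)
      nlinarith [mul_le_mul_of_nonneg_right hmin (norm_nonneg v)]
    · have := h2 x y hle
      nlinarith
  · intro h
    have hap := h1 x y (h.trans hr1)
    have hst := (Φ.wordDeriv k x).le_opNorm (Φ.coding y - Φ.coding (leftShift^[k] x))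
    rw [dist_eq_norm] at h ⊢
    set v := Φ.coding y - Φ.coding (leftShift^[k] x)
    set w := Φ.coding (prepend k x y) - Φ.coding x
    have htri : ‖w‖ ≤ ‖w - Φ.wordDeriv k x v‖ + ‖Φ.wordDeriv k x v‖ := by
      simpa using norm_add_le (w - Φ.wordDeriv k x v) (Φ.wordDeriv k x v)
    have h3 : α ^ k / 2 * ‖v‖ ≤ ‖Φ.wordDeriv k x‖ * r :=
      mul_le_mul (by linarith) h (norm_nonneg v) (norm_nonneg _)
    have h4 := mul_le_mul_of_nonneg_left h (norm_nonneg (Φ.wordDeriv k x))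
    linarith

end C1IFS

/-! ### Radon–Nikodym derivatives along an injective map -/

/-- If `g` is a left inverse of `S`, then `d(S_*ν)/dμ = d(S_*μ)/dμ · (dν/dμ) ∘ g`, except on the
image of a `μ`-null set, where the singular part of `ν` may be carried to. -/
theorem exists_null_rnDeriv_map_eq {α : Type*} [MeasurableSpace α] {μ ν : Measure α}
    [IsFiniteMeasure μ] [IsFiniteMeasure ν] {S g : α → α} (hS : Measurable S) (hg : Measurable g)
    (hμ : ∀ᵐ z ∂μ, g (S z) = z) (hν : ∀ᵐ z ∂ν, g (S z) = z) :
    ∃ N, MeasurableSet N ∧ μ N = 0 ∧ ∀ᵐ z ∂μ, g z ∉ N →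
      (ν.map S).rnDeriv μ z = (μ.map S).rnDeriv μ z * ν.rnDeriv μ (g z) := by
  set ψ := ν.rnDeriv μ with hψ
  have hψm : Measurable ψ := Measure.measurable_rnDeriv _ _
  set j := (μ.map S).rnDeriv μ with hj
  have hjm : Measurable j := Measure.measurable_rnDeriv _ _
  set s := ν.singularPart μ with hs
  obtain ⟨N', hN'm, hsN', hμN'⟩ := Measure.mutuallySingular_singularPart ν μ
  have hsν : s ≤ ν := Measure.singularPart_le ν μ
  have hgs : ∀ᵐ z ∂s, g (S z) = z := (Measure.absolutelyContinuous_of_le hsν).ae_le hν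
  -- The absolutely continuous part of `ν` is carried to a measure with density `ψ ∘ g` relative to
  -- `S_* μ`, whose part absolutely continuous with respect to `μ` has the asserted density.
  have hmap : (μ.withDensity ψ).map S = (μ.map S).withDensity (ψ ∘ g) := by
    ext B hB
    rw [Measure.map_apply hS hB, withDensity_apply _ (hS hB), withDensity_apply _ hB,
      setLIntegral_map hB (hψm.comp hg) hS]
    refine lintegral_congr_ae (ae_restrict_of_ae ?_)
    filter_upwards [hμ] with z hz
    rw [Function.comp_apply, hz]
  have hsplit : (μ.map S).withDensity (ψ ∘ g) =
      ((μ.map S).singularPart μ).withDensity (ψ ∘ g) + μ.withDensity (j * (ψ ∘ g)) := by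
    conv_lhs => rw [← Measure.singularPart_add_rnDeriv (μ.map S) μ]
    rw [withDensity_add_measure, ← withDensity_mul _ hjm (hψm.comp hg)]
  have hfin : IsFiniteMeasure ((μ.map S).withDensity (ψ ∘ g)) := by
    rw [← hmap]; infer_instance
  set t := ((μ.map S).singularPart μ).withDensity (ψ ∘ g) with ht
  have htfin : IsFiniteMeasure t := by
    refine ⟨lt_of_le_of_lt ?_ (measure_lt_top ((μ.map S).withDensity (ψ ∘ g)) univ)⟩
    rw [hsplit]
    exact le_self_add
  have hdfin : IsFiniteMeasure (μ.withDensity (j * (ψ ∘ g))) := by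
    refine ⟨lt_of_le_of_lt ?_ (measure_lt_top ((μ.map S).withDensity (ψ ∘ g)) univ)⟩
    rw [hsplit]
    exact le_add_self
  have htsing : t ⟂ₘ μ := (Measure.mutuallySingular_singularPart (μ.map S) μ).withDensity
  have hdecomp : ν.map S = s.map S + (t + μ.withDensity (j * (ψ ∘ g))) := by
    rw [← hsplit, ← hmap, ← Measure.map_add _ _ hS, Measure.singularPart_add_rnDeriv]
  -- The singular part of `ν` lives on the `μ`-null set `N'ᶜ`, so its image lives on `g ⁻¹' N'ᶜ`.
  have hN0 : (s.map S) (g ⁻¹' N'ᶜ)ᶜ = 0 := by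
    rw [Measure.map_apply hS (hg hN'm.compl).compl]
    refine measure_mono_null ?_ (measure_union_null hsN' (ae_iff.1 hgs))
    intro z hz
    by_contra hcon
    simp only [mem_union, not_or, mem_ofPred_eq, not_not] at hcon
    refine hz ?_
    change g (S z) ∈ N'ᶜ
    rw [hcon.2]
    exact hcon.1
  have hzero : ∀ᵐ z ∂μ, z ∈ (g ⁻¹' N'ᶜ)ᶜ → (s.map S).rnDeriv μ z = 0 := by
    rw [← ae_restrict_iff' (hg hN'm.compl).compl]
    have hle : ∫⁻ z in (g ⁻¹' N'ᶜ)ᶜ, (s.map S).rnDeriv μ z ∂μ = 0 :=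
      le_antisymm ((Measure.setLIntegral_rnDeriv_le _).trans hN0.le) zero_le
    exact (lintegral_eq_zero_iff (Measure.measurable_rnDeriv _ _)).1 hle
  refine ⟨N'ᶜ, hN'm.compl, hμN', ?_⟩
  have h1 := Measure.rnDeriv_add (s.map S) (t + μ.withDensity (j * (ψ ∘ g))) μ
  have h2 := Measure.rnDeriv_add t (μ.withDensity (j * (ψ ∘ g))) μ
  have h3 := Measure.rnDeriv_eq_zero_of_mutuallySingular htsing
    (Measure.AbsolutelyContinuous.refl μ)
  have h4 := Measure.rnDeriv_withDensity μ (hjm.mul (hψm.comp hg))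
  filter_upwards [hzero, h1, h2, h3, h4] with z h0 h1 h2 h3 h4 hz
  rw [hdecomp, h1, Pi.add_apply, h0 hz, h2, Pi.add_apply, h3, h4]
  simp

/-! ### Conditional information -/

section CondInformation

variable {Ω ι : Type*} [Fintype ι] {𝒜 : MeasurableSpace Ω} [mΩ : MeasurableSpace Ω]

theorem condInformation_eq_neg_log {m : Measure Ω} {ξ : ι → Set Ω} {x : Ω} {i : ι} (hi : x ∈ ξ i)
    (hj : ∀ j, j ≠ i → x ∉ ξ j) :
    condInformation 𝒜 m ξ x = -Real.log ((m⟦ξ i | 𝒜⟧) x) := by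
  unfold condInformation
  rw [Finset.sum_eq_single i]
  · rw [indicator_of_mem hi]
  · intro j _ hji
    exact indicator_of_notMem (hj j hji) _
  · intro h
    exact absurd (Finset.mem_univ _) h

theorem measurable_condInformation (h𝒜 : 𝒜 ≤ mΩ) (m : Measure Ω) {ξ : ι → Set Ω}
    (hξ : ∀ i, MeasurableSet (ξ i)) : Measurable (condInformation 𝒜 m ξ) := by
  unfold condInformation
  refine (Finset.measurable_sum _ fun i _ => Measurable.indicator ?_ (hξ i)).neg
  exact (stronglyMeasurable_condExp.measurable.mono h𝒜 le_rfl).log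

theorem ae_condExp_indicator_one_mem_Icc (h𝒜 : 𝒜 ≤ mΩ) (m : Measure Ω) [IsProbabilityMeasure m]
    {A : Set Ω} (hA : MeasurableSet A) : ∀ᵐ x ∂m, 0 ≤ (m⟦A | 𝒜⟧) x ∧ (m⟦A | 𝒜⟧) x ≤ 1 := by
  have hi : Integrable (A.indicator fun _ => (1 : ℝ)) m := (integrable_const 1).indicator hA
  have h1 : 0 ≤ᵐ[m] m⟦A | 𝒜⟧ := condExp_nonneg (Eventually.of_forall fun x =>
    indicator_nonneg (fun _ _ => zero_le_one) x)
  have h2 : m⟦A | 𝒜⟧ ≤ᵐ[m] m[fun _ => (1 : ℝ) | 𝒜] := condExp_mono hi (integrable_const 1)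
    (Eventually.of_forall fun x => indicator_le_self' (fun _ _ => zero_le_one) x)
  rw [condExp_const h𝒜] at h2
  filter_upwards [h1, h2] with x h1 h2 using ⟨h1, h2⟩

theorem measure_inter_condExp_le (h𝒜 : 𝒜 ≤ mΩ) (m : Measure Ω) [IsProbabilityMeasure m]
    {A : Set Ω} (hA : MeasurableSet A) {s : ℝ} (hs : 0 ≤ s) :
    m (A ∩ {x | (m⟦A | 𝒜⟧) x ≤ s}) ≤ ENNReal.ofReal s := by
  have hB : MeasurableSet[𝒜] {x | (m⟦A | 𝒜⟧) x ≤ s} :=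
    measurableSet_le (stronglyMeasurable_condExp (m := 𝒜)).measurable measurable_const
  have hi : Integrable (A.indicator fun _ => (1 : ℝ)) m := (integrable_const 1).indicator hA
  have h1 := setIntegral_condExp h𝒜 hi hB
  rw [setIntegral_indicator hA, setIntegral_const, smul_eq_mul, mul_one, inter_comm] at h1
  have h2 : ∫ x in {x | (m⟦A | 𝒜⟧) x ≤ s}, (m⟦A | 𝒜⟧) x ∂m ≤
      ∫ _x in {x | (m⟦A | 𝒜⟧) x ≤ s}, s ∂m :=
    setIntegral_mono_on integrable_condExp.integrableOn (integrable_const s).integrableOn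
      (h𝒜 _ hB) fun x hx => hx
  rw [setIntegral_const, smul_eq_mul] at h2
  have h3 : m.real {x | (m⟦A | 𝒜⟧) x ≤ s} * s ≤ s :=
    mul_le_of_le_one_left hs measureReal_le_one
  rw [← ofReal_measureReal]
  exact ENNReal.ofReal_le_ofReal (h1 ▸ h2.trans h3)

/-- The set of points of `A` where `E(χ_A | 𝒜) ≤ e⁻ⁿ` has measure at most `e⁻ⁿ`, so the information
function has exponential tails. -/
theorem integrable_condInformation (h𝒜 : 𝒜 ≤ mΩ) (m : Measure Ω) [IsProbabilityMeasure m]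
    {ξ : ι → Set Ω} (hξ : ∀ i, MeasurableSet (ξ i)) : Integrable (condInformation 𝒜 m ξ) m := by
  have hm : ∀ i, Measurable fun x => (ξ i).indicator (fun y => Real.log ((m⟦ξ i | 𝒜⟧) y)) x :=
    fun i => ((stronglyMeasurable_condExp.measurable.mono h𝒜 le_rfl).log).indicator (hξ i)
  refine (integrable_finsetSum _ fun i _ => ?_).neg
  refine integrable_of_exponential_tail (hm i) ENNReal.one_ne_top fun n => ?_
  rw [one_mul]
  refine le_trans (measure_mono_ae ?_) (measure_inter_condExp_le h𝒜 m (hξ i) (Real.exp_pos _).le)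
  filter_upwards [ae_condExp_indicator_one_mem_Icc h𝒜 m (hξ i)] with x hx hxn
  have hxn' : (n : ℝ) < |(ξ i).indicator (fun y => Real.log ((m⟦ξ i | 𝒜⟧) y)) x| := hxn
  obtain ⟨h0, h1⟩ := hx
  by_cases hxi : x ∈ ξ i
  · refine ⟨hxi, ?_⟩
    change (m⟦ξ i | 𝒜⟧) x ≤ _
    rw [indicator_of_mem hxi, abs_of_nonpos (Real.log_nonpos h0 h1)] at hxn'
    rcases h0.eq_or_lt with h | h
    · rw [← h]
      exact (Real.exp_pos _).le
    · rw [← Real.log_le_iff_le_exp h]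
      linarith
  · rw [indicator_of_notMem hxi, abs_zero] at hxn'
    exact absurd hxn' (not_lt.2 (Nat.cast_nonneg n))

end CondInformation

/-! ### The Jacobian of the coded measure -/

namespace C1IFS

variable {d ℓ : ℕ}

local notation "𝔼" => EuclideanSpace ℝ (Fin d)

theorem measurable_leftShift : Measurable (leftShift : SymbolSpace ℓ → SymbolSpace ℓ) :=
  continuous_leftShift.measurable

theorem measurable_consSymbol (u : Fin ℓ) :
    Measurable (consSymbol u : SymbolSpace ℓ → SymbolSpace ℓ) :=
  (continuous_consSymbol.comp (Continuous.prodMk_right u)).measurable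

theorem measurable_prepend (k : ℕ) (x : SymbolSpace ℓ) : Measurable (prepend k x) :=
  ((continuous_prepend k).comp (Continuous.prodMk_right x)).measurable

theorem measurableSet_firstCylinder (u : Fin ℓ) :
    MeasurableSet (firstCylinder u : Set (SymbolSpace ℓ)) :=
  measurableSet_eq_fun (measurable_pi_apply 0) measurable_const

variable [NeZero ℓ] (Φ : C1IFS d ℓ)

theorem measurable_coding : Measurable Φ.coding := Φ.continuous_coding.measurable

/-- Each `S_u` agrees on the attractor with a measurable map of the whole space that has a
measurable left inverse there. -/
theorem exists_measurable_map_leftInverse (u : Fin ℓ) : ∃ S g : 𝔼 → 𝔼, Measurable S ∧ Measurable g ∧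
    ∀ p ∈ Φ.attractor, S p = Φ.map u p ∧ g (S p) = p := by
  have hK := Φ.isAttractor_attractor.2.1.isClosed.measurableSet
  have hcont : ContinuousOn (Φ.map u) Φ.attractor :=
    (Φ.contDiffOn u).continuousOn.mono Φ.attractor_subset_U
  have hemb := hcont.measurableEmbedding hK ((Φ.injOn u).mono Φ.attractor_subset_U)
  obtain ⟨g, hg, hgS⟩ := hemb.exists_measurable_extend measurable_subtype_coe fun _ => ⟨0⟩
  obtain ⟨S, hS, hSv⟩ := (MeasurableEmbedding.subtype_coe hK).exists_measurable_extend
    hemb.measurable fun _ => ⟨0⟩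
  refine ⟨S, g, hS, hg, fun p hp => ?_⟩
  have h1 : S p = Φ.map u p := congrFun hSv ⟨p, hp⟩
  exact ⟨h1, by rw [h1]; exact congrFun hgS ⟨p, hp⟩⟩

/-- The Jacobian `d((S_u)_* μ)/dμ` of the coded measure `μ = π_* m` along the map `S_u`. -/
noncomputable def jacobian (m : Measure (SymbolSpace ℓ)) (u : Fin ℓ) : 𝔼 → ENNReal :=
  (m.map fun y => Φ.coding (consSymbol u y)).rnDeriv (m.map Φ.coding)

/-- The exceptional null set of `exists_null_rnDeriv_map_eq` is harmless here: by invariance of `m`,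
almost every `π x` is the image under `S_{x₀}` of a point `π σ x` outside of it. -/
theorem ae_rnDeriv_map_coding_consSymbol {m : Measure (SymbolSpace ℓ)} [IsFiniteMeasure m]
    (hm : MeasurePreserving leftShift m m) (ρ : Measure (SymbolSpace ℓ)) [IsFiniteMeasure ρ]
    (u : Fin ℓ) :
    ∀ᵐ x ∂m, x 0 = u →
      (ρ.map fun y => Φ.coding (consSymbol u y)).rnDeriv (m.map Φ.coding) (Φ.coding x) =
        Φ.jacobian m u (Φ.coding x) *
          (ρ.map Φ.coding).rnDeriv (m.map Φ.coding) (Φ.coding (leftShift x)) := by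
  obtain ⟨S, g, hS, hg, hSg⟩ := Φ.exists_measurable_map_leftInverse u
  have hae : ∀ ρ : Measure (SymbolSpace ℓ), ∀ᵐ z ∂(ρ.map Φ.coding), g (S z) = z := fun ρ => by
    refine (ae_map_iff Φ.measurable_coding.aemeasurable
      (measurableSet_eq_fun (hg.comp hS) measurable_id)).2 (Eventually.of_forall fun x => ?_)
    exact (hSg _ (Φ.coding_mem_attractor x)).2
  have hmap : ∀ ρ : Measure (SymbolSpace ℓ),
      (ρ.map fun y => Φ.coding (consSymbol u y)) = (ρ.map Φ.coding).map S := fun ρ => by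
    rw [Measure.map_map hS Φ.measurable_coding]
    congr 1
    funext y
    rw [coding_consSymbol, Function.comp_apply, (hSg _ (Φ.coding_mem_attractor y)).1]
  obtain ⟨N, hN, hN0, h⟩ := exists_null_rnDeriv_map_eq hS hg (hae m) (hae ρ)
  have hN1 : ∀ᵐ x ∂m, Φ.coding (leftShift x) ∉ N := by
    have h1 : ∀ᵐ x ∂m, Φ.coding x ∉ N :=
      ae_of_ae_map Φ.measurable_coding.aemeasurable (measure_eq_zero_iff_ae_notMem.1 hN0)
    exact hm.quasiMeasurePreserving.ae h1
  filter_upwards [ae_of_ae_map Φ.measurable_coding.aemeasurable h, hN1] with x hx hxN hxu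
  have hgx : g (Φ.coding x) = Φ.coding (leftShift x) := by
    obtain ⟨h1, h2⟩ := hSg _ (Φ.coding_mem_attractor (leftShift x))
    rw [Φ.coding_eq_map x, hxu, ← h1, h2]
  rw [hgx] at hx
  rw [jacobian, hmap, hmap]
  exact hx hxN

/-- The chain rule for the Jacobians of blocks of maps. -/
theorem ae_rnDeriv_map_coding_prepend {m : Measure (SymbolSpace ℓ)} [IsFiniteMeasure m]
    (hm : MeasurePreserving leftShift m m) (k : ℕ) :
    ∀ᵐ x ∂m, (m.map fun y => Φ.coding (prepend k x y)).rnDeriv (m.map Φ.coding) (Φ.coding x) =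
      ∏ i ∈ Finset.range k, Φ.jacobian m ((leftShift^[i] x) 0) (Φ.coding (leftShift^[i] x)) := by
  induction k with
  | zero =>
    have h := ae_of_ae_map Φ.measurable_coding.aemeasurable
      (Measure.rnDeriv_self (m.map Φ.coding))
    filter_upwards [h] with x hx
    rw [Finset.range_zero, Finset.prod_empty]
    exact hx
  | succ k ih =>
    have h1 : ∀ᵐ x ∂m, ∀ u : Fin ℓ, ∀ f ∈ range (prepend k : SymbolSpace ℓ → _), x 0 = u →
        (m.map fun y => Φ.coding (consSymbol u (f y))).rnDeriv (m.map Φ.coding) (Φ.coding x) =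
          Φ.jacobian m u (Φ.coding x) * (m.map fun y => Φ.coding (f y)).rnDeriv (m.map Φ.coding)
            (Φ.coding (leftShift x)) := by
      refine ae_all_iff.2 fun u => (eventually_all_finite (finite_range_prepend k)).2 ?_
      rintro _ ⟨w, rfl⟩
      have hw := measurable_prepend k w
      have h := Φ.ae_rnDeriv_map_coding_consSymbol hm (m.map (prepend k w)) u
      have hcu : Measurable fun y => Φ.coding (consSymbol u y) :=
        Φ.measurable_coding.comp (measurable_consSymbol u)
      rw [Measure.map_map Φ.measurable_coding hw, Measure.map_map hcu hw] at h
      exact h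
    have h2 := hm.quasiMeasurePreserving.ae ih
    filter_upwards [h1, h2] with x h1 h2
    rw [Finset.prod_range_succ', mul_comm]
    have h := h1 (x 0) _ ⟨leftShift x, rfl⟩ rfl
    rw [h2] at h
    exact h

/-! ### The information functions -/

/-- The difference `I_m(𝒫 | σ⁻¹π⁻¹𝓑) - I_m(𝒫 | π⁻¹𝓑)` of the two information functions. -/
noncomputable def infoIncrement (m : Measure (SymbolSpace ℓ)) (x : SymbolSpace ℓ) : ℝ :=
  condInformation Φ.shiftCodingSigma m firstCylinder x
    - condInformation Φ.codingSigma m firstCylinder x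

theorem codingSigma_eq : Φ.codingSigma = MeasurableSpace.comap Φ.coding inferInstance := by
  rw [codingSigma, BorelSpace.measurable_eq (α := 𝔼)]

theorem shiftCodingSigma_eq : Φ.shiftCodingSigma =
    MeasurableSpace.comap (Φ.coding ∘ leftShift) inferInstance := by
  rw [shiftCodingSigma, codingSigma_eq, MeasurableSpace.comap_comp]

theorem codingSigma_le : Φ.codingSigma ≤ (inferInstance : MeasurableSpace (SymbolSpace ℓ)) := by
  rw [codingSigma_eq]
  exact Φ.measurable_coding.comap_le

theorem shiftCodingSigma_le :
    Φ.shiftCodingSigma ≤ (inferInstance : MeasurableSpace (SymbolSpace ℓ)) := by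
  rw [shiftCodingSigma_eq]
  exact (Φ.measurable_coding.comp measurable_leftShift).comap_le

theorem measurable_infoIncrement (m : Measure (SymbolSpace ℓ)) :
    Measurable (Φ.infoIncrement m) :=
  (measurable_condInformation Φ.shiftCodingSigma_le m measurableSet_firstCylinder).sub
    (measurable_condInformation Φ.codingSigma_le m measurableSet_firstCylinder)

theorem integrable_infoIncrement (m : Measure (SymbolSpace ℓ)) [IsProbabilityMeasure m] :
    Integrable (Φ.infoIncrement m) m :=
  (integrable_condInformation Φ.shiftCodingSigma_le m measurableSet_firstCylinder).sub
    (integrable_condInformation Φ.codingSigma_le m measurableSet_firstCylinder)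

theorem ae_condExp_firstCylinder_eq_rnDeriv {m : Measure (SymbolSpace ℓ)} [IsFiniteMeasure m]
    {g : SymbolSpace ℓ → 𝔼} (hg : Measurable g) (u : Fin ℓ) :
    ∀ᵐ x ∂m, (m⟦firstCylinder u | MeasurableSpace.comap g inferInstance⟧) x =
      (((m.restrict (firstCylinder u)).map g).rnDeriv (m.map g) (g x)).toReal := by
  have hu := measurableSet_firstCylinder u
  have h1 := toReal_rnDeriv_map (μ := m.restrict (firstCylinder u)) (ν := m)
    Measure.restrict_le_self.absolutelyContinuous hg
  have h2 : m[fun a => ((m.restrict (firstCylinder u)).rnDeriv m a).toReal |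
      MeasurableSpace.comap g inferInstance] =ᵐ[m]
      m⟦firstCylinder u | MeasurableSpace.comap g inferInstance⟧ := by
    refine condExp_congr_ae ?_
    filter_upwards [Measure.rnDeriv_restrict_self m hu] with x hx
    rw [hx]
    by_cases hxu : x ∈ firstCylinder u <;> simp [hxu]
  filter_upwards [h1, h2] with x h1 h2
  rw [← h2, ← h1]

/-- The increment of information is the logarithm of the Jacobian: on the cylinder `[u]` the two
conditional expectations of `χ_[u]` are the densities of the images of `m|[u]` under `π` and `π σ`,
and the first of these images is the image of the second under `S_u`. -/
theorem ae_infoIncrement_eq_log_jacobian {m : Measure (SymbolSpace ℓ)} [IsFiniteMeasure m]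
    (hm : MeasurePreserving leftShift m m) :
    ∀ᵐ x ∂m, Φ.jacobian m (x 0) (Φ.coding x) ≠ 0 ∧ Φ.jacobian m (x 0) (Φ.coding x) ≠ ⊤ ∧
      Φ.infoIncrement m x = Real.log (Φ.jacobian m (x 0) (Φ.coding x)).toReal := by
  have hπ := Φ.measurable_coding
  have hπσ := hπ.comp measurable_leftShift
  have hmapσ : m.map (Φ.coding ∘ leftShift) = m.map Φ.coding := by
    rw [← Measure.map_map hπ measurable_leftShift, hm.map_eq]
  have h1 : ∀ᵐ x ∂m, ∀ u : Fin ℓ, x 0 = u →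
      ((m.restrict (firstCylinder u)).map Φ.coding).rnDeriv (m.map Φ.coding) (Φ.coding x) =
        Φ.jacobian m u (Φ.coding x) *
          ((m.restrict (firstCylinder u)).map (Φ.coding ∘ leftShift)).rnDeriv (m.map Φ.coding)
            (Φ.coding (leftShift x)) := by
    refine ae_all_iff.2 fun u => ?_
    have h := Φ.ae_rnDeriv_map_coding_consSymbol hm ((m.restrict (firstCylinder u)).map leftShift) u
    have hcu : Measurable fun y => Φ.coding (consSymbol u y) := hπ.comp (measurable_consSymbol u)
    rw [Measure.map_map hπ measurable_leftShift, Measure.map_map hcu measurable_leftShift] at h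
    have hc : (m.restrict (firstCylinder u)).map
        ((fun y => Φ.coding (consSymbol u y)) ∘ leftShift) =
        (m.restrict (firstCylinder u)).map Φ.coding := by
      refine Measure.map_congr ((ae_restrict_iff' (measurableSet_firstCylinder u)).2
        (Eventually.of_forall fun x hx => ?_))
      have hx : x 0 = u := hx
      rw [Function.comp_apply, ← hx, consSymbol_head_leftShift]
    filter_upwards [h] with x hx hxu
    rw [← hx hxu, ← hc]
  have h2 : ∀ᵐ x ∂m, ∀ u : Fin ℓ, x 0 = u →
      0 < ((m.restrict (firstCylinder u)).map Φ.coding).rnDeriv (m.map Φ.coding)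
        (Φ.coding x) := by
    refine ae_all_iff.2 fun u => ?_
    have hac : (m.restrict (firstCylinder u)).map Φ.coding ≪ m.map Φ.coding :=
      (Measure.map_mono Measure.restrict_le_self hπ).absolutelyContinuous
    have := Measure.haveLebesgueDecomposition_of_sigmaFinite
      ((m.restrict (firstCylinder u)).map Φ.coding) (m.map Φ.coding)
    exact (ae_restrict_iff' (measurableSet_firstCylinder u)).1
      (ae_of_ae_map hπ.aemeasurable (Measure.rnDeriv_pos hac))
  have h3 : ∀ᵐ x ∂m, ∀ u : Fin ℓ,
      ((m.restrict (firstCylinder u)).map Φ.coding).rnDeriv (m.map Φ.coding) (Φ.coding x) ≠ ⊤ :=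
    ae_all_iff.2 fun u => ae_of_ae_map hπ.aemeasurable (Measure.rnDeriv_ne_top _ _)
  have h4 : ∀ᵐ x ∂m, ∀ u : Fin ℓ, Φ.jacobian m u (Φ.coding x) ≠ ⊤ :=
    ae_all_iff.2 fun u => ae_of_ae_map hπ.aemeasurable (Measure.rnDeriv_ne_top _ _)
  have h5 : ∀ᵐ x ∂m, ∀ u : Fin ℓ,
      ((m.restrict (firstCylinder u)).map (Φ.coding ∘ leftShift)).rnDeriv (m.map Φ.coding)
        (Φ.coding (leftShift x)) ≠ ⊤ :=
    ae_all_iff.2 fun u => hm.quasiMeasurePreserving.ae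
      (ae_of_ae_map hπ.aemeasurable (Measure.rnDeriv_ne_top _ _))
  have h6 : ∀ᵐ x ∂m, ∀ u : Fin ℓ, (m⟦firstCylinder u | Φ.codingSigma⟧) x =
      (((m.restrict (firstCylinder u)).map Φ.coding).rnDeriv (m.map Φ.coding)
        (Φ.coding x)).toReal := by
    rw [codingSigma_eq]
    exact ae_all_iff.2 fun u => ae_condExp_firstCylinder_eq_rnDeriv hπ u
  have h7 : ∀ᵐ x ∂m, ∀ u : Fin ℓ, (m⟦firstCylinder u | Φ.shiftCodingSigma⟧) x =
      (((m.restrict (firstCylinder u)).map (Φ.coding ∘ leftShift)).rnDeriv (m.map Φ.coding)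
        (Φ.coding (leftShift x))).toReal := by
    rw [shiftCodingSigma_eq]
    refine ae_all_iff.2 fun u => ?_
    have h := ae_condExp_firstCylinder_eq_rnDeriv (m := m) hπσ u
    rw [hmapσ] at h
    exact h
  filter_upwards [h1, h2, h3, h4, h5, h6, h7] with x h1 h2 h3 h4 h5 h6 h7
  have h1 := h1 (x 0) rfl
  have h2 := h2 (x 0) rfl
  rw [h1] at h2
  have hJ : Φ.jacobian m (x 0) (Φ.coding x) ≠ 0 := fun h => by simp [h] at h2
  have hψ : ((m.restrict (firstCylinder (x 0))).map (Φ.coding ∘ leftShift)).rnDeriv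
      (m.map Φ.coding) (Φ.coding (leftShift x)) ≠ 0 := fun h => by simp [h] at h2
  refine ⟨hJ, h4 (x 0), ?_⟩
  have hx0 : x ∈ firstCylinder (x 0) := rfl
  have hxj : ∀ j, j ≠ x 0 → x ∉ firstCylinder j := fun j hj h => hj h.symm
  rw [infoIncrement, condInformation_eq_neg_log hx0 hxj, condInformation_eq_neg_log hx0 hxj, h6,
    h7, h1,
    ENNReal.toReal_mul, Real.log_mul (ENNReal.toReal_ne_zero.2 ⟨hJ, h4 _⟩)
      (ENNReal.toReal_ne_zero.2 ⟨hψ, h5 _⟩)]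
  ring

theorem ae_log_rnDeriv_prepend {m : Measure (SymbolSpace ℓ)} [IsFiniteMeasure m]
    (hm : MeasurePreserving leftShift m m) (k : ℕ) :
    ∀ᵐ x ∂m,
      (m.map fun y => Φ.coding (prepend k x y)).rnDeriv (m.map Φ.coding) (Φ.coding x) ≠ 0 ∧
      (m.map fun y => Φ.coding (prepend k x y)).rnDeriv (m.map Φ.coding) (Φ.coding x) ≠ ⊤ ∧
      Real.log ((m.map fun y => Φ.coding (prepend k x y)).rnDeriv (m.map Φ.coding)
        (Φ.coding x)).toReal = birkhoffSum leftShift (Φ.infoIncrement m) k x := by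
  have h1 := ae_all_iff.2 fun i : ℕ =>
    (hm.iterate i).quasiMeasurePreserving.ae (Φ.ae_infoIncrement_eq_log_jacobian hm)
  filter_upwards [h1, Φ.ae_rnDeriv_map_coding_prepend hm k] with x h1 h2
  rw [h2]
  refine ⟨Finset.prod_ne_zero_iff.2 fun i _ => (h1 i).1,
    ENNReal.prod_ne_top fun i _ => (h1 i).2.1, ?_⟩
  rw [ENNReal.toReal_prod, Real.log_prod fun i _ => ENNReal.toReal_ne_zero.2
    ⟨(h1 i).1, (h1 i).2.1⟩, birkhoffSum]
  exact Finset.sum_congr rfl fun i _ => (h1 i).2.2.symm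

end C1IFS

/-! ### Uniform errors in a pointwise limit at small scales -/

theorem le_iSup_rat_of_tendsto_nhdsGT {φ : ℝ → ENNReal} {r R : ℝ}
    (h : Tendsto φ (𝓝[>] r) (𝓝 (φ r))) (hr : 0 < r) (hR : r < R) :
    φ r ≤ ⨆ q : ℚ, ⨆ _ : 0 < (q : ℝ) ∧ (q : ℝ) < R, φ q := by
  by_contra! hlt
  have hev := (h.eventually (lt_mem_nhds hlt)).and (Ioo_mem_nhdsGT hR)
  obtain ⟨u, hu, hsub⟩ := (mem_nhdsGT_iff_exists_Ioo_subset).1 hev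
  obtain ⟨q, hq1, hq2⟩ := exists_rat_btwn (mem_Ioi.1 hu)
  obtain ⟨h1, h2⟩ := hsub ⟨hq1, hq2⟩
  have h3 : φ q ≤ ⨆ q : ℚ, ⨆ _ : 0 < (q : ℝ) ∧ (q : ℝ) < R, φ q :=
    le_iSup₂_of_le q ⟨hr.trans hq1, h2.2⟩ le_rfl
  exact absurd h1 (not_lt.2 h3)

/-- Right continuous functions with a limit at `0+` and a maximal function with exponential tails
converge with monotone, integrably dominated errors. -/
theorem exists_antitone_error {Ω : Type*} [MeasurableSpace Ω] {m : Measure Ω}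
    {L : Ω → ℝ → ℝ} {f : Ω → ℝ} (hLm : ∀ r, Measurable fun x => L x r) (hf : Measurable f)
    (hrc : ∀ᵐ x ∂m, ∀ r > 0, Tendsto (L x) (𝓝[>] r) (𝓝 (L x r)))
    (hlim : ∀ᵐ x ∂m, Tendsto (L x) (𝓝[>] 0) (𝓝 (f x))) {C : ENNReal} (hC : C ≠ ⊤)
    (htail : ∀ n : ℕ, m {x | ∃ r, 0 < r ∧ r ≤ 1 ∧ (n : ℝ) < |L x r|} ≤
      C * ENNReal.ofReal (Real.exp (-n)))
    {R : ℕ → ℝ} (hR : Antitone R) (hR1 : R 0 ≤ 1)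
    (hRlim : Tendsto R atTop (𝓝 0)) :
    ∃ G : ℕ → Ω → ℝ, (∀ N, Measurable (G N)) ∧ (∀ N x, 0 ≤ G N x) ∧
      (∀ᵐ x ∂m, Antitone fun N => G N x) ∧ Integrable (G 0) m ∧
      (∀ᵐ x ∂m, Tendsto (fun N => G N x) atTop (𝓝 0)) ∧
      ∀ᵐ x ∂m, ∀ N r, 0 < r → r < R N → |L x r - f x| ≤ G N x := by
  -- By right continuity, suprema over rational radii suffice, and these are measurable.
  set H : ℕ → Ω → ENNReal := fun N x =>
    ⨆ q : ℚ, ⨆ _ : 0 < (q : ℝ) ∧ (q : ℝ) < R N, ‖L x q - f x‖ₑ with hH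
  set M : Ω → ENNReal := fun x =>
    ⨆ q : ℚ, ⨆ _ : 0 < (q : ℝ) ∧ (q : ℝ) < 1, ‖L x q‖ₑ with hM
  have hHm : ∀ N, Measurable (H N) := fun N =>
    Measurable.iSup fun q => Measurable.iSup fun _ => ((hLm q).sub hf).enorm
  have hMm : Measurable M := Measurable.iSup fun q => Measurable.iSup fun _ => (hLm q).enorm
  have hMint : ∫⁻ x, M x ∂m < ⊤ := by
    refine lintegral_lt_top_of_exponential_tail hMm hC fun n => ?_
    refine le_trans (measure_mono fun x hx => ?_) (htail n)
    have hx : (n : ENNReal) < M x := hx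
    simp only [hM, lt_iSup_iff] at hx
    obtain ⟨q, ⟨hq0, hq1⟩, hq⟩ := hx
    refine ⟨q, hq0, hq1.le, ?_⟩
    rw [Real.enorm_eq_ofReal_abs, ENNReal.lt_ofReal_iff_toReal_lt (by simp)] at hq
    simpa using hq
  have hHM : ∀ᵐ x ∂m, H 0 x ≤ M x + M x := by
    filter_upwards [hrc, hlim] with x hx hl
    have hMr : ∀ r, 0 < r → r < 1 → ‖L x r‖ₑ ≤ M x := fun r h0 h1 =>
      le_iSup_rat_of_tendsto_nhdsGT (φ := fun r => ‖L x r‖ₑ) (hx r h0).enorm h0 h1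
    have hfM : ‖f x‖ₑ ≤ M x := by
      refine le_of_tendsto hl.enorm ?_
      filter_upwards [Ioo_mem_nhdsGT (zero_lt_one (α := ℝ))] with r hr using hMr r hr.1 hr.2
    refine iSup₂_le fun q hq => (enorm_sub_le).trans ?_
    exact add_le_add (hMr q hq.1 (hq.2.trans_le hR1)) hfM
  have hHint : ∫⁻ x, H 0 x ∂m ≠ ⊤ := by
    refine ((lintegral_mono_ae hHM).trans_lt ?_).ne
    rw [lintegral_add_left hMm]
    exact ENNReal.add_lt_top.2 ⟨hMint, hMint⟩
  have hHanti : ∀ x, Antitone fun N => H N x := fun x N N' hN => by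
    refine iSup₂_le fun q hq => ?_
    exact le_iSup₂_of_le q ⟨hq.1, hq.2.trans_le (hR hN)⟩ le_rfl
  have hHtop : ∀ᵐ x ∂m, ∀ N, H N x ≠ ⊤ := by
    filter_upwards [ae_lt_top (hHm 0) hHint] with x hx N
    exact ((hHanti x (Nat.zero_le N)).trans_lt hx).ne
  refine ⟨fun N x => (H N x).toReal, fun N => (hHm N).ennreal_toReal,
    fun N x => ENNReal.toReal_nonneg, ?_, integrable_toReal_of_lintegral_ne_top
      (hHm 0).aemeasurable hHint, ?_, ?_⟩
  · filter_upwards [hHtop] with x hx N N' hN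
    exact ENNReal.toReal_mono (hx N) (hHanti x hN)
  · filter_upwards [hlim, hHtop] with x hx ht
    rw [Metric.tendsto_atTop']
    intro ε hε
    have h1 := (Metric.tendsto_nhds.1 hx) (ε / 2) (half_pos hε)
    obtain ⟨δ, hδ, hsub⟩ := (mem_nhdsGT_iff_exists_Ioo_subset).1 h1
    obtain ⟨N, hN⟩ := (hRlim.eventually (gt_mem_nhds hδ)).exists
    refine ⟨N, fun n hn => ?_⟩
    rw [dist_zero_right, Real.norm_of_nonneg ENNReal.toReal_nonneg]
    refine lt_of_le_of_lt (ENNReal.toReal_le_of_le_ofReal (half_pos hε).le ?_) (half_lt_self hε)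
    refine iSup₂_le fun q hq => ?_
    have h2 : dist (L x q) (f x) < ε / 2 :=
      hsub ⟨hq.1, (hq.2.trans_le (hR hn.le)).trans hN⟩
    rw [Real.enorm_eq_ofReal_abs]
    exact ENNReal.ofReal_le_ofReal h2.le
  · filter_upwards [hrc, hHtop] with x hx ht N r h0 h1
    have h2 : ‖L x r - f x‖ₑ ≤ H N x :=
      le_iSup_rat_of_tendsto_nhdsGT (φ := fun r => ‖L x r - f x‖ₑ)
        ((hx r h0).sub_const _).enorm h0 h1
    rw [Real.enorm_eq_ofReal_abs] at h2
    exact (ENNReal.ofReal_le_iff_le_toReal (ht N)).1 h2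

/-! ### Ratios of measures of balls along a block -/

theorem ae_measure_closedBall_pos {E : Type*} [MetricSpace E] [SecondCountableTopology E]
    [MeasurableSpace E] [OpensMeasurableSpace E] (μ : Measure E) :
    ∀ᵐ z ∂μ, ∀ r > 0, 0 < μ (Metric.closedBall z r) := by
  filter_upwards [Measure.support_mem_ae (μ := μ)] with z hz r hr
  exact (Measure.mem_support_iff_forall z).1 hz _ (Metric.closedBall_mem_nhds z hr)

theorem tendsto_measureReal_closedBall_nhdsGT {E : Type*} [MetricSpace E]
    [MeasurableSpace E] [OpensMeasurableSpace E] (μ : Measure E) [IsFiniteMeasure μ] (z : E)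
    (r : ℝ) : Tendsto (fun s => μ.real (Metric.closedBall z s)) (𝓝[>] r)
      (𝓝 (μ.real (Metric.closedBall z r))) := by
  have h := tendsto_measure_biInter_gt (μ := μ) (s := Metric.closedBall z) (a := r)
    (fun s _ => Metric.isClosed_closedBall.measurableSet.nullMeasurableSet)
    (fun i j _ hij => Metric.closedBall_subset_closedBall hij)
    ⟨r + 1, by simp, measure_ne_top _ _⟩
  have hi : ⋂ s, ⋂ (_ : s > r), Metric.closedBall z s = Metric.closedBall z r := by
    ext y
    simp only [mem_iInter, Metric.mem_closedBall]
    exact ⟨fun h => le_of_forall_gt_imp_ge_of_dense h, fun h s hs => h.trans hs.le⟩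
  rw [hi] at h
  exact (ENNReal.tendsto_toReal (measure_ne_top _ _)).comp h

namespace C1IFS

variable {d ℓ : ℕ} [NeZero ℓ] (Φ : C1IFS d ℓ)

local notation "𝔼" => EuclideanSpace ℝ (Fin d)

/-- The logarithm of the mass that the coded measure gives to the ball of radius `r` at `π x`. For
almost every `x` these masses are positive, so the value `0` of the logarithm at `0` plays no role.
-/
noncomputable def logMass (m : Measure (SymbolSpace ℓ)) (x : SymbolSpace ℓ) (r : ℝ) : ℝ :=
  Real.log ((m.map Φ.coding).real (Metric.closedBall (Φ.coding x) r))

/-- The logarithm of the mass of the ball of radius `r` at `π x` with respect to the image of the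
coded measure under the block `S_{x₀} ∘ ⋯ ∘ S_{x_{k-1}}`. -/
noncomputable def blockLogMass (m : Measure (SymbolSpace ℓ)) (k : ℕ) (x : SymbolSpace ℓ) (r : ℝ) :
    ℝ :=
  Real.log ((m.map fun y => Φ.coding (prepend k x y)).real (Metric.closedBall (Φ.coding x) r))

theorem measurable_coding_prepend (k : ℕ) (x : SymbolSpace ℓ) :
    Measurable fun y => Φ.coding (prepend k x y) :=
  Φ.measurable_coding.comp (measurable_prepend k x)

theorem measurable_blockLogMass (m : Measure (SymbolSpace ℓ)) [IsFiniteMeasure m] (k : ℕ) (r : ℝ) :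
    Measurable fun x => Φ.blockLogMass m k x r := by
  have hc : Continuous fun p : SymbolSpace ℓ × SymbolSpace ℓ =>
      dist (Φ.coding (prepend k p.1 p.2)) (Φ.coding p.1) :=
    (Φ.continuous_coding.comp (continuous_prepend k)).dist (Φ.continuous_coding.comp continuous_fst)
  have h := measurable_measure_prodMk_left (ν := m)
    (isClosed_le hc (continuous_const (y := r))).measurableSet
  have heq : ∀ x, (m.map fun y => Φ.coding (prepend k x y)).real
      (Metric.closedBall (Φ.coding x) r) = (m (Prod.mk x ⁻¹' {p : SymbolSpace ℓ × SymbolSpace ℓ |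
        dist (Φ.coding (prepend k p.1 p.2)) (Φ.coding p.1) ≤ r})).toReal := fun x => by
    rw [Measure.real, Measure.map_apply (Φ.measurable_coding_prepend k x)
      Metric.isClosed_closedBall.measurableSet]
    rfl
  simp only [blockLogMass, heq]
  exact h.ennreal_toReal.log

/-- The part of the coded measure that comes from a cylinder is dominated by the image of the coded
measure under the corresponding block of maps. -/
theorem map_restrict_cylinder_le {m : Measure (SymbolSpace ℓ)}
    (hm : MeasurePreserving leftShift m m) (k : ℕ) (w : SymbolSpace ℓ) :
    (m.restrict {x | prepend k x = prepend k w}).map Φ.coding ≤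
      m.map fun y => Φ.coding (prepend k w y) := by
  have hσ := (hm.iterate k)
  have h1 : (m.restrict {x | prepend k x = prepend k w}).map Φ.coding =
      (m.restrict {x | prepend k x = prepend k w}).map
        ((fun y => Φ.coding (prepend k w y)) ∘ leftShift^[k]) := by
    refine Measure.map_congr ((ae_restrict_iff' (measurableSet_prepend_eq k w)).2
      (Eventually.of_forall fun x hx => ?_))
    have hx : prepend k x = prepend k w := hx
    rw [Function.comp_apply, ← hx, prepend_iterate_leftShift]
  rw [h1]
  refine (Measure.map_mono Measure.restrict_le_self
    ((Φ.measurable_coding_prepend k w).comp hσ.measurable)).trans ?_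
  rw [← Measure.map_map (Φ.measurable_coding_prepend k w) hσ.measurable, hσ.map_eq]

theorem ae_block_closedBall_pos {m : Measure (SymbolSpace ℓ)}
    (hm : MeasurePreserving leftShift m m) (k : ℕ) :
    ∀ᵐ x ∂m, ∀ r > 0,
      0 < (m.map fun y => Φ.coding (prepend k x y)) (Metric.closedBall (Φ.coding x) r) := by
  have h : ∀ᵐ x ∂m, ∀ f ∈ range (prepend k : SymbolSpace ℓ → _), prepend k x = f → ∀ r > 0,
      0 < (m.map fun y => Φ.coding (f y)) (Metric.closedBall (Φ.coding x) r) := by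
    refine (eventually_all_finite (finite_range_prepend k)).2 ?_
    rintro _ ⟨w, rfl⟩
    refine (ae_restrict_iff' (measurableSet_prepend_eq k w)).1 ?_
    filter_upwards [ae_of_ae_map Φ.measurable_coding.aemeasurable
      (ae_measure_closedBall_pos ((m.restrict {x | prepend k x = prepend k w}).map Φ.coding))]
      with x hx r hr
    exact (hx r hr).trans_le (Φ.map_restrict_cylinder_le hm k w _)
  filter_upwards [h] with x hx
  exact hx _ ⟨x, rfl⟩ rfl

theorem ae_block_measureReal_pos {m : Measure (SymbolSpace ℓ)} [IsFiniteMeasure m]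
    (hm : MeasurePreserving leftShift m m) (k : ℕ) :
    ∀ᵐ x ∂m, ∀ r > 0,
      0 < (m.map fun y => Φ.coding (prepend k x y)).real (Metric.closedBall (Φ.coding x) r) := by
  filter_upwards [Φ.ae_block_closedBall_pos hm k] with x hx r hr
  exact ENNReal.toReal_pos (hx r hr).ne' (measure_ne_top _ _)

theorem tendsto_blockLogMass_nhdsGT {m : Measure (SymbolSpace ℓ)} [IsFiniteMeasure m]
    (hm : MeasurePreserving leftShift m m) (k : ℕ) :
    ∀ᵐ x ∂m, ∀ r > 0, Tendsto (Φ.blockLogMass m k x) (𝓝[>] r) (𝓝 (Φ.blockLogMass m k x r)) := by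
  filter_upwards [Φ.ae_block_measureReal_pos hm k] with x hx r hr
  exact (tendsto_measureReal_closedBall_nhdsGT _ _ r).log (hx r hr).ne'

/-- The differentiation theorem for measures, together with the chain rule for the Jacobians. -/
theorem ae_tendsto_blockLogMass_sub_logMass {m : Measure (SymbolSpace ℓ)} [IsFiniteMeasure m]
    (hm : MeasurePreserving leftShift m m) (k : ℕ) :
    ∀ᵐ x ∂m, Tendsto (fun r => Φ.blockLogMass m k x r - Φ.logMass m x r) (𝓝[>] 0)
      (𝓝 (birkhoffSum leftShift (Φ.infoIncrement m) k x)) := by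
  have h1 : ∀ᵐ x ∂m, ∀ f ∈ range (prepend k : SymbolSpace ℓ → _),
      Tendsto (fun r => (m.map fun y => Φ.coding (f y)) (Metric.closedBall (Φ.coding x) r) /
        (m.map Φ.coding) (Metric.closedBall (Φ.coding x) r)) (𝓝[>] 0)
        (𝓝 ((m.map fun y => Φ.coding (f y)).rnDeriv (m.map Φ.coding) (Φ.coding x))) := by
    refine (eventually_all_finite (finite_range_prepend k)).2 ?_
    rintro _ ⟨w, rfl⟩
    exact ae_of_ae_map Φ.measurable_coding.aemeasurable (Besicovitch.ae_tendsto_rnDeriv _ _)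
  filter_upwards [h1, Φ.ae_log_rnDeriv_prepend hm k, Φ.ae_block_measureReal_pos hm k,
    Φ.ae_block_measureReal_pos hm 0] with x h1 ⟨h2, h3, h4⟩ h5 h6
  have h := h1 _ ⟨x, rfl⟩
  rw [← h4]
  have h7 := ((ENNReal.tendsto_toReal h3).comp h).log (ENNReal.toReal_ne_zero.2 ⟨h2, h3⟩)
  refine h7.congr' ?_
  filter_upwards [self_mem_nhdsWithin] with r hr
  rw [Function.comp_apply, ENNReal.toReal_div]
  exact Real.log_div (h5 r hr).ne' (h6 r hr).ne'

/-- Both tails come from the maximal inequality, the lower one because the block measure dominates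
the part of the coded measure coming from the cylinder. -/
theorem exists_tail_blockLogMass_sub_logMass {m : Measure (SymbolSpace ℓ)}
    [IsProbabilityMeasure m] (hm : MeasurePreserving leftShift m m) (k : ℕ) :
    ∃ C : ENNReal, C ≠ ⊤ ∧ ∀ n : ℕ,
      m {x | ∃ r, 0 < r ∧ r ≤ 1 ∧ (n : ℝ) < |Φ.blockLogMass m k x r - Φ.logMass m x r|} ≤
        C * ENNReal.ofReal (Real.exp (-n)) := by
  obtain ⟨N, hN⟩ := exists_measure_maximal_le 𝔼
  have hπ := Φ.measurable_coding
  set W := (finite_range_prepend (ℓ := ℓ) k).toFinset with hW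
  refine ⟨W.card * (2 * N), by finiteness, fun n => ?_⟩
  set e := ENNReal.ofReal (Real.exp (-(n : ℝ))) with he
  set t := ENNReal.ofReal (Real.exp n) with ht
  have het : e * t = 1 := by
    rw [he, ht, ← ENNReal.ofReal_mul (Real.exp_pos _).le, ← Real.exp_add]
    simp
  have hinv : ∀ a : ENNReal, t * a ≤ N * 1 → a ≤ N * e := fun a ha => by
    calc a = e * (t * a) := by rw [← mul_assoc, het, one_mul]
      _ ≤ e * (N * 1) := by gcongr
      _ = N * e := by rw [mul_one, mul_comm]
  have hexp : ∀ a b : ℝ, 0 < a → 0 < b → (n : ℝ) < Real.log a - Real.log b →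
      t * ENNReal.ofReal b ≤ ENNReal.ofReal a := fun a b ha hb hab => by
    rw [ht, ← ENNReal.ofReal_mul (Real.exp_pos _).le]
    refine ENNReal.ofReal_le_ofReal ?_
    rw [← Real.log_div ha.ne' hb.ne', Real.lt_log_iff_exp_lt (div_pos ha hb), lt_div_iff₀ hb] at hab
    exact hab.le
  -- The sets where the ratio is too large, respectively too small, somewhere, for the block `f`.
  let A : (SymbolSpace ℓ → SymbolSpace ℓ) → Set (SymbolSpace ℓ) := fun f =>
    Φ.coding ⁻¹' {z | ∃ r, 0 < r ∧ r ≤ 1 ∧ t * (m.map Φ.coding) (Metric.closedBall z r) ≤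
      (m.map fun y => Φ.coding (f y)) (Metric.closedBall z r)}
  let B : (SymbolSpace ℓ → SymbolSpace ℓ) → Set (SymbolSpace ℓ) := fun f =>
    Φ.coding ⁻¹' {z | ∃ r, 0 < r ∧ r ≤ 1 ∧
      t * ((m.restrict {x | prepend k x = f}).map Φ.coding) (Metric.closedBall z r) ≤
      (m.map Φ.coding) (Metric.closedBall z r)} ∩ {x | prepend k x = f}
  have hA : ∀ f ∈ W, m (A f) ≤ N * e := by
    intro f hf
    obtain ⟨w, rfl⟩ := (Finite.mem_toFinset _).1 hf
    refine hinv _ (le_trans ?_ ((hN (m.map Φ.coding)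
      (m.map fun y => Φ.coding (prepend k w y)) t).trans (le_of_eq ?_)))
    · exact mul_le_mul_right (Measure.le_map_apply hπ.aemeasurable _) t
    · rw [Measure.map_apply (Φ.measurable_coding_prepend k w) MeasurableSet.univ]
      simp
  have hB : ∀ f ∈ W, m (B f) ≤ N * e := by
    intro f hf
    obtain ⟨w, rfl⟩ := (Finite.mem_toFinset _).1 hf
    refine hinv _ (le_trans ?_ ((hN ((m.restrict {x | prepend k x = prepend k w}).map Φ.coding)
      (m.map Φ.coding) t).trans (le_of_eq ?_)))
    · refine mul_le_mul_right (le_trans ?_ (Measure.le_map_apply hπ.aemeasurable _)) t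
      rw [Measure.restrict_apply' (measurableSet_prepend_eq k w)]
    · rw [Measure.map_apply hπ MeasurableSet.univ]
      simp
  calc m {x | ∃ r, 0 < r ∧ r ≤ 1 ∧ (n : ℝ) < |Φ.blockLogMass m k x r - Φ.logMass m x r|}
      ≤ m (⋃ f ∈ W, A f ∪ B f) := by
        refine measure_mono_ae ?_
        filter_upwards [Φ.ae_block_measureReal_pos hm k, Φ.ae_block_measureReal_pos hm 0]
          with x h1 h2 hx
        obtain ⟨r, hr0, hr1, hr⟩ := hx
        refine mem_iUnion₂.2 ⟨prepend k x, (Finite.mem_toFinset _).2 ⟨x, rfl⟩, ?_⟩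
        rcases lt_abs.1 hr with h | h
        · refine Or.inl ⟨r, hr0, hr1, ?_⟩
          have := hexp _ _ (h1 r hr0) (h2 r hr0) h
          rwa [ofReal_measureReal, ofReal_measureReal] at this
        · refine Or.inr ⟨⟨r, hr0, hr1, ?_⟩, rfl⟩
          rw [neg_sub] at h
          have := hexp _ _ (h2 r hr0) (h1 r hr0) h
          rw [ofReal_measureReal, ofReal_measureReal] at this
          exact (mul_le_mul_right (Φ.map_restrict_cylinder_le hm k x _) t).trans this
    _ ≤ ∑ f ∈ W, m (A f ∪ B f) := measure_biUnion_finset_le _ _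
    _ ≤ ∑ _f ∈ W, (2 * N * e) := by
        refine Finset.sum_le_sum fun f hf => (measure_union_le _ _).trans ?_
        refine (add_le_add (hA f hf) (hB f hf)).trans (le_of_eq ?_)
        ring
    _ = W.card * (2 * N) * e := by
        rw [Finset.sum_const, nsmul_eq_mul]
        ring

end C1IFS

/-! ### Telescoping along an orbit -/

section Telescoping

variable {Ω : Type*}

/-- The product `ρ a(x) a(T x) ⋯ a(T^{n-1} x)`. -/
noncomputable def orbitRadius (T : Ω → Ω) (a : Ω → ℝ) (ρ : ℝ) (n : ℕ) (x : Ω) : ℝ :=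
  ρ * ∏ j ∈ Finset.range n, a (T^[j] x)

theorem orbitRadius_succ (T : Ω → Ω) (a : Ω → ℝ) (ρ : ℝ) (n : ℕ) (x : Ω) :
    orbitRadius T a ρ (n + 1) x = a x * orbitRadius T a ρ n (T x) := by
  simp only [orbitRadius, Finset.prod_range_succ', Function.iterate_succ_apply,
    Function.iterate_zero, id_eq]
  ring

theorem orbitRadius_pos {T : Ω → Ω} {a : Ω → ℝ} {ρ : ℝ} (hρ : 0 < ρ) (ha : ∀ x, 0 < a x) (n : ℕ)
    (x : Ω) : 0 < orbitRadius T a ρ n x :=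
  mul_pos hρ (Finset.prod_pos fun _ _ => ha _)

theorem orbitRadius_le {T : Ω → Ω} {a : Ω → ℝ} {ρ c : ℝ} (hρ : 0 < ρ) (ha : ∀ x, 0 < a x)
    (hac : ∀ x, a x ≤ c) (n : ℕ) (x : Ω) : orbitRadius T a ρ n x ≤ ρ * c ^ n := by
  refine mul_le_mul_of_nonneg_left ?_ hρ.le
  simpa using Finset.prod_le_prod (s := Finset.range n) (fun j _ => (ha (T^[j] x)).le)
    fun j _ => hac (T^[j] x)

theorem log_orbitRadius {T : Ω → Ω} {a : Ω → ℝ} {ρ : ℝ} (hρ : 0 < ρ) (ha : ∀ x, 0 < a x) (n : ℕ)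
    (x : Ω) : Real.log (orbitRadius T a ρ n x) =
      Real.log ρ + birkhoffSum T (fun x => Real.log (a x)) n x := by
  rw [orbitRadius, Real.log_mul hρ.ne' (Finset.prod_pos fun _ _ => ha _).ne',
    Real.log_prod fun j _ => (ha _).ne', birkhoffSum]

/-- The `j`-th step is taken at the scale left after it, the orbit radius for the remaining `n - j`
steps. -/
theorem le_sub_sum_of_step {T : Ω → Ω} {a : Ω → ℝ} {ρ : ℝ} {φ L : Ω → ℝ → ℝ} (hρ : 0 < ρ)
    (ha : ∀ x, 0 < a x) (ha1 : ∀ x, a x ≤ 1) (n : ℕ) : ∀ x,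
    (∀ j r, 0 < r → r ≤ ρ → φ (T^[j] x) (a (T^[j] x) * r) ≤
      φ (T^[j + 1] x) r - L (T^[j] x) (a (T^[j] x) * r)) →
    φ x (orbitRadius T a ρ n x) ≤ φ (T^[n] x) ρ -
      ∑ j ∈ Finset.range n, L (T^[j] x) (orbitRadius T a ρ (n - j) (T^[j] x)) := by
  induction n with
  | zero => intro x _; simp [orbitRadius]
  | succ n ih =>
    intro x h
    have h1 := ih (T x) fun j r hr hrρ => h (j + 1) r hr hrρ
    have hle : orbitRadius T a ρ n (T x) ≤ ρ := by
      simpa using orbitRadius_le hρ ha ha1 n (T x)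
    have h2 := h 0 _ (orbitRadius_pos hρ ha n (T x)) hle
    rw [Function.iterate_zero, id_eq, ← orbitRadius_succ, zero_add, Function.iterate_one] at h2
    rw [Finset.sum_range_succ']
    simp only [Function.iterate_zero, id_eq, Nat.sub_zero, Nat.add_sub_add_right,
      Function.iterate_succ_apply]
    linarith

/-- If one step of the dynamics costs `L`, and `L` converges to `f` at small scales with monotone
integrable errors, then `n` steps cost the Birkhoff sum of `f` up to `o(n)`. -/
theorem ae_eventually_le_of_step [MeasurableSpace Ω] {m : Measure Ω} [IsFiniteMeasure m]
    {T : Ω → Ω} (hT : MeasurePreserving T m m) {a : Ω → ℝ} {ρ c : ℝ} {φ L : Ω → ℝ → ℝ}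
    {f g : Ω → ℝ} {G : ℕ → Ω → ℝ} (hρ : 0 < ρ) (ha : ∀ x, 0 < a x) (hac : ∀ x, a x ≤ c)
    (hc1 : c ≤ 1)
    (hstep : ∀ᵐ x ∂m, ∀ r, 0 < r → r ≤ ρ → φ x (a x * r) ≤ φ (T x) r - L x (a x * r))
    {C : ℝ} (hC : ∀ᵐ x ∂m, φ x ρ ≤ C)
    (hGm : ∀ N, Measurable (G N)) (hG0 : ∀ N x, 0 ≤ G N x)
    (hGanti : ∀ᵐ x ∂m, Antitone fun N => G N x) (hGint : Integrable (G 0) m)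
    (hGlim : ∀ᵐ x ∂m, Tendsto (fun N => G N x) atTop (𝓝 0))
    (hG : ∀ᵐ x ∂m, ∀ N r, 0 < r → r < 2 * ρ * c ^ N → |L x r - f x| ≤ G N x)
    (hg : ∀ᵐ x ∂m, Tendsto (fun n : ℕ => birkhoffSum T f n x / n) atTop (𝓝 (g x))) :
    ∀ᵐ x ∂m, ∀ η > 0, ∀ᶠ n : ℕ in atTop,
      φ x (orbitRadius T a ρ n x) ≤ n * (-g x + η) := by
  have horb : ∀ {p : Ω → Prop}, (∀ᵐ x ∂m, p x) → ∀ᵐ x ∂m, ∀ j : ℕ, p (T^[j] x) := fun h =>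
    ae_all_iff.2 fun j => (hT.iterate j).quasiMeasurePreserving.ae h
  filter_upwards [horb hstep, horb hC, horb hG, hg,
    ae_tendsto_sum_antitone_div hT hGm hG0 hGanti hGint hGlim] with x hstep hC hG hg hmaker η hη
  have hc0 : 0 < c := (ha x).trans_le (hac x)
  have hconst : Tendsto (fun n : ℕ => C / n) atTop (𝓝 0) :=
    tendsto_const_div_atTop_nhds_zero_nat C
  have hlim := (hconst.sub hg).add hmaker
  rw [zero_sub, add_zero] at hlim
  filter_upwards [hlim.eventually (gt_mem_nhds (show -g x < -g x + η by linarith)),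
    eventually_gt_atTop 0] with n hn hn0
  have hn0' : (0 : ℝ) < n := by exact_mod_cast hn0
  have h1 := le_sub_sum_of_step (T := T) (φ := φ) (L := L) hρ ha (fun x => (hac x).trans hc1) n x
    fun j r hr hrρ => by
      rw [Function.iterate_succ_apply']
      exact hstep j r hr hrρ
  have h2 : ∀ j ∈ Finset.range n, f (T^[j] x) - G (n - j) (T^[j] x) ≤
      L (T^[j] x) (orbitRadius T a ρ (n - j) (T^[j] x)) := fun j _ => by
    have hle := orbitRadius_le (T := T) hρ ha hac (n - j) (T^[j] x)
    have hpos : 0 < ρ * c ^ (n - j) := by positivity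
    have := (abs_le.1 (hG j (n - j) _ (orbitRadius_pos hρ ha _ _) (by linarith))).1
    linarith
  have h3 := Finset.sum_le_sum h2
  rw [Finset.sum_sub_distrib] at h3
  have h4 : C / n - birkhoffSum T f n x / n +
      (∑ j ∈ Finset.range n, G (n - j) (T^[j] x)) / n =
      (C - birkhoffSum T f n x + ∑ j ∈ Finset.range n, G (n - j) (T^[j] x)) / n := by ring
  rw [h4, div_lt_iff₀ hn0'] at hn
  have h5 := hC n
  rw [birkhoffSum] at hn
  linarith

end Telescoping

theorem birkhoffSum_iterate_birkhoffSum {Ω : Type*} (T : Ω → Ω) (f : Ω → ℝ) (k n : ℕ) (x : Ω) :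
    birkhoffSum T^[k] (birkhoffSum T f k) n x = birkhoffSum T f (k * n) x := by
  induction n with
  | zero => simp
  | succ n ih =>
    rw [birkhoffSum_succ, ih, Nat.mul_succ, birkhoffSum_add, ← Function.iterate_mul]

theorem tendsto_birkhoffSum_iterate_div {Ω : Type*} {T : Ω → Ω} {f : Ω → ℝ} {k : ℕ} (hk : 0 < k)
    {x : Ω} {h : ℝ} (hx : Tendsto (fun n : ℕ => birkhoffSum T f n x / n) atTop (𝓝 h)) :
    Tendsto (fun n : ℕ => birkhoffSum T^[k] (birkhoffSum T f k) n x / n) atTop (𝓝 (k * h)) := by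
  have h1 : Tendsto (fun n : ℕ => k * n) atTop atTop := tendsto_id.const_mul_atTop' hk
  refine ((hx.comp h1).const_mul (k : ℝ)).congr' ?_
  filter_upwards [eventually_gt_atTop 0] with n hn
  have hn' : (n : ℝ) ≠ 0 := by exact_mod_cast hn.ne'
  have hk' : (k : ℝ) ≠ 0 := by exact_mod_cast hk.ne'
  rw [Function.comp_apply, birkhoffSum_iterate_birkhoffSum, Nat.cast_mul]
  field_simp

/-! ### Mass estimates along an orbit -/

namespace C1IFS

variable {d ℓ : ℕ} [NeZero ℓ] (Φ : C1IFS d ℓ)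

/-- A ball of radius `ρ` contains some ball of radius `ρ / 2` from a finite cover of the attractor,
and the members of the cover that are null sets can be ignored. -/
theorem exists_neg_logMass_le (m : Measure (SymbolSpace ℓ)) [IsProbabilityMeasure m] {ρ : ℝ}
    (hρ : 0 < ρ) : ∃ C, ∀ᵐ x ∂m, -Φ.logMass m x ρ ≤ C := by
  set μ := m.map Φ.coding with hμ
  have hprob : IsProbabilityMeasure μ :=
    Measure.isProbabilityMeasure_map Φ.measurable_coding.aemeasurable
  obtain ⟨t, ht, hcov⟩ := Metric.totallyBounded_iff.1
    Φ.isAttractor_attractor.2.1.totallyBounded (ρ / 2) (half_pos hρ)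
  have hnull : ∀ᵐ z ∂μ, ∀ y ∈ t, μ (Metric.ball y (ρ / 2)) = 0 → z ∉ Metric.ball y (ρ / 2) := by
    refine (eventually_all_finite ht).2 fun y _ => ?_
    by_cases h : μ (Metric.ball y (ρ / 2)) = 0
    · filter_upwards [measure_eq_zero_iff_ae_notMem.1 h] with z hz _ using hz
    · exact Eventually.of_forall fun z h' => absurd h' h
  obtain ⟨C, hC⟩ : ∃ C, ∀ y ∈ t, -Real.log (μ.real (Metric.ball y (ρ / 2))) ≤ C := by
    obtain ⟨C, hC⟩ := (ht.image fun y => -Real.log (μ.real (Metric.ball y (ρ / 2)))).bddAbove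
    exact ⟨C, fun y hy => hC ⟨y, hy, rfl⟩⟩
  refine ⟨C, ?_⟩
  filter_upwards [ae_of_ae_map Φ.measurable_coding.aemeasurable hnull] with x hx
  obtain ⟨y, hy, hxy⟩ := mem_iUnion₂.1 (hcov (Φ.coding_mem_attractor x))
  have hpos : μ (Metric.ball y (ρ / 2)) ≠ 0 := fun h => hx y hy h hxy
  refine le_trans (neg_le_neg (Real.log_le_log
    (ENNReal.toReal_pos hpos (measure_ne_top _ _)) (measureReal_mono ?_))) (hC y hy)
  intro z hz
  have h1 : dist z y < ρ / 2 := hz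
  have h2 : dist (Φ.coding x) y < ρ / 2 := hxy
  have h3 := dist_triangle_right z (Φ.coding x) y
  rw [Metric.mem_closedBall]
  linarith

theorem logMass_nonpos (m : Measure (SymbolSpace ℓ)) [IsProbabilityMeasure m] (x : SymbolSpace ℓ)
    (r : ℝ) : Φ.logMass m x r ≤ 0 := by
  have hprob : IsProbabilityMeasure (m.map Φ.coding) :=
    Measure.isProbabilityMeasure_map Φ.measurable_coding.aemeasurable
  exact Real.log_nonpos measureReal_nonneg measureReal_le_one

theorem exists_blockLogMass_error {m : Measure (SymbolSpace ℓ)} [IsProbabilityMeasure m]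
    (hm : MeasurePreserving leftShift m m) (k : ℕ) {R : ℕ → ℝ} (hR : Antitone R) (hR1 : R 0 ≤ 1)
    (hRlim : Tendsto R atTop (𝓝 0)) :
    ∃ G : ℕ → SymbolSpace ℓ → ℝ, (∀ N, Measurable (G N)) ∧ (∀ N x, 0 ≤ G N x) ∧
      (∀ᵐ x ∂m, Antitone fun N => G N x) ∧ Integrable (G 0) m ∧
      (∀ᵐ x ∂m, Tendsto (fun N => G N x) atTop (𝓝 0)) ∧
      ∀ᵐ x ∂m, ∀ N r, 0 < r → r < R N →
        |Φ.blockLogMass m k x r - Φ.logMass m x r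
          - birkhoffSum leftShift (Φ.infoIncrement m) k x| ≤ G N x := by
  obtain ⟨C, hC, htail⟩ := Φ.exists_tail_blockLogMass_sub_logMass hm k
  have hF : Measurable (birkhoffSum leftShift (Φ.infoIncrement m) k) :=
    Finset.measurable_sum _ fun i _ =>
      (Φ.measurable_infoIncrement m).comp (hm.measurable.iterate i)
  refine exists_antitone_error (L := fun x r => Φ.blockLogMass m k x r - Φ.logMass m x r)
    (fun r => (Φ.measurable_blockLogMass m k r).sub (Φ.measurable_blockLogMass m 0 r)) hF ?_
    (Φ.ae_tendsto_blockLogMass_sub_logMass hm k) hC htail hR hR1 hRlim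
  filter_upwards [Φ.tendsto_blockLogMass_nhdsGT hm k, Φ.tendsto_blockLogMass_nhdsGT hm 0]
    with x h1 h2 r hr
  exact (h1 r hr).sub (h2 r hr)

/-- The local projection entropy is the limit of the averages of the increments of information. -/
theorem ae_tendsto_birkhoffSum_infoIncrement {m : Measure (SymbolSpace ℓ)}
    [IsProbabilityMeasure m] (hm : MeasurePreserving leftShift m m) :
    ∀ᵐ x ∂m, Tendsto (fun n : ℕ => birkhoffSum leftShift (Φ.infoIncrement m) n x / n) atTop
      (𝓝 (Φ.localProjEntropy m x)) :=
  ae_tendsto_birkhoffSum_div hm (Φ.integrable_infoIncrement m)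

theorem antitone_mul_pow {ρ c : ℝ} (hρ : 0 < ρ) (hc0 : 0 < c) (hc1 : c < 1) :
    Antitone fun N : ℕ => 2 * ρ * c ^ N := fun _ _ h =>
  mul_le_mul_of_nonneg_left (pow_le_pow_of_le_one hc0.le hc1.le h) (by positivity)

theorem tendsto_mul_pow {ρ c : ℝ} (hc0 : 0 < c) (hc1 : c < 1) :
    Tendsto (fun N : ℕ => 2 * ρ * c ^ N) atTop (𝓝 0) := by
  simpa using (tendsto_pow_atTop_nhds_zero_of_lt_one hc0.le hc1).const_mul (2 * ρ)

variable [NeZero d]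

/-- An upper bound for the mass of the balls whose radii are products of smallest stretching factors
of blocks. -/
theorem exists_ae_logMass_le {m : Measure (SymbolSpace ℓ)} [IsProbabilityMeasure m]
    (hm : MeasurePreserving leftShift m m) {k : ℕ} (hk : 0 < k) :
    ∃ ρ > 0, ∀ᵐ x ∂m, ∀ η > 0, ∀ᶠ n : ℕ in atTop,
      Φ.logMass m x (orbitRadius leftShift^[k]
        (fun x => minStretch (Φ.wordDeriv k x) / 2) ρ n x) ≤
        n * (-(k * Φ.localProjEntropy m x) + η) := by
  obtain ⟨α, c, hα0, hc0, hc1, hα⟩ := Φ.exists_pow_le_minStretch_norm_le_pow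
  obtain ⟨ρ', hρ', hdist⟩ := Φ.exists_block_distortion k
  set ρ := min ρ' (1 / 2) with hρdef
  have hρ : 0 < ρ := lt_min hρ' (by norm_num)
  have hρ1 : 2 * ρ ≤ 1 := by linarith [min_le_right ρ' (1 / 2)]
  obtain ⟨G, hGm, hG0, hGanti, hGint, hGlim, hG⟩ := Φ.exists_blockLogMass_error hm k
    (antitone_mul_pow hρ (c := 1 / 2) (by norm_num) (by norm_num)) (by simpa using hρ1)
    (tendsto_mul_pow (by norm_num) (by norm_num))
  have ha : ∀ x, 0 < minStretch (Φ.wordDeriv k x) / 2 := fun x =>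
    half_pos (Φ.minStretch_wordDeriv_pos k x)
  have hac : ∀ x, minStretch (Φ.wordDeriv k x) / 2 ≤ 1 / 2 := fun x => by
    have := (minStretch_le_norm _).trans ((hα k x).2.trans (pow_le_one₀ hc0.le hc1.le))
    linarith
  refine ⟨ρ, hρ, ae_eventually_le_of_step (hm.iterate k)
    (L := fun x r => Φ.blockLogMass m k x r - Φ.logMass m x r) hρ ha hac (by norm_num) ?_
    (Eventually.of_forall fun x => Φ.logMass_nonpos m x ρ) hGm hG0 hGanti hGint hGlim hG ?_⟩
  · filter_upwards [Φ.ae_block_measureReal_pos hm k] with x hx r hr hrρ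
    have hle : Φ.blockLogMass m k x (minStretch (Φ.wordDeriv k x) / 2 * r) ≤
        Φ.logMass m (leftShift^[k] x) r := by
      refine Real.log_le_log (hx _ (mul_pos (ha x) hr)) ?_
      refine ENNReal.toReal_mono (measure_ne_top _ _) ?_
      rw [Measure.map_apply (Φ.measurable_coding_prepend k x)
        Metric.isClosed_closedBall.measurableSet, Measure.map_apply Φ.measurable_coding
        Metric.isClosed_closedBall.measurableSet]
      exact measure_mono fun y hy => (hdist r hr (hrρ.trans (min_le_left _ _)) x y).1 hy
    linarith
  · filter_upwards [Φ.ae_tendsto_birkhoffSum_infoIncrement hm] with x hx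
    exact tendsto_birkhoffSum_iterate_div hk hx

/-- A lower bound for the mass of the balls whose radii are products of norms of differentials of
blocks. -/
theorem exists_ae_le_logMass {m : Measure (SymbolSpace ℓ)} [IsProbabilityMeasure m]
    (hm : MeasurePreserving leftShift m m) {k : ℕ} (hk : 0 < k) {c : ℝ} (hc1 : c < 1)
    (hc : ∀ x, 2 * ‖Φ.wordDeriv k x‖ ≤ c) :
    ∃ ρ > 0, ∀ᵐ x ∂m, ∀ η > 0, ∀ᶠ n : ℕ in atTop,
      n * (-(k * Φ.localProjEntropy m x) - η) ≤
      Φ.logMass m x (orbitRadius leftShift^[k] (fun x => 2 * ‖Φ.wordDeriv k x‖) ρ n x) := by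
  obtain ⟨ρ', hρ', hdist⟩ := Φ.exists_block_distortion k
  set ρ := min ρ' (1 / 2) with hρdef
  have hρ : 0 < ρ := lt_min hρ' (by norm_num)
  have hρ1 : 2 * ρ ≤ 1 := by linarith [min_le_right ρ' (1 / 2)]
  have ha : ∀ x, 0 < 2 * ‖Φ.wordDeriv k x‖ := fun x =>
    mul_pos two_pos (Φ.norm_wordDeriv_pos k x)
  have hc0 : 0 < c := (ha fun _ => 0).trans_le (hc _)
  obtain ⟨G, hGm, hG0, hGanti, hGint, hGlim, hG⟩ := Φ.exists_blockLogMass_error hm k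
    (antitone_mul_pow hρ hc0 hc1) (by simpa using hρ1) (tendsto_mul_pow hc0 hc1)
  obtain ⟨C, hC⟩ := Φ.exists_neg_logMass_le m hρ
  have key := ae_eventually_le_of_step (hm.iterate k) (φ := fun x r => -Φ.logMass m x r)
    (L := fun x r => -(Φ.blockLogMass m k x r - Φ.logMass m x r))
    (f := fun x => -birkhoffSum leftShift (Φ.infoIncrement m) k x)
    (g := fun x => -(k * Φ.localProjEntropy m x)) hρ ha hc hc1.le ?_ hC hGm hG0 hGanti hGint
    hGlim ?_ ?_
  · refine ⟨ρ, hρ, ?_⟩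
    filter_upwards [key] with x hx η hη
    filter_upwards [hx η hη] with n hn
    rw [neg_neg] at hn
    linarith
  · filter_upwards [(hm.iterate k).quasiMeasurePreserving.ae (Φ.ae_block_measureReal_pos hm 0)]
      with x hx r hr hrρ
    have hle : Φ.logMass m (leftShift^[k] x) r ≤
        Φ.blockLogMass m k x (2 * ‖Φ.wordDeriv k x‖ * r) := by
      refine Real.log_le_log (hx r hr) ?_
      refine ENNReal.toReal_mono (measure_ne_top _ _) ?_
      rw [Measure.map_apply (Φ.measurable_coding_prepend k x)
        Metric.isClosed_closedBall.measurableSet, Measure.map_apply Φ.measurable_coding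
        Metric.isClosed_closedBall.measurableSet]
      exact measure_mono fun y hy => (hdist r hr (hrρ.trans (min_le_left _ _)) x y).2 hy
    linarith
  · filter_upwards [hG] with x hx N r h0 h1
    rw [← neg_sub', abs_neg]
    exact hx N r h0 h1
  · filter_upwards [Φ.ae_tendsto_birkhoffSum_infoIncrement hm] with x hx
    refine (tendsto_birkhoffSum_iterate_div hk hx).neg.congr fun n => ?_
    simp only [birkhoffSum, Finset.sum_neg_distrib, neg_div]

end C1IFS

/-! ### Subadditive sequences and block averages -/

/-- If a subadditive sequence with linear growth has a limiting average, then that average is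
approximated by the Birkhoff averages over blocks of suitable large lengths. -/
theorem ae_frequently_birkhoffSum_block_le {Ω : Type*} [MeasurableSpace Ω] {m : Measure Ω}
    [IsFiniteMeasure m] {T : Ω → Ω} (hT : MeasurePreserving T m m) {ψ : ℕ → Ω → ℝ}
    (hψm : ∀ n, Measurable (ψ n)) {C : ℝ} (hC : ∀ n x, |ψ n x| ≤ C * n)
    (hsub : ∀ n k x, ψ (n + k) x ≤ ψ n x + ψ k (T^[n] x)) {θ : Ω → ℝ}
    (hθ : ∀ᵐ x ∂m, Tendsto (fun n : ℕ => ψ n x / n) atTop (𝓝 (θ x))) :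
    ∀ᵐ x ∂m, ∀ η > 0, ∃ᶠ k : ℕ in atTop, 0 < k ∧ ∀ᶠ n : ℕ in atTop,
      birkhoffSum T^[k] (ψ k) n x ≤ n * (k * (θ x + η)) := by
  have hbd : ∀ n x, ‖ψ n x / n‖ ≤ |C| := fun n x => by
    rw [Real.norm_eq_abs, abs_div, Nat.abs_cast]
    refine div_le_of_le_mul₀ (Nat.cast_nonneg n) (abs_nonneg C) ((hC n x).trans ?_)
    exact mul_le_mul_of_nonneg_right (le_abs_self C) (Nat.cast_nonneg n)
  have hint : ∀ n, Integrable (ψ n) m := fun n =>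
    Integrable.of_bound (hψm n).aestronglyMeasurable (C * n) (Eventually.of_forall (hC n))
  have hθm : AEStronglyMeasurable θ m :=
    aestronglyMeasurable_of_tendsto_ae atTop (fun n => ((hψm n).div_const n).aestronglyMeasurable)
      hθ
  have hθi : Integrable θ m := by
    refine Integrable.of_bound hθm |C| ?_
    filter_upwards [hθ] with x hx
    exact le_of_tendsto' hx.norm fun n => hbd n x
  have hψθ : Tendsto (fun n : ℕ => ∫ x, ψ n x / n ∂m) atTop (𝓝 (∫ x, θ x ∂m)) :=
    tendsto_integral_of_dominated_convergence (fun _ => |C|)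
      (fun n => ((hψm n).div_const n).aestronglyMeasurable) (integrable_const _)
      (fun n => Eventually.of_forall (hbd n)) hθ
  -- By subadditivity the limit `g k / k` of the averages over blocks of length `k` is at least `θ`,
  -- and its integral tends to that of `θ`, so it is close to `θ` for infinitely many `k`.
  set g : ℕ → Ω → ℝ := fun k => m[ψ k | MeasurableSpace.invariants T^[k]] with hg
  have hB := ae_all_iff.2 fun k => ae_tendsto_birkhoffSum_div (hT.iterate k) (hint k)
  have hle : ∀ k n x, ψ (k * n) x ≤ birkhoffSum T^[k] (ψ k) n x := fun k n => by
    induction n with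
    | zero =>
      intro x
      simpa using (abs_le.1 (hC 0 x)).2
    | succ n ih =>
      intro x
      rw [birkhoffSum_succ, Nat.mul_succ, ← Function.iterate_mul]
      exact (hsub _ _ _).trans (add_le_add (ih x) le_rfl)
  have hge : ∀ k : ℕ, 0 ≤ᵐ[m] fun x => g (k + 1) x / ((k + 1 : ℕ) : ℝ) - θ x := fun k => by
    filter_upwards [hB, hθ] with x hx hθx
    have hk : (0 : ℝ) < ((k + 1 : ℕ) : ℝ) := by exact_mod_cast k.succ_pos
    have h1 : Tendsto (fun n : ℕ => (k + 1) * n) atTop atTop :=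
      tendsto_id.const_mul_atTop' k.succ_pos
    have h2 := ((hx (k + 1)).div_const ((k + 1 : ℕ) : ℝ))
    refine sub_nonneg.2 (le_of_tendsto_of_tendsto (hθx.comp h1) h2 ?_)
    filter_upwards with n
    rw [Function.comp_apply, Nat.cast_mul, div_div, mul_comm (n : ℝ)]
    exact div_le_div_of_nonneg_right (hle _ _ _) (by positivity)
  have hI : Tendsto (fun k : ℕ => ∫ x, g (k + 1) x / ((k + 1 : ℕ) : ℝ) - θ x ∂m) atTop (𝓝 0) := by
    have h1 : ∀ k : ℕ, ∫ x, g (k + 1) x / ((k + 1 : ℕ) : ℝ) - θ x ∂m =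
        ∫ x, ψ (k + 1) x / ((k + 1 : ℕ) : ℝ) ∂m - ∫ x, θ x ∂m := fun k => by
      rw [integral_sub (integrable_condExp.div_const _) hθi, integral_div, integral_div,
        integral_condExp (MeasurableSpace.invariants_le _)]
    simp only [h1]
    simpa using ((tendsto_add_atTop_iff_nat 1).2 hψθ).sub_const (∫ x, θ x ∂m)
  filter_upwards [hB, ae_frequently_lt_of_tendsto_integral_zero
    (fun k => (integrable_condExp.div_const _).sub hθi) hge hI] with x hx hfreq η hη
  refine (tendsto_add_atTop_nat 1).frequently ((hfreq η hη).mono fun k hk => ⟨k.succ_pos, ?_⟩)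
  have hk0 : (0 : ℝ) < ((k + 1 : ℕ) : ℝ) := by exact_mod_cast k.succ_pos
  have hk1 : g (k + 1) x < ((k + 1 : ℕ) : ℝ) * (θ x + η) := by
    have hk' : g (k + 1) x / ((k + 1 : ℕ) : ℝ) - θ x < η := hk
    rw [sub_lt_iff_lt_add, div_lt_iff₀ hk0] at hk'
    linarith
  filter_upwards [(hx (k + 1)).eventually (gt_mem_nhds hk1), eventually_gt_atTop 0] with n hn hn0
  have hn0' : (0 : ℝ) < n := by exact_mod_cast hn0
  rw [div_lt_iff₀ hn0'] at hn
  linarith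

/-- A subadditive sequence is bounded by its Birkhoff averages over blocks of any given length. -/
theorem eventually_le_of_tendsto_birkhoffSum_block {Ω : Type*} {T : Ω → Ω} {ψ : ℕ → Ω → ℝ} {C : ℝ}
    (hC0 : 0 ≤ C) (hC : ∀ n x, |ψ n x| ≤ C * n)
    (hsub : ∀ n k x, ψ (n + k) x ≤ ψ n x + ψ k (T^[n] x)) {k : ℕ} (hk : 0 < k) {x : Ω} {b : ℝ}
    (hb : Tendsto (fun n : ℕ => birkhoffSum T^[k] (ψ k) n x / n) atTop (𝓝 b)) {η : ℝ}
    (hη : 0 < η) : ∀ᶠ n : ℕ in atTop, ψ n x / n ≤ b / k + η := by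
  have hk' : (0 : ℝ) < k := by exact_mod_cast hk
  have hle : ∀ n, ψ (k * n) x ≤ birkhoffSum T^[k] (ψ k) n x := fun n => by
    induction n with
    | zero => simpa using (abs_le.1 (hC 0 x)).2
    | succ n ih =>
      rw [birkhoffSum_succ, Nat.mul_succ, ← Function.iterate_mul]
      exact (hsub _ _ _).trans (add_le_add ih le_rfl)
  have hdiv : Tendsto (fun n : ℕ => n / k) atTop atTop :=
    Nat.tendsto_div_const_atTop hk.ne'
  have hratio : Tendsto (fun n : ℕ => ((n / k : ℕ) : ℝ) / n) atTop (𝓝 (1 / k)) := by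
    have h1 : Tendsto (fun n : ℕ => (1 : ℝ) / n) atTop (𝓝 0) := tendsto_one_div_atTop_nhds_zero_nat
    have h2 : Tendsto (fun n : ℕ => 1 / (k : ℝ) - 1 / n) atTop (𝓝 (1 / k)) := by
      simpa using tendsto_const_nhds.sub h1
    refine tendsto_of_tendsto_of_tendsto_of_le_of_le' h2 tendsto_const_nhds ?_ ?_
    · filter_upwards [eventually_gt_atTop 0] with n hn
      have hn' : (0 : ℝ) < n := by exact_mod_cast hn
      have h3 : n < k * (n / k + 1) := Nat.lt_mul_div_succ n hk
      have h4 : (n : ℝ) < k * (((n / k : ℕ) : ℝ) + 1) := by exact_mod_cast h3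
      rw [div_sub_div _ _ hk'.ne' hn'.ne', div_le_div_iff₀ (by positivity) hn']
      nlinarith
    · filter_upwards [eventually_gt_atTop 0] with n hn
      have hn' : (0 : ℝ) < n := by exact_mod_cast hn
      have h3 : ((n / k : ℕ) : ℝ) ≤ (n : ℝ) / k := Nat.cast_div_le
      rw [div_le_div_iff₀ hn' hk', one_mul]
      rwa [le_div_iff₀ hk'] at h3
  have hlim : Tendsto (fun n : ℕ => birkhoffSum T^[k] (ψ k) (n / k) x / ((n / k : ℕ) : ℝ)
      * (((n / k : ℕ) : ℝ) / n) + C * k / n) atTop (𝓝 (b / k)) := by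
    have h1 : Tendsto (fun n : ℕ => C * k / (n : ℝ)) atTop (𝓝 0) :=
      tendsto_const_div_atTop_nhds_zero_nat (C * k)
    simpa [div_eq_mul_inv] using ((hb.comp hdiv).mul hratio).add h1
  filter_upwards [hlim.eventually (gt_mem_nhds (show b / k < b / k + η by linarith)),
    eventually_ge_atTop k] with n hn hnk
  have hq : (0 : ℝ) < ((n / k : ℕ) : ℝ) := by exact_mod_cast Nat.div_pos hnk hk
  have hn' : (0 : ℝ) < n := by exact_mod_cast hk.trans_le hnk
  refine le_trans ?_ hn.le
  rw [div_mul_div_cancel₀ hq.ne', ← add_div]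
  refine div_le_div_of_nonneg_right ?_ hn'.le
  have h1 := hsub (k * (n / k)) (n % k) x
  rw [Nat.div_add_mod] at h1
  have h2 := (abs_le.1 (hC (n % k) (T^[k * (n / k)] x))).2
  have h3 : ((n % k : ℕ) : ℝ) ≤ k := by exact_mod_cast (Nat.mod_lt n hk).le
  have h4 := mul_le_mul_of_nonneg_left h3 hC0
  linarith [hle (n / k)]

/-! ### Lyapunov exponents -/

namespace C1IFS

variable {d ℓ : ℕ} [NeZero ℓ] (Φ : C1IFS d ℓ)

/-- `log ⟦S'_{x₀…x_{n-1}}(π σⁿ x)⟧`. -/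
noncomputable def logMinStretch (n : ℕ) (x : SymbolSpace ℓ) : ℝ :=
  Real.log (minStretch (Φ.wordDeriv n x))

/-- `log ‖S'_{x₀…x_{n-1}}(π σⁿ x)‖`. -/
noncomputable def logNorm (n : ℕ) (x : SymbolSpace ℓ) : ℝ := Real.log ‖Φ.wordDeriv n x‖

theorem measurable_logNorm (n : ℕ) : Measurable (Φ.logNorm n) :=
  (Φ.continuous_wordDeriv n).norm.measurable.log

variable [NeZero d]

theorem logMinStretch_le_logNorm (n : ℕ) (x : SymbolSpace ℓ) :
    Φ.logMinStretch n x ≤ Φ.logNorm n x :=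
  Real.log_le_log (Φ.minStretch_wordDeriv_pos n x) (minStretch_le_norm _)

theorem exists_log_bounds : ∃ C κ : ℝ, 0 < κ ∧ ∀ (n : ℕ) (x : SymbolSpace ℓ),
    -(C * n) ≤ Φ.logMinStretch n x ∧ Φ.logNorm n x ≤ -(κ * n) := by
  obtain ⟨α, c, hα0, hc0, hc1, h⟩ := Φ.exists_pow_le_minStretch_norm_le_pow
  refine ⟨-Real.log α, -Real.log c, neg_pos.2 (Real.log_neg hc0 hc1), fun n x => ⟨?_, ?_⟩⟩
  · have := Real.log_le_log (pow_pos hα0 n) (h n x).1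
    rw [Real.log_pow] at this
    unfold logMinStretch
    linarith
  · have := Real.log_le_log (Φ.norm_wordDeriv_pos n x) (h n x).2
    rw [Real.log_pow] at this
    unfold logNorm
    linarith

theorem exists_abs_log_le : ∃ C : ℝ, 0 ≤ C ∧ ∀ (n : ℕ) (x : SymbolSpace ℓ),
    |Φ.logMinStretch n x| ≤ C * n ∧ |Φ.logNorm n x| ≤ C * n := by
  obtain ⟨C, κ, hκ, h⟩ := Φ.exists_log_bounds
  refine ⟨|C|, abs_nonneg C, fun n x => ?_⟩
  obtain ⟨h1, h2⟩ := h n x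
  have h3 := Φ.logMinStretch_le_logNorm n x
  have h4 : C * n ≤ |C| * n := mul_le_mul_of_nonneg_right (le_abs_self C) (Nat.cast_nonneg n)
  have h5 : 0 ≤ κ * n := by positivity
  have h6 : 0 ≤ |C| * n := by positivity
  constructor <;> rw [abs_le] <;> constructor <;> linarith

theorem logNorm_add_le (n k : ℕ) (x : SymbolSpace ℓ) :
    Φ.logNorm (n + k) x ≤ Φ.logNorm n x + Φ.logNorm k (leftShift^[n] x) := by
  unfold logNorm
  rw [← Real.log_mul (Φ.norm_wordDeriv_pos _ _).ne' (Φ.norm_wordDeriv_pos _ _).ne']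
  refine Real.log_le_log (Φ.norm_wordDeriv_pos _ _) ?_
  rw [wordDeriv_add]
  exact ContinuousLinearMap.opNorm_comp_le _ _

theorem neg_logMinStretch_add_le (n k : ℕ) (x : SymbolSpace ℓ) :
    -Φ.logMinStretch (n + k) x ≤ -Φ.logMinStretch n x + -Φ.logMinStretch k (leftShift^[n] x) := by
  unfold logMinStretch
  rw [← neg_add, ← Real.log_mul (Φ.minStretch_wordDeriv_pos _ _).ne'
    (Φ.minStretch_wordDeriv_pos _ _).ne']
  refine neg_le_neg (Real.log_le_log (mul_pos (Φ.minStretch_wordDeriv_pos _ _)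
    (Φ.minStretch_wordDeriv_pos _ _)) ?_)
  rw [wordDeriv_add]
  exact minStretch_mul_le_comp _ _

theorem measurable_logMinStretch (n : ℕ) : Measurable (Φ.logMinStretch n) :=
  (continuous_minStretch.comp (Φ.continuous_wordDeriv n)).measurable.log

/-- Where the upper and lower Lyapunov exponents agree, both averages converge. -/
theorem tendsto_log_div_of_upperLyapunov_eq {κ : ℝ}
    (hκ : ∀ (n : ℕ) (x : SymbolSpace ℓ), Φ.logNorm n x ≤ -(κ * n))
    {x : SymbolSpace ℓ} (hx : Φ.upperLyapunov x = Φ.lowerLyapunov x) :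
    Tendsto (fun n : ℕ => Φ.logMinStretch n x / n) atTop (𝓝 (-Φ.lyapunov x)) ∧
    Tendsto (fun n : ℕ => Φ.logNorm n x / n) atTop (𝓝 (-Φ.lyapunov x)) ∧
    Φ.upperLyapunov x = (Φ.lyapunov x : EReal) ∧ κ ≤ Φ.lyapunov x := by
  obtain ⟨C, hC0, hC⟩ := Φ.exists_abs_log_le
  set u : ℕ → EReal := fun n => ((1 / (n : ℝ) * Φ.logMinStretch n x : ℝ) : EReal) with hu
  set v : ℕ → EReal := fun n => ((1 / (n : ℝ) * Φ.logNorm n x : ℝ) : EReal) with hv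
  have huv : u ≤ v := fun n => EReal.coe_le_coe_iff.2
    (mul_le_mul_of_nonneg_left (Φ.logMinStretch_le_logNorm n x) (by positivity))
  have heq : liminf u atTop = limsup v atTop := neg_injective hx
  have h1 : liminf u atTop ≤ limsup u atTop := liminf_le_limsup
  have h2 : limsup u atTop ≤ limsup v atTop := limsup_le_limsup (Eventually.of_forall huv)
  have h3 : liminf u atTop ≤ liminf v atTop := liminf_le_liminf (Eventually.of_forall huv)
  have h4 : liminf v atTop ≤ limsup v atTop := liminf_le_limsup
  have hut : Tendsto u atTop (𝓝 (limsup v atTop)) :=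
    tendsto_of_liminf_eq_limsup heq (le_antisymm h2 (heq ▸ h1))
  have hvt : Tendsto v atTop (𝓝 (limsup v atTop)) :=
    tendsto_of_liminf_eq_limsup (le_antisymm h4 (heq ▸ h3)) rfl
  have hlow : ((-C : ℝ) : EReal) ≤ limsup v atTop := by
    refine ge_of_tendsto hvt ?_
    filter_upwards [eventually_gt_atTop 0] with n hn
    have hn' : (0 : ℝ) < n := by exact_mod_cast hn
    refine EReal.coe_le_coe_iff.2 ?_
    rw [one_div, inv_mul_eq_div, le_div_iff₀ hn']
    linarith [(abs_le.1 (hC n x).2).1]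
  have hupp : limsup v atTop ≤ ((-κ : ℝ) : EReal) := by
    refine le_of_tendsto hvt ?_
    filter_upwards [eventually_gt_atTop 0] with n hn
    have hn' : (0 : ℝ) < n := by exact_mod_cast hn
    refine EReal.coe_le_coe_iff.2 ?_
    rw [one_div, inv_mul_eq_div, div_le_iff₀ hn']
    linarith [hκ n x]
  obtain ⟨l, hl⟩ : ∃ l : ℝ, limsup v atTop = (l : EReal) := by
    refine ⟨(limsup v atTop).toReal, (EReal.coe_toReal ?_ ?_).symm⟩
    · exact (hupp.trans_lt (EReal.coe_lt_top _)).ne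
    · exact ((EReal.bot_lt_coe _).trans_le hlow).ne'
  have hup : Φ.upperLyapunov x = ((-l : ℝ) : EReal) := by
    change -liminf u atTop = _
    rw [heq, hl, EReal.coe_neg]
  have hly : Φ.lyapunov x = -l := by
    rw [lyapunov, hup, EReal.toReal_coe]
  rw [hl] at hut hvt hupp
  rw [hly, neg_neg]
  refine ⟨?_, ?_, hup, ?_⟩
  · refine (EReal.tendsto_coe.1 hut).congr fun n => ?_
    rw [one_div, inv_mul_eq_div]
  · refine (EReal.tendsto_coe.1 hvt).congr fun n => ?_
    rw [one_div, inv_mul_eq_div]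
  · have := EReal.coe_le_coe_iff.1 hupp
    linarith

/-- Weak conformality makes both logarithms additive up to a uniformly sublinear error, and then
the pointwise ergodic theorem for blocks suffices for the existence of the exponents. -/
theorem IsWeaklyConformal.isConformalFor {Φ : C1IFS d ℓ} (hΦ : Φ.IsWeaklyConformal)
    {m : Measure (SymbolSpace ℓ)} [IsProbabilityMeasure m]
    (hm : MeasurePreserving leftShift m m) : Φ.IsConformalFor m := by
  obtain ⟨C, hC0, hC⟩ := Φ.exists_abs_log_le
  have hint : ∀ {ψ : SymbolSpace ℓ → ℝ} {K : ℝ}, Measurable ψ → (∀ x, |ψ x| ≤ K) →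
      Integrable ψ m := fun hψ hK =>
    Integrable.of_bound hψ.aestronglyMeasurable _ (Eventually.of_forall hK)
  have hB := ae_all_iff.2 fun k : ℕ => ae_tendsto_birkhoffSum_div (hm.iterate k)
    (hint (Φ.measurable_logNorm k) fun x => (hC k x).2)
  have hA := ae_all_iff.2 fun k : ℕ => ae_tendsto_birkhoffSum_div (hm.iterate k)
    (hint (Φ.measurable_logMinStretch k).neg fun x => by
      rw [Pi.neg_apply, abs_neg]; exact (hC k x).1)
  filter_upwards [hA, hB] with x hA hB
  set u : ℕ → EReal := fun n => ((1 / (n : ℝ) * Φ.logMinStretch n x : ℝ) : EReal) with hu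
  set v : ℕ → EReal := fun n => ((1 / (n : ℝ) * Φ.logNorm n x : ℝ) : EReal) with hv
  have huv : u ≤ v := fun n => EReal.coe_le_coe_iff.2
    (mul_le_mul_of_nonneg_left (Φ.logMinStretch_le_logNorm n x) (by positivity))
  have h1 : liminf u atTop ≤ limsup v atTop :=
    (liminf_le_liminf (Eventually.of_forall huv)).trans liminf_le_limsup
  suffices h : limsup v atTop ≤ liminf u atTop by
    change -liminf u atTop = -limsup v atTop
    rw [le_antisymm h1 h]
  -- Blocks of a length `k` on which the two logarithms differ by little compared with `k`.
  have key : ∀ ε > 0, ∃ s : ℝ, limsup v atTop ≤ ((s + ε : ℝ) : EReal) ∧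
      ((s - ε : ℝ) : EReal) ≤ liminf u atTop := by
    intro ε hε
    obtain ⟨k, hk, hk0⟩ := (((Metric.tendstoUniformly_iff.1 hΦ) (ε / 2) (half_pos hε)).and
      (eventually_gt_atTop 0)).exists
    have hk' : (0 : ℝ) < k := by exact_mod_cast hk0
    set b := (m[Φ.logNorm k | MeasurableSpace.invariants leftShift^[k]]) x
    set a := (m[-Φ.logMinStretch k | MeasurableSpace.invariants leftShift^[k]]) x
    have hab : b + a ≤ k * (ε / 2) := by
      refine le_of_tendsto' ((hB k).add (hA k)) fun n => ?_
      rw [← add_div]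
      refine div_le_of_le_mul₀ (Nat.cast_nonneg n) (by positivity) ?_
      simp only [birkhoffSum, ← Finset.sum_add_distrib, Pi.neg_apply]
      refine (Finset.sum_le_card_nsmul _ _ (k * (ε / 2)) fun j _ => ?_).trans (le_of_eq ?_)
      · have h2 := hk ((leftShift^[k])^[j] x)
        rw [dist_comm, dist_zero_right, norm_mul, Real.norm_of_nonneg (by positivity),
          one_div, inv_mul_lt_iff₀ hk'] at h2
        have h3 := neg_abs_le (Real.log (minStretch (Φ.wordDeriv k ((leftShift^[k])^[j] x))) -
          Real.log ‖Φ.wordDeriv k ((leftShift^[k])^[j] x)‖)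
        rw [Real.norm_eq_abs] at h2
        unfold logNorm logMinStretch
        linarith
      · rw [Finset.card_range, nsmul_eq_mul]
        ring
    have hv1 := eventually_le_of_tendsto_birkhoffSum_block (T := leftShift) hC0
      (fun n x => (hC n x).2) Φ.logNorm_add_le hk0 (hB k) (half_pos hε)
    have hu1 := eventually_le_of_tendsto_birkhoffSum_block (T := leftShift)
      (ψ := fun n => -Φ.logMinStretch n) hC0
      (fun n x => by rw [Pi.neg_apply, abs_neg]; exact (hC n x).1) Φ.neg_logMinStretch_add_le hk0
      (hA k) hε
    refine ⟨-(a / k), ?_, ?_⟩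
    · refine limsup_le_of_le (by isBoundedDefault) ?_
      filter_upwards [hv1] with n hn
      refine EReal.coe_le_coe_iff.2 ?_
      rw [one_div, inv_mul_eq_div]
      have h2 : b / k + a / k ≤ ε / 2 := by
        rw [← add_div, div_le_iff₀ hk']
        linarith
      linarith
    · refine le_liminf_of_le (by isBoundedDefault) ?_
      filter_upwards [hu1] with n hn
      refine EReal.coe_le_coe_iff.2 ?_
      rw [one_div, inv_mul_eq_div]
      rw [Pi.neg_apply, neg_div] at hn
      linarith
  refine EReal.le_of_forall_lt_iff_le.1 fun z hz => ?_
  by_contra! hlt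
  obtain ⟨w, hw1, hw2⟩ := EReal.lt_iff_exists_real_btwn.1 hlt
  have hwz : z < w := EReal.coe_lt_coe_iff.1 hw1
  obtain ⟨s, hs1, hs2⟩ := key ((w - z) / 2) (by linarith)
  have h2 : w < s + (w - z) / 2 := EReal.coe_lt_coe_iff.1 (hw2.trans_le hs1)
  have h3 : s - (w - z) / 2 < z := EReal.coe_lt_coe_iff.1 (hs2.trans_lt hz)
  linarith

end C1IFS

/-! ### From a sequence of radii to all radii -/

theorem eventually_exists_lt_le_of_tendsto_zero {R : ℕ → ℝ} (hRpos : ∀ n, 0 < R n)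
    (hR : Tendsto R atTop (𝓝 0)) (N : ℕ) :
    ∀ᶠ r in 𝓝[>] (0 : ℝ), ∃ n ≥ N, R (n + 1) < r ∧ r ≤ R n := by
  filter_upwards [Ioo_mem_nhdsGT (hRpos N)] with r hr
  have hex : ∃ j, R (N + j) < r := by
    have h := (tendsto_add_atTop_iff_nat N).2 hR
    obtain ⟨j, hj⟩ := (h.eventually (gt_mem_nhds hr.1)).exists
    exact ⟨j, by rwa [add_comm]⟩
  classical
  have hpos : Nat.find hex ≠ 0 := fun h0 => by
    have := Nat.find_spec hex
    rw [h0] at this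
    exact this.not_ge hr.2.le
  obtain ⟨j, hj⟩ := Nat.exists_eq_succ_of_ne_zero hpos
  refine ⟨N + j, Nat.le_add_right _ _, ?_, ?_⟩
  · have := Nat.find_spec hex
    rwa [hj] at this
  · exact not_lt.1 (Nat.find_min hex (hj ▸ Nat.lt_succ_self j))

/-- If `f` is at most `-n p` at radii not smaller than `e^{-n q}`, then `f r ≤ t log r` for small
`r` as soon as `t q < p`: consecutive radii may be far apart, but the bounds for their logarithms
are not. -/
theorem eventually_le_mul_log_of_sequence {f : ℝ → ℝ} (hf : ∀ r s, 0 < r → r ≤ s → f r ≤ f s)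
    {R : ℕ → ℝ} (hRpos : ∀ n, 0 < R n) (hR : Tendsto R atTop (𝓝 0)) {p q t : ℝ}
    (hp : ∀ᶠ n : ℕ in atTop, f (R n) ≤ -(n * p))
    (hq : ∀ᶠ n : ℕ in atTop, -(n * q) ≤ Real.log (R n)) (ht : 0 ≤ t) (htq : t * q < p) :
    ∀ᶠ r in 𝓝[>] (0 : ℝ), f r ≤ t * Real.log r := by
  obtain ⟨N₁, hN₁⟩ := eventually_atTop.1 (hp.and hq)
  obtain ⟨N₂, hN₂⟩ := exists_nat_gt (t * q / (p - t * q))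
  filter_upwards [eventually_exists_lt_le_of_tendsto_zero hRpos hR (max N₁ N₂),
    self_mem_nhdsWithin] with r ⟨n, hn, h1, h2⟩ hr
  have hn1 : N₁ ≤ n := (le_max_left _ _).trans hn
  have hn2 : (N₂ : ℝ) ≤ n := by exact_mod_cast (le_max_right _ _).trans hn
  have h3 : t * q ≤ n * (p - t * q) := by
    rw [← div_le_iff₀ (sub_pos.2 htq)]
    exact hN₂.le.trans hn2
  have h4 := mul_le_mul_of_nonneg_left ((hN₁ (n + 1) (by omega)).2.trans
    (Real.log_le_log (hRpos _) h1.le)) ht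
  push_cast at h4
  linarith [hf r _ hr h2, (hN₁ n hn1).1]

/-- The counterpart of `eventually_le_mul_log_of_sequence` for lower bounds. -/
theorem eventually_mul_log_le_of_sequence {f : ℝ → ℝ} (hf : ∀ r s, 0 < r → r ≤ s → f r ≤ f s)
    {R : ℕ → ℝ} (hRpos : ∀ n, 0 < R n) (hR : Tendsto R atTop (𝓝 0)) {p q t : ℝ}
    (hp : ∀ᶠ n : ℕ in atTop, -(n * p) ≤ f (R n))
    (hq : ∀ᶠ n : ℕ in atTop, Real.log (R n) ≤ -(n * q)) (ht : 0 ≤ t) (htq : p < t * q) :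
    ∀ᶠ r in 𝓝[>] (0 : ℝ), t * Real.log r ≤ f r := by
  obtain ⟨N₁, hN₁⟩ := eventually_atTop.1 (hp.and hq)
  obtain ⟨N₂, hN₂⟩ := exists_nat_gt (p / (t * q - p))
  filter_upwards [eventually_exists_lt_le_of_tendsto_zero hRpos hR (max N₁ N₂),
    self_mem_nhdsWithin] with r ⟨n, hn, h1, h2⟩ hr
  have hn1 : N₁ ≤ n := (le_max_left _ _).trans hn
  have hn2 : (N₂ : ℝ) ≤ n := by exact_mod_cast (le_max_right _ _).trans hn
  have h3 : p ≤ n * (t * q - p) := by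
    rw [← div_le_iff₀ (sub_pos.2 htq)]
    exact hN₂.le.trans hn2
  have h4 := mul_le_mul_of_nonneg_left ((Real.log_le_log hr h2).trans (hN₁ n hn1).2) ht
  have h5 := (hN₁ (n + 1) (by omega)).1
  push_cast at h5
  linarith [hf _ _ (hRpos _) h1.le]

theorem tendsto_div_log_of_eventually {f : ℝ → ℝ} (hf0 : ∀ r, f r ≤ 0) {s : ℝ}
    (h1 : ∀ t, 0 ≤ t → t < s → ∀ᶠ r in 𝓝[>] (0 : ℝ), f r ≤ t * Real.log r)
    (h2 : ∀ t, s < t → ∀ᶠ r in 𝓝[>] (0 : ℝ), t * Real.log r ≤ f r) :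
    Tendsto (fun r => f r / Real.log r) (𝓝[>] 0) (𝓝 s) := by
  have hlog : ∀ᶠ r in 𝓝[>] (0 : ℝ), Real.log r < 0 := by
    filter_upwards [Ioo_mem_nhdsGT one_pos] with r hr
    exact Real.log_neg hr.1 hr.2
  refine tendsto_order.2 ⟨fun a ha => ?_, fun b hb => ?_⟩
  · rcases lt_or_ge a 0 with ha0 | ha0
    · filter_upwards [hlog] with r hr
      exact ha0.trans_le (div_nonneg_of_nonpos (hf0 r) hr.le)
    · filter_upwards [hlog, h1 ((a + s) / 2) (by linarith) (by linarith)] with r hr h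
      rw [lt_div_iff_of_neg hr]
      nlinarith
  · filter_upwards [hlog, h2 ((b + s) / 2) (by linarith)] with r hr h
    rw [div_lt_iff_of_neg hr]
    nlinarith

theorem hasLocalDim_of_tendsto {d : ℕ} {μ : Measure (EuclideanSpace ℝ (Fin d))} [IsFiniteMeasure μ]
    {z : EuclideanSpace ℝ (Fin d)} {s : ℝ} (hpos : ∀ r > 0, 0 < μ.real (Metric.closedBall z r))
    (h : Tendsto (fun r => Real.log (μ.real (Metric.closedBall z r)) / Real.log r) (𝓝[>] 0) (𝓝 s)) :
    HasLocalDim μ z s := by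
  have h1 : Tendsto (fun r : ℝ => ENNReal.log (μ (Metric.closedBall z r)) / (Real.log r : EReal))
      (𝓝[>] 0) (𝓝 (s : EReal)) := by
    refine ((continuous_coe_real_ereal.tendsto s).comp h).congr' ?_
    filter_upwards [self_mem_nhdsWithin] with r hr
    rw [Function.comp_apply, EReal.coe_div, ENNReal.log_pos_real' (hpos r hr)]
    rfl
  exact ⟨h1.liminf_eq, h1.limsup_eq⟩

/-- The local dimension is determined by the masses of the balls with dyadic radii. -/
theorem hasLocalDim_of_tendsto_dyadic {d : ℕ} {μ : Measure (EuclideanSpace ℝ (Fin d))}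
    [IsProbabilityMeasure μ] {z : EuclideanSpace ℝ (Fin d)} {s : ℝ}
    (hpos : ∀ r > 0, 0 < μ.real (Metric.closedBall z r))
    (h : Tendsto (fun n : ℕ => Real.log (μ.real (Metric.closedBall z ((1 / 2) ^ n))) /
      Real.log ((1 / 2) ^ n)) atTop (𝓝 s)) :
    HasLocalDim μ z s := by
  have hf : ∀ r s, 0 < r → r ≤ s → Real.log (μ.real (Metric.closedBall z r)) ≤
      Real.log (μ.real (Metric.closedBall z s)) := fun r s hr hrs =>
    Real.log_le_log (hpos r hr) (measureReal_mono (Metric.closedBall_subset_closedBall hrs))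
  have hf0 : ∀ r, Real.log (μ.real (Metric.closedBall z r)) ≤ 0 := fun r =>
    Real.log_nonpos measureReal_nonneg measureReal_le_one
  have hlogn : ∀ n : ℕ, Real.log ((1 / 2) ^ n) = -(n * Real.log 2) := fun n => by
    rw [Real.log_pow, one_div, Real.log_inv]
    ring
  have h2 : 0 < Real.log 2 := Real.log_pos one_lt_two
  have hR : Tendsto (fun n : ℕ => (1 / 2 : ℝ) ^ n) atTop (𝓝 0) :=
    tendsto_pow_atTop_nhds_zero_of_lt_one (by norm_num) (by norm_num)
  have hs : 0 ≤ s := ge_of_tendsto' h fun n => div_nonneg_of_nonpos (hf0 _) <| by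
    rw [hlogn]
    exact neg_nonpos.2 (by positivity)
  refine hasLocalDim_of_tendsto hpos (tendsto_div_log_of_eventually hf0 ?_ ?_)
  · intro t ht hts
    refine eventually_le_mul_log_of_sequence hf (fun n => by positivity) hR
      (p := (t + s) / 2 * Real.log 2) (q := Real.log 2) ?_
      (Eventually.of_forall fun n => (hlogn n).ge) ht (by nlinarith)
    filter_upwards [h.eventually (lt_mem_nhds (show (t + s) / 2 < s by linarith)),
      eventually_gt_atTop 0] with n hn hn0
    have hn0' : (0 : ℝ) < n := by exact_mod_cast hn0
    rw [hlogn, lt_div_iff_of_neg (neg_lt_zero.2 (mul_pos hn0' h2))] at hn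
    linarith
  · intro t hts
    refine eventually_mul_log_le_of_sequence hf (fun n => by positivity) hR
      (p := (t + s) / 2 * Real.log 2) (q := Real.log 2) ?_
      (Eventually.of_forall fun n => (hlogn n).le) (hs.trans hts.le) (by nlinarith)
    filter_upwards [h.eventually (gt_mem_nhds (show s < (t + s) / 2 by linarith)),
      eventually_gt_atTop 0] with n hn hn0
    have hn0' : (0 : ℝ) < n := by exact_mod_cast hn0
    rw [hlogn, div_lt_iff_of_neg (neg_lt_zero.2 (mul_pos hn0' h2))] at hn
    linarith

/-! ### The local dimension -/

namespace C1IFS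

variable {d ℓ : ℕ} [NeZero ℓ] (Φ : C1IFS d ℓ)

theorem logMass_mono {m : Measure (SymbolSpace ℓ)} [IsProbabilityMeasure m] {x : SymbolSpace ℓ}
    (hpos : ∀ r > 0, 0 < (m.map Φ.coding).real (Metric.closedBall (Φ.coding x) r)) (r s : ℝ)
    (hr : 0 < r) (hrs : r ≤ s) : Φ.logMass m x r ≤ Φ.logMass m x s := by
  have hprob : IsProbabilityMeasure (m.map Φ.coding) :=
    Measure.isProbabilityMeasure_map Φ.measurable_coding.aemeasurable
  exact Real.log_le_log (hpos r hr) (measureReal_mono (Metric.closedBall_subset_closedBall hrs))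

variable [NeZero d]

/-- The lower bound for the local dimension, at a single point. -/
theorem eventually_logMass_le_mul_log {m : Measure (SymbolSpace ℓ)} [IsProbabilityMeasure m]
    {x : SymbolSpace ℓ}
    (hpos : ∀ r > 0, 0 < (m.map Φ.coding).real (Metric.closedBall (Φ.coding x) r)) {h lam t : ℝ}
    (hmass : ∀ k : ℕ, 0 < k → ∃ ρ > 0, ∀ η > 0, ∀ᶠ n : ℕ in atTop,
      Φ.logMass m x (orbitRadius leftShift^[k] (fun x => minStretch (Φ.wordDeriv k x) / 2) ρ n x) ≤
        n * (-(k * h) + η))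
    (hlam : ∀ η > 0, ∃ᶠ k : ℕ in atTop, 0 < k ∧ ∀ᶠ n : ℕ in atTop,
      birkhoffSum leftShift^[k] (-Φ.logMinStretch k) n x ≤ n * (k * (lam + η)))
    (ht : 0 ≤ t) (hth : t * lam < h) :
    ∀ᶠ r in 𝓝[>] (0 : ℝ), Φ.logMass m x r ≤ t * Real.log r := by
  obtain ⟨α, c, hα0, hc0, hc1, hα⟩ := Φ.exists_pow_le_minStretch_norm_le_pow
  set η : ℝ := (h - t * lam) / (2 * (t + 1)) with hη
  have hη0 : 0 < η := div_pos (sub_pos.2 hth) (by positivity)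
  have hηt : t * η < h - t * lam := by
    rw [hη, mul_div_assoc', div_lt_iff₀ (by positivity)]
    nlinarith
  -- The loss of a factor `2` for each block is negligible when the blocks are long.
  obtain ⟨k, ⟨hk0, hk⟩, hklarge⟩ := ((hlam η hη0).and_eventually
    ((tendsto_natCast_atTop_atTop (R := ℝ)).eventually_gt_atTop
      ((t * (Real.log 2 + 1) + 1) / (h - t * (lam + η))))).exists
  have hden : 0 < h - t * (lam + η) := by linarith
  rw [div_lt_iff₀ hden] at hklarge
  obtain ⟨ρ, hρ, hmassk⟩ := hmass k hk0
  have ha : ∀ x, 0 < minStretch (Φ.wordDeriv k x) / 2 :=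
    fun x => half_pos (Φ.minStretch_wordDeriv_pos k x)
  have hac : ∀ x, minStretch (Φ.wordDeriv k x) / 2 ≤ 1 / 2 := fun x => by
    have h1 := (minStretch_le_norm (Φ.wordDeriv k x)).trans (hα k x).2
    have h2 : c ^ k ≤ 1 := pow_le_one₀ hc0.le hc1.le
    linarith
  have hRpos := fun n => orbitRadius_pos (T := leftShift^[k]) hρ ha n x
  refine eventually_le_mul_log_of_sequence (Φ.logMass_mono hpos) hRpos
    (squeeze_zero (fun n => (hRpos n).le) (fun n => orbitRadius_le hρ ha hac n x) ?_)
    (p := k * h - 1) (q := k * (lam + η) + Real.log 2 + 1) ?_ ?_ ht (by linarith)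
  · simpa using (tendsto_pow_atTop_nhds_zero_of_lt_one (show (0 : ℝ) ≤ 1 / 2 by norm_num)
      (by norm_num)).const_mul ρ
  · filter_upwards [hmassk 1 one_pos] with n hn
    linarith
  · filter_upwards [hk, (tendsto_natCast_atTop_atTop (R := ℝ)).eventually_gt_atTop
      (-Real.log ρ)] with n hn hnρ
    have h1 : birkhoffSum leftShift^[k] (fun x => Real.log (minStretch (Φ.wordDeriv k x) / 2)) n x =
        -birkhoffSum leftShift^[k] (-Φ.logMinStretch k) n x - n * Real.log 2 := by
      simp only [birkhoffSum, Pi.neg_apply, Finset.sum_neg_distrib, neg_neg, logMinStretch]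
      rw [Finset.sum_congr rfl fun j _ =>
        Real.log_div (Φ.minStretch_wordDeriv_pos k _).ne' two_ne_zero]
      simp
    rw [log_orbitRadius hρ ha, h1]
    linarith

theorem exists_two_mul_norm_wordDeriv_le : ∀ᶠ k : ℕ in atTop, ∃ c < 1, ∀ x,
    2 * ‖Φ.wordDeriv k x‖ ≤ c := by
  obtain ⟨α, c, hα0, hc0, hc1, hα⟩ := Φ.exists_pow_le_minStretch_norm_le_pow
  have h : Tendsto (fun k : ℕ => 2 * c ^ k) atTop (𝓝 0) := by
    simpa using (tendsto_pow_atTop_nhds_zero_of_lt_one hc0.le hc1).const_mul 2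
  filter_upwards [h.eventually (gt_mem_nhds one_pos)] with k hk
  exact ⟨2 * c ^ k, hk, fun x => mul_le_mul_of_nonneg_left (hα k x).2 two_pos.le⟩

/-- The upper bound for the local dimension, at a single point. -/
theorem eventually_mul_log_le_logMass {m : Measure (SymbolSpace ℓ)} [IsProbabilityMeasure m]
    {x : SymbolSpace ℓ}
    (hpos : ∀ r > 0, 0 < (m.map Φ.coding).real (Metric.closedBall (Φ.coding x) r)) {h lam t : ℝ}
    (hmass : ∀ k : ℕ, 0 < k → (∃ c < 1, ∀ x, 2 * ‖Φ.wordDeriv k x‖ ≤ c) →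
      ∃ ρ > 0, ∀ η > 0, ∀ᶠ n : ℕ in atTop, n * (-(k * h) - η) ≤
        Φ.logMass m x (orbitRadius leftShift^[k] (fun x => 2 * ‖Φ.wordDeriv k x‖) ρ n x))
    (hlam : ∀ η > 0, ∃ᶠ k : ℕ in atTop, 0 < k ∧ ∀ᶠ n : ℕ in atTop,
      birkhoffSum leftShift^[k] (Φ.logNorm k) n x ≤ n * (k * (-lam + η)))
    (ht : 0 ≤ t) (hth : h < t * lam) :
    ∀ᶠ r in 𝓝[>] (0 : ℝ), t * Real.log r ≤ Φ.logMass m x r := by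
  set η : ℝ := (t * lam - h) / (2 * (t + 1)) with hη
  have hη0 : 0 < η := div_pos (sub_pos.2 hth) (by positivity)
  have hηt : t * η < t * lam - h := by
    rw [hη, mul_div_assoc', div_lt_iff₀ (by positivity)]
    nlinarith
  -- The loss of a factor `2` for each block is negligible when the blocks are long.
  obtain ⟨k, ⟨hk0, hk⟩, hklarge, c, hc1, hc⟩ := ((hlam η hη0).and_eventually
    (((tendsto_natCast_atTop_atTop (R := ℝ)).eventually_gt_atTop
      ((t * (Real.log 2 + 1) + 1) / (t * (lam - η) - h))).and
        Φ.exists_two_mul_norm_wordDeriv_le)).exists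
  have hden : 0 < t * (lam - η) - h := by linarith
  rw [div_lt_iff₀ hden] at hklarge
  obtain ⟨ρ, hρ, hmassk⟩ := hmass k hk0 ⟨c, hc1, hc⟩
  have ha : ∀ x, 0 < 2 * ‖Φ.wordDeriv k x‖ := fun x => mul_pos two_pos (Φ.norm_wordDeriv_pos k x)
  have hRpos := fun n => orbitRadius_pos (T := leftShift^[k]) hρ ha n x
  refine eventually_mul_log_le_of_sequence (Φ.logMass_mono hpos) hRpos
    (squeeze_zero (fun n => (hRpos n).le) (fun n => orbitRadius_le hρ ha hc n x) ?_)
    (p := k * h + 1) (q := k * (lam - η) - Real.log 2 - 1) ?_ ?_ ht (by linarith)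
  · simpa using (tendsto_pow_atTop_nhds_zero_of_lt_one ((ha x).le.trans (hc x)) hc1).const_mul ρ
  · filter_upwards [hmassk 1 one_pos] with n hn
    linarith
  · filter_upwards [hk, (tendsto_natCast_atTop_atTop (R := ℝ)).eventually_gt_atTop
      (Real.log ρ)] with n hn hnρ
    have h1 : birkhoffSum leftShift^[k] (fun x => Real.log (2 * ‖Φ.wordDeriv k x‖)) n x =
        birkhoffSum leftShift^[k] (Φ.logNorm k) n x + n * Real.log 2 := by
      simp only [birkhoffSum, logNorm]
      rw [Finset.sum_congr rfl fun j _ =>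
        Real.log_mul two_ne_zero (Φ.norm_wordDeriv_pos k _).ne', Finset.sum_add_distrib]
      simp [add_comm]
    rw [log_orbitRadius hρ ha, h1]
    linarith

theorem nonneg_of_le_logMass {m : Measure (SymbolSpace ℓ)} [IsProbabilityMeasure m]
    {x : SymbolSpace ℓ} {h : ℝ}
    (hmass : ∀ k : ℕ, 0 < k → (∃ c < 1, ∀ x, 2 * ‖Φ.wordDeriv k x‖ ≤ c) →
      ∃ ρ > 0, ∀ η > 0, ∀ᶠ n : ℕ in atTop, n * (-(k * h) - η) ≤
        Φ.logMass m x (orbitRadius leftShift^[k] (fun x => 2 * ‖Φ.wordDeriv k x‖) ρ n x)) :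
    0 ≤ h := by
  obtain ⟨k, hk, hk0⟩ := (Φ.exists_two_mul_norm_wordDeriv_le.and (eventually_gt_atTop 0)).exists
  have hk' : (0 : ℝ) < k := by exact_mod_cast hk0
  obtain ⟨ρ, hρ, hη⟩ := hmass k hk0 hk
  refine nonneg_of_mul_nonneg_right (le_of_forall_pos_lt_add fun η hη0 => ?_) hk'
  obtain ⟨n, hn, hn0⟩ := ((hη (η / 2) (half_pos hη0)).and (eventually_gt_atTop 0)).exists
  have hn' : (0 : ℝ) < n := by exact_mod_cast hn0
  have h1 := nonpos_of_mul_nonpos_right (hn.trans (Φ.logMass_nonpos m x _)) hn'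
  linarith

theorem ae_tendsto_logMass_div_log {m : Measure (SymbolSpace ℓ)} [IsProbabilityMeasure m]
    (hm : MeasurePreserving leftShift m m) (hΦ : Φ.IsConformalFor m) :
    ∀ᵐ x ∂m, Tendsto (fun r => Φ.logMass m x r / Real.log r) (𝓝[>] 0)
      (𝓝 (Φ.localProjEntropy m x / Φ.lyapunov x)) := by
  obtain ⟨_, κ, hκ0, hκ⟩ := Φ.exists_log_bounds
  obtain ⟨C, hC0, hC⟩ := Φ.exists_abs_log_le
  have hlyap := fun x hx =>
    Φ.tendsto_log_div_of_upperLyapunov_eq (fun n x => (hκ n x).2) (x := x) hx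
  have hmin := ae_frequently_birkhoffSum_block_le hm (ψ := fun k => -Φ.logMinStretch k)
    (fun n => (Φ.measurable_logMinStretch n).neg)
    (fun n x => by rw [Pi.neg_apply, abs_neg]; exact (hC n x).1) Φ.neg_logMinStretch_add_le
    (θ := Φ.lyapunov) <| by
      filter_upwards [hΦ] with x hx
      simpa [neg_div] using (hlyap x hx).1.neg
  have hnorm := ae_frequently_birkhoffSum_block_le hm Φ.measurable_logNorm (fun n x => (hC n x).2)
    Φ.logNorm_add_le (θ := fun x => -Φ.lyapunov x) <| by
      filter_upwards [hΦ] with x hx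
      exact (hlyap x hx).2.1
  have hupp : ∀ᵐ x ∂m, ∀ k : ℕ, 0 < k → ∃ ρ > 0, ∀ η > 0, ∀ᶠ n : ℕ in atTop,
      Φ.logMass m x (orbitRadius leftShift^[k] (fun x => minStretch (Φ.wordDeriv k x) / 2) ρ n x) ≤
        n * (-(k * Φ.localProjEntropy m x) + η) := by
    refine ae_all_iff.2 fun k => ?_
    rcases k.eq_zero_or_pos with rfl | hk
    · exact Eventually.of_forall fun _ h => (lt_irrefl _ h).elim
    · obtain ⟨ρ, hρ, h⟩ := Φ.exists_ae_logMass_le hm hk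
      filter_upwards [h] with x hx _ using ⟨ρ, hρ, hx⟩
  have hlow : ∀ᵐ x ∂m, ∀ k : ℕ, 0 < k → (∃ c < 1, ∀ x, 2 * ‖Φ.wordDeriv k x‖ ≤ c) →
      ∃ ρ > 0, ∀ η > 0, ∀ᶠ n : ℕ in atTop, n * (-(k * Φ.localProjEntropy m x) - η) ≤
        Φ.logMass m x (orbitRadius leftShift^[k] (fun x => 2 * ‖Φ.wordDeriv k x‖) ρ n x) := by
    refine ae_all_iff.2 fun k => ?_
    by_cases hk : 0 < k ∧ ∃ c < 1, ∀ x, 2 * ‖Φ.wordDeriv k x‖ ≤ c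
    · obtain ⟨hk0, c, hc1, hc⟩ := hk
      obtain ⟨ρ, hρ, h⟩ := Φ.exists_ae_le_logMass hm hk0 hc1 hc
      filter_upwards [h] with x hx _ _ using ⟨ρ, hρ, hx⟩
    · exact Eventually.of_forall fun _ h1 h2 => (hk ⟨h1, h2⟩).elim
  filter_upwards [hΦ, hmin, hnorm, hupp, hlow, Φ.ae_block_measureReal_pos hm 0]
    with x hx hminx hnormx huppx hlowx hposx
  have hlam : 0 < Φ.lyapunov x := hκ0.trans_le (hlyap x hx).2.2.2
  have hh := Φ.nonneg_of_le_logMass hlowx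
  refine tendsto_div_log_of_eventually (Φ.logMass_nonpos m x) ?_ ?_
  · intro t ht hts
    rw [lt_div_iff₀ hlam] at hts
    exact Φ.eventually_logMass_le_mul_log hposx huppx hminx ht hts
  · intro t hts
    have ht : 0 ≤ t := (div_nonneg hh hlam.le).trans hts.le
    rw [div_lt_iff₀ hlam] at hts
    exact Φ.eventually_mul_log_le_logMass hposx hlowx hnormx ht hts

theorem integrable_lyapunov {m : Measure (SymbolSpace ℓ)} [IsProbabilityMeasure m]
    (hΦ : Φ.IsConformalFor m) : Integrable Φ.lyapunov m := by
  obtain ⟨_, κ, hκ0, hκ⟩ := Φ.exists_log_bounds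
  obtain ⟨C, hC0, hC⟩ := Φ.exists_abs_log_le
  have hlim : ∀ᵐ x ∂m, Tendsto (fun n : ℕ => -(Φ.logNorm n x / n)) atTop (𝓝 (Φ.lyapunov x)) := by
    filter_upwards [hΦ] with x hx
    simpa using (Φ.tendsto_log_div_of_upperLyapunov_eq (fun n x => (hκ n x).2) hx).2.1.neg
  refine Integrable.of_bound (aestronglyMeasurable_of_tendsto_ae atTop
    (fun n => (((Φ.measurable_logNorm n).div_const n).neg).aestronglyMeasurable) hlim) C ?_
  filter_upwards [hlim] with x hx
  refine le_of_tendsto' hx.norm fun n => ?_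
  rw [norm_neg, Real.norm_eq_abs, abs_div, Nat.abs_cast]
  exact div_le_of_le_mul₀ (Nat.cast_nonneg n) hC0 (hC n x).2

end C1IFS

/-! ### The ergodic case -/

namespace C1IFS

variable {d ℓ : ℕ} [NeZero ℓ] (Φ : C1IFS d ℓ)

theorem ae_localProjEntropy_eq_projEntropy {m : Measure (SymbolSpace ℓ)} [IsProbabilityMeasure m]
    (hm : Ergodic leftShift m) : ∀ᵐ x ∂m, Φ.localProjEntropy m x = Φ.projEntropy m := by
  have h1 : Φ.localProjEntropy m ∘ leftShift = Φ.localProjEntropy m :=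
    funext fun x => condExp_invariants_comp m leftShift _ x
  obtain ⟨c, hc⟩ := hm.ae_eq_const_of_ae_eq_comp_ae
    (integrable_condExp (m := MeasurableSpace.invariants leftShift) (μ := m)
      (f := Φ.infoIncrement m)).aestronglyMeasurable (Eventually.of_forall fun x => congrFun h1 x)
  have h2 : ∫ x, Φ.localProjEntropy m x ∂m = Φ.projEntropy m := by
    refine (integral_condExp (MeasurableSpace.invariants_le leftShift)).trans ?_
    exact integral_sub
      (integrable_condInformation Φ.shiftCodingSigma_le m measurableSet_firstCylinder)
      (integrable_condInformation Φ.codingSigma_le m measurableSet_firstCylinder)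
  have h3 : ∫ x, Φ.localProjEntropy m x ∂m = c := by
    refine (integral_congr_ae (g := fun _ => c) hc).trans ?_
    simp
  filter_upwards [hc] with x hx
  rw [← h2, h3]
  exact hx

/-- A constant local dimension along the coding map passes to the coded measure. -/
theorem ae_map_hasLocalDim_of_ae_tendsto {m : Measure (SymbolSpace ℓ)} [IsProbabilityMeasure m]
    {s : ℝ} (h : ∀ᵐ x ∂m, Tendsto (fun r => Φ.logMass m x r / Real.log r) (𝓝[>] 0) (𝓝 s)) :
    ∀ᵐ z ∂(m.map Φ.coding), HasLocalDim (m.map Φ.coding) z s := by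
  set μ := m.map Φ.coding with hμ
  have hprob : IsProbabilityMeasure μ :=
    Measure.isProbabilityMeasure_map Φ.measurable_coding.aemeasurable
  have hball : ∀ r, Measurable fun z => μ.real (Metric.closedBall z r) := fun r => by
    have hs : MeasurableSet {p : EuclideanSpace ℝ (Fin d) × EuclideanSpace ℝ (Fin d) |
        dist p.2 p.1 ≤ r} :=
      (isClosed_le (continuous_snd.dist continuous_fst) continuous_const).measurableSet
    exact (measurable_measure_prodMk_left (ν := μ) hs).ennreal_toReal
  have hR : Tendsto (fun n : ℕ => (1 / 2 : ℝ) ^ n) atTop (𝓝[>] 0) :=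
    tendsto_nhdsWithin_iff.2 ⟨tendsto_pow_atTop_nhds_zero_of_lt_one (by norm_num) (by norm_num),
      Eventually.of_forall fun n => show (0 : ℝ) < (1 / 2) ^ n by positivity⟩
  have hmeas : MeasurableSet {z | Tendsto (fun n : ℕ => Real.log
      (μ.real (Metric.closedBall z ((1 / 2) ^ n))) / Real.log ((1 / 2) ^ n)) atTop (𝓝 s)} :=
    measurableSet_tendsto _ fun n => (hball _).log.div_const _
  have h1 : ∀ᵐ z ∂μ, Tendsto (fun n : ℕ => Real.log
      (μ.real (Metric.closedBall z ((1 / 2) ^ n))) / Real.log ((1 / 2) ^ n)) atTop (𝓝 s) := by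
    rw [hμ, ae_map_iff Φ.measurable_coding.aemeasurable hmeas]
    filter_upwards [h] with x hx
    exact hx.comp hR
  filter_upwards [h1, ae_measure_closedBall_pos μ] with z hz hpos
  exact hasLocalDim_of_tendsto_dyadic
    (fun r hr => ENNReal.toReal_pos (hpos r hr).ne' (measure_ne_top _ _)) hz

variable [NeZero d]

/-- Subadditivity of `log ‖S_w'‖` bounds the exponent at `x` from below by the one at `σ x`, and
superadditivity of `log ⟦S_w'⟧` bounds it from above. -/
theorem ae_lyapunov_comp_leftShift {m : Measure (SymbolSpace ℓ)} [IsProbabilityMeasure m]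
    (hm : MeasurePreserving leftShift m m) (hΦ : Φ.IsConformalFor m) :
    Φ.lyapunov ∘ leftShift =ᵐ[m] Φ.lyapunov := by
  obtain ⟨_, κ, hκ0, hκ⟩ := Φ.exists_log_bounds
  have hlyap := fun x hx =>
    Φ.tendsto_log_div_of_upperLyapunov_eq (fun n x => (hκ n x).2) (x := x) hx
  have key : ∀ {u v : ℕ → ℝ} {a b e : ℝ}, Tendsto (fun n => u n / n) atTop (𝓝 a) →
      Tendsto (fun n => v n / n) atTop (𝓝 b) → (∀ n, u (1 + n) ≤ e + v n) → a ≤ b := by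
    intro u v a b e hu hv huv
    have h1 : Tendsto (fun n : ℕ => u (1 + n) / n) atTop (𝓝 a) := by
      have h2 : Tendsto (fun n : ℕ => 1 + 1 / (n : ℝ)) atTop (𝓝 (1 + 0)) :=
        tendsto_const_nhds.add tendsto_one_div_atTop_nhds_zero_nat
      have h3 := ((tendsto_add_atTop_iff_nat 1).2 hu).mul h2
      rw [add_zero, mul_one] at h3
      refine h3.congr' ?_
      filter_upwards [eventually_gt_atTop 0] with n hn
      have hn' : (0 : ℝ) < n := by exact_mod_cast hn
      rw [add_comm 1 n]
      push_cast
      field_simp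
    have h4 : Tendsto (fun n : ℕ => e / n + v n / n) atTop (𝓝 (0 + b)) :=
      (tendsto_const_div_atTop_nhds_zero_nat e).add hv
    rw [zero_add] at h4
    refine le_of_tendsto_of_tendsto' h1 h4 fun n => ?_
    rw [← add_div]
    exact div_le_div_of_nonneg_right (huv n) (Nat.cast_nonneg n)
  filter_upwards [hΦ, hm.quasiMeasurePreserving.ae hΦ] with x hx hx'
  have h1 := key (hlyap x hx).2.1 (hlyap _ hx').2.1 fun n => Φ.logNorm_add_le 1 n x
  have h2 := key (u := fun n => -Φ.logMinStretch n x)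
    (v := fun n => -Φ.logMinStretch n (leftShift x))
    (by simpa [neg_div] using (hlyap x hx).1.neg) (by simpa [neg_div] using (hlyap _ hx').1.neg)
    fun n => Φ.neg_logMinStretch_add_le 1 n x
  exact le_antisymm (neg_le_neg_iff.1 h1) h2

theorem ae_lyapunov_eq_integral {m : Measure (SymbolSpace ℓ)} [IsProbabilityMeasure m]
    (hm : Ergodic leftShift m) (hΦ : Φ.IsConformalFor m) :
    ∀ᵐ x ∂m, Φ.lyapunov x = ∫ y, Φ.lyapunov y ∂m := by
  obtain ⟨c, hc⟩ := hm.ae_eq_const_of_ae_eq_comp_ae (Φ.integrable_lyapunov hΦ).aestronglyMeasurable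
    (Φ.ae_lyapunov_comp_leftShift hm.toMeasurePreserving hΦ)
  have h3 : ∫ x, Φ.lyapunov x ∂m = c := by
    rw [integral_congr_ae (g := fun _ => c) hc]
    simp
  filter_upwards [hc] with x hx
  rw [h3]
  exact hx

end C1IFS

theorem mainTheorem1 {d ℓ : ℕ} [NeZero d] [NeZero ℓ] (Φ : C1IFS d ℓ) :
    (∀ m : Measure (SymbolSpace ℓ), IsInvariantMeasure m → Φ.IsConformalFor m →
      -- the local projection entropy and the Lyapunov exponent are well defined
      Integrable (condInformation Φ.shiftCodingSigma m firstCylinder) m ∧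
      Integrable (condInformation Φ.codingSigma m firstCylinder) m ∧
      Integrable Φ.lyapunov m ∧
      (∀ᵐ x ∂m, Φ.upperLyapunov x = (Φ.lyapunov x : EReal) ∧
        Φ.lowerLyapunov x = (Φ.lyapunov x : EReal) ∧ 0 < Φ.lyapunov x) ∧
      -- the local dimension of the projected measure
      (∀ᵐ x ∂m, HasLocalDim (m.map Φ.coding) (Φ.coding x)
        (Φ.localProjEntropy m x / Φ.lyapunov x)) ∧
      -- the ergodic case
      (Ergodic leftShift m →
        ∀ᵐ z ∂(m.map Φ.coding), HasLocalDim (m.map Φ.coding) z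
          (Φ.projEntropy m / ∫ x, Φ.lyapunov x ∂m))) ∧
    (Φ.IsWeaklyConformal →
      ∀ m : Measure (SymbolSpace ℓ), IsInvariantMeasure m → Φ.IsConformalFor m) := by
  refine ⟨fun m ⟨hprob, hm⟩ hΦ => ?_, fun hw m ⟨hprob, hm⟩ => hw.isConformalFor hm⟩
  have hlim := Φ.ae_tendsto_logMass_div_log hm hΦ
  refine ⟨integrable_condInformation Φ.shiftCodingSigma_le m C1IFS.measurableSet_firstCylinder,
    integrable_condInformation Φ.codingSigma_le m C1IFS.measurableSet_firstCylinder,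
    Φ.integrable_lyapunov hΦ, ?_, ?_, fun hE => Φ.ae_map_hasLocalDim_of_ae_tendsto ?_⟩
  · obtain ⟨_, κ, hκ0, hκ⟩ := Φ.exists_log_bounds
    filter_upwards [hΦ] with x hx
    have h := (Φ.tendsto_log_div_of_upperLyapunov_eq (fun n x => (hκ n x).2) hx).2.2
    exact ⟨h.1, hx ▸ h.1, hκ0.trans_le h.2⟩
  · have hmap : IsProbabilityMeasure (m.map Φ.coding) :=
      Measure.isProbabilityMeasure_map Φ.measurable_coding.aemeasurable
    filter_upwards [hlim, Φ.ae_block_measureReal_pos hm 0] with x hx hpos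
    exact hasLocalDim_of_tendsto hpos hx
  · filter_upwards [hlim, Φ.ae_localProjEntropy_eq_projEntropy hE,
      Φ.ae_lyapunov_eq_integral hE hΦ] with x hx h1 h2
    rwa [← h1, ← h2]
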